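/- **Setting.** A *factor* over a finite set $\mathbf X_i$ of discrete variables, each with a finite non-empty set of values, assigns a non-negative rational number to every instantiation of $\mathbf X_i$. An input is a finite family $f_1(\mathbf X_1),\dots,f_n(\mathbf X_n)$ of factors given as tables; put $\mathbf X=\mathbf X_1\cup\dots\cup\mathbf X_n$ and $f=f_1\cdots f_n$, a factor over $\mathbf X$. The *size* $s$ of the input is the number of bits of its encoding (numbers of values of the variables, variables of each factor, and numerator and denominator of each table entry, with one extra bit for each number written). For $\mathbf Y\subseteq\mathbf X$ and an instantiation $\mathbf y$ of $\mathbf Y$, the *marginal* is $f(\mathbf y)=\sum_{\mathbf x} f(\mathbf x)$ over the instantiations $\mathbf x$ of $\mathbf X$ that agree with $\mathbf y$. An *MPE* of $f$ is an instantiation $\mathbf x$ of $\mathbf X$ that maximizes $f(\mathbf x)$. An *arithmetic circuit* over $\mathbf X$ is a rooted DAG whose internal nodes are labelled $+$ or $*$ and whose leaves are labelled with indicators $\lambda_{X=x}$ ($x$ a value of $X\in\mathbf X$) or non-negative rational parameters. Its value at $\mathbf y$ is obtained by setting $\lambda_{X=x}=1$ if $\mathbf y$ assigns $x$ or nothing to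 $X$, and $\lambda_{X=x}=0$ otherwise. It *computes the marginals of $f$* if its value at $\mathbf y$ is $f(\mathbf y)$ for every instantiation $\mathbf y$ of every $\mathbf Y\subseteq\mathbf X$. Let $\mathrm{vars}(n)$ be the set of variables with an indicator at or under the node $n$. The circuit is *decomposable* if any two children $c_1,c_2$ of a $*$-node have $\mathrm{vars}(c_1)\cap\mathrm{vars}(c_2)=\emptyset$, and *smooth* if it contains an indicator of every variable in $\mathbf X$ and $\mathrm{vars}(c)=\mathrm{vars}(n)$ for every child $c$ of every $+$-node $n$. A circuit is output as the list of its nodes, children before parents. Algorithms are programs of a random access machine on natural numbers with unit-cost addition, truncated subtraction, halving, array access, tests for zero, and writing of one output number; running time is the worst-case number of steps. **Theorem.** There is a polynomial $p$ with natural coefficients such that the following holds. Let $\Xi$ be an algorithm that, on every input $f_1,\dots,f_n$, returns a decomposable and smooth arithmetic circuit that computes the marginals of $f=f_1\cdots f_n$, and let $t:\mathbb N\to\mathbb R$ be such that the running time of $\Xi$ on inputs of size $s$ is $O(t(s))$. Then there is an algorithm that, on every input $f_1,\dots,f_n$, returns an MPE of $f$, with running time $O(t(p(s)))$ on inputs of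 size $s$. -/

import Mathlib

/-! ## Probabilistic graphical models: finite families of tabular factors -/

namespace ArithCirc

/-- A factor in tabular form. `scope` lists its variables (variables are named by natural
numbers), `table` lists its values, row after row, the last variable of `scope` varying
fastest. -/
structure Factor where
  scope : List ℕ
  table : List ℚ≥0

/-- A finite family of factors. The variables are `0, …, dom.length - 1`, and the variable `X`
has the values `0, …, dom[X] - 1`. -/
structure Model where
  dom : List ℕ
  factors : List Factor

namespace Model

/-- The number of values of the variable `X`. -/
def card (M : Model) (X : ℕ) : ℕ := M.dom.getD X 0

/-- Every variable has a value; every factor is a full table over distinct variables of the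
model; and the variables of the model are exactly those of its factors. -/
structure WF (M : Model) : Prop where
  card_pos : ∀ d ∈ M.dom, 0 < d
  scope_nodup : ∀ f ∈ M.factors, f.scope.Nodup
  scope_lt : ∀ f ∈ M.factors, ∀ X ∈ f.scope, X < M.dom.length
  table_length : ∀ f ∈ M.factors, f.table.length = (f.scope.map M.card).prod
  covered : ∀ X < M.dom.length, ∃ f ∈ M.factors, X ∈ f.scope

/-- Instantiations of all the variables. -/
abbrev Inst (M : Model) : Type := (X : Fin M.dom.length) → Fin (M.card X)

/-- Instantiations of some of the variables (`none`: no value is assigned). -/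
abbrev PInst (M : Model) : Type := (X : Fin M.dom.length) → Option (Fin (M.card X))

/-- The value that an instantiation gives to the variable named `X`. -/
def Inst.get {M : Model} (x : M.Inst) (X : ℕ) : ℕ :=
  if h : X < M.dom.length then (x ⟨X, h⟩ : ℕ) else 0

/-- The position, in the table of a factor with the given scope, of the row of `x`. -/
def rowIndex (M : Model) (x : M.Inst) (scope : List ℕ) : ℕ :=
  scope.foldl (fun r X => r * M.card X + x.get X) 0

/-- The value of one factor at `x`. -/
def factorValue (M : Model) (f : Factor) (x : M.Inst) : ℚ≥0 :=
  f.table.getD (M.rowIndex x f.scope) 0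

/-- The value at `x` of the product of the factors. -/
def value (M : Model) (x : M.Inst) : ℚ≥0 :=
  (M.factors.map fun f => M.factorValue f x).prod

/-- `x` agrees with the partial instantiation `y`. -/
def Compatible {M : Model} (y : M.PInst) (x : M.Inst) : Prop :=
  ∀ X, y X = none ∨ y X = some (x X)

open Classical in
/-- The marginal at `y` of the product of the factors. -/
noncomputable def marginal (M : Model) (y : M.PInst) : ℚ≥0 :=
  ∑ x : M.Inst with Compatible y x, M.value x

/-- `x` is a most probable explanation, i.e. a maximizer of the product of the factors. -/
def IsMPE (M : Model) (x : M.Inst) : Prop := ∀ x' : M.Inst, M.value x' ≤ M.value x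

end Model

/-- A factor as a sequence of numbers; a rational is written as its numerator and denominator. -/
def Factor.encode (f : Factor) : List ℕ :=
  f.scope.length :: f.scope ++
    f.table.length :: f.table.flatMap (fun q => [q.num, q.den])

/-- A model as a sequence of numbers. -/
def Model.encode (M : Model) : List ℕ :=
  M.dom.length :: M.dom ++ M.factors.length :: M.factors.flatMap Factor.encode

/-- The size of a model: the total number of bits in its encoding, plus one for each number. -/
def Model.size (M : Model) : ℕ := (M.encode.map fun w => w.size + 1).sum

/-! ## Arithmetic circuits -/

/-- The node of a circuit: an indicator `λ_x` for the value `x` of the variable `X`, a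
nonnegative rational parameter `num / den`, or a `+`-node or `*`-node with its children. -/
inductive Node where
  | ind (X x : ℕ)
  | param (num den : ℕ)
  | add (children : List ℕ)
  | mul (children : List ℕ)

namespace Node

/-- The children of a node. -/
def children : Node → List ℕ
  | ind _ _ => []
  | param _ _ => []
  | add cs => cs
  | mul cs => cs

/-- A node as a sequence of numbers. -/
def encode : Node → List ℕ
  | ind X x => [0, X, x]
  | param a b => [1, a, b]
  | add cs => 2 :: cs.length :: cs
  | mul cs => 3 :: cs.length :: cs

/-- The value of a node from the circuit input `Λ` and the values `vs` of the earlier nodes. -/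
def value (Λ : ℕ → ℕ → ℚ≥0) (vs : List ℚ≥0) : Node → ℚ≥0
  | ind X x => Λ X x
  | param a b => (a : ℚ≥0) / (b : ℚ≥0)
  | add cs => (cs.map fun c => vs.getD c 0).sum
  | mul cs => (cs.map fun c => vs.getD c 0).prod

/-- The variables of a node from the variables `vs` of the earlier nodes. -/
def vars (vs : List (Finset ℕ)) : Node → Finset ℕ
  | ind X _ => {X}
  | param _ _ => ∅
  | add cs => cs.toFinset.biUnion fun c => vs.getD c ∅
  | mul cs => cs.toFinset.biUnion fun c => vs.getD c ∅

end Node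

/-- A circuit is the list of its nodes in a topological order, children before parents; a child
is given by its position in the list, and the root is the last node. -/
abbrev Circuit : Type := List Node

/-- Bottom-up evaluation: the list of the values of the nodes of `C`. -/
def bottomUp {α : Type} (step : List α → Node → α) (C : Circuit) : List α :=
  C.foldl (fun vs nd => vs ++ [step vs nd]) []

namespace Circuit

/-- `C` is a rooted DAG over the variables of `M`, with proper labels. -/
structure WF (M : Model) (C : Circuit) : Prop where
  ne_nil : C ≠ []
  ind_lt : ∀ X x, Node.ind X x ∈ C → X < M.dom.length ∧ x < M.card X
  den_ne : ∀ a b, Node.param a b ∈ C → b ≠ 0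
  add_ne : ∀ cs, Node.add cs ∈ C → cs ≠ []
  mul_ne : ∀ cs, Node.mul cs ∈ C → cs ≠ []
  child_lt : ∀ (i : ℕ) (nd : Node), C[i]? = some nd → ∀ c ∈ nd.children, c < i
  rooted : ∀ i : ℕ, i + 1 < C.length → ∃ nd ∈ C, i ∈ nd.children

/-- The value of the root under the circuit input `Λ`. -/
def eval (C : Circuit) (Λ : ℕ → ℕ → ℚ≥0) : ℚ≥0 :=
  (bottomUp (fun vs nd => nd.value Λ vs) C).getLastD 0

/-- The variables with an indicator at or under node `i`. -/
def vars (C : Circuit) (i : ℕ) : Finset ℕ :=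
  (bottomUp (fun vs nd => nd.vars vs) C).getD i ∅

/-- Children of the same `*`-node share no variable. -/
def Decomposable (C : Circuit) : Prop :=
  ∀ (i : ℕ) (cs : List ℕ), C[i]? = some (Node.mul cs) →
    cs.Pairwise fun c c' => Disjoint (C.vars c) (C.vars c')

/-- There is an indicator for every variable of the model, and a `+`-node has the same
variables as each of its children. -/
def Smooth (M : Model) (C : Circuit) : Prop :=
  (∀ X < M.dom.length, ∃ x, Node.ind X x ∈ C) ∧
    ∀ (i : ℕ) (cs : List ℕ), C[i]? = some (Node.add cs) → ∀ c ∈ cs, C.vars i = C.vars c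

end Circuit

open Classical in
/-- The circuit input at a partial instantiation `y`: the indicator `λ_x` is `1` if `x` is
compatible with `y`, and `0` otherwise. -/
noncomputable def Model.PInst.input {M : Model} (y : M.PInst) (X x : ℕ) : ℚ≥0 :=
  if ∃ h : X < M.dom.length, ∀ v, y ⟨X, h⟩ = some v → (v : ℕ) = x then 1 else 0

namespace Circuit

/-- `C` computes the marginals of the product of the factors of `M`. -/
def ComputesMarginals (M : Model) (C : Circuit) : Prop :=
  ∀ y : M.PInst, C.eval (Model.PInst.input y) = M.marginal y

/-- A circuit as a sequence of numbers. -/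
def encode (C : Circuit) : List ℕ := C.flatMap Node.encode

end Circuit

/-! ## Algorithms: structured programs of a random access machine with unit costs

Registers and memory cells hold natural numbers. There are finitely many arrays in a program,
each with random access. The arithmetic is addition, truncated subtraction and halving (there is
no multiplication, so that one step makes numbers longer by at most one bit). -/

/-- The registers, the arrays, and the output written so far. -/
structure State where
  reg : ℕ → ℕ
  mem : ℕ → ℕ → ℕ
  out : List ℕ

/-- Basic instructions. -/
inductive Instr where
  | const (d n : ℕ)
  | add (d a b : ℕ)
  | sub (d a b : ℕ)
  | half (d a : ℕ)
  | load (d A a : ℕ)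
  | store (A a b : ℕ)
  | emit (a : ℕ)

/-- The effect of a basic instruction. -/
def Instr.run (σ : State) : Instr → State
  | const d n => { σ with reg := Function.update σ.reg d n }
  | add d a b => { σ with reg := Function.update σ.reg d (σ.reg a + σ.reg b) }
  | sub d a b => { σ with reg := Function.update σ.reg d (σ.reg a - σ.reg b) }
  | half d a => { σ with reg := Function.update σ.reg d (σ.reg a / 2) }
  | load d A a => { σ with reg := Function.update σ.reg d (σ.mem A (σ.reg a)) }
  | store A a b =>
      { σ with mem := Function.update σ.mem A (Function.update (σ.mem A) (σ.reg a) (σ.reg b)) }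
  | emit a => { σ with out := σ.out ++ [σ.reg a] }

/-- Programs; a test asks whether a register is nonzero. -/
inductive Prog where
  | basic (i : Instr)
  | seq (P Q : Prog)
  | cond (r : ℕ) (P Q : Prog)
  | loop (r : ℕ) (P : Prog)

/-- `Exec P σ σ' k`: started in `σ`, the program `P` halts in `σ'` after `k` steps, where every
basic instruction and every test counts as one step. -/
inductive Exec : Prog → State → State → ℕ → Prop where
  | basic (i : Instr) (σ : State) : Exec (.basic i) σ (i.run σ) 1
  | seq {P Q : Prog} {σ σ' σ'' : State} {k l : ℕ} :
      Exec P σ σ' k → Exec Q σ' σ'' l → Exec (.seq P Q) σ σ'' (k + l)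
  | cond_true {r : ℕ} {P Q : Prog} {σ σ' : State} {k : ℕ} :
      σ.reg r ≠ 0 → Exec P σ σ' k → Exec (.cond r P Q) σ σ' (k + 1)
  | cond_false {r : ℕ} {P Q : Prog} {σ σ' : State} {k : ℕ} :
      σ.reg r = 0 → Exec Q σ σ' k → Exec (.cond r P Q) σ σ' (k + 1)
  | loop_done {r : ℕ} {P : Prog} {σ : State} :
      σ.reg r = 0 → Exec (.loop r P) σ σ 1
  | loop_step {r : ℕ} {P : Prog} {σ σ' σ'' : State} {k l : ℕ} :
      σ.reg r ≠ 0 → Exec P σ σ' k → Exec (.loop r P) σ' σ'' l →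
        Exec (.loop r P) σ σ'' (k + l + 1)

/-- The initial state on input `w`: array `0` holds `w`, register `0` holds its length, and
everything else is `0`. -/
def State.init (w : List ℕ) : State where
  reg := fun r => if r = 0 then w.length else 0
  mem := fun A i => if A = 0 then w.getD i 0 else 0
  out := []

/-- On every family of factors the program `P` halts with an output as prescribed by `spec`, and
its worst-case running time on inputs of size `s` is `O(t(s))`. -/
def SolvesInTime (spec : Model → List ℕ → Prop) (P : Prog) (t : ℕ → ℝ) : Prop :=
  ∃ T : ℕ → ℕ,
    (∀ M : Model, M.WF → ∃ σ k, Exec P (State.init M.encode) σ k ∧ spec M σ.out ∧ k ≤ T M.size) ∧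
      (fun s => (T s : ℝ)) =O[Filter.atTop] t

/-- The output is a decomposable and smooth arithmetic circuit that computes the marginals of
the product of the factors. -/
def CompilationSpec (M : Model) (out : List ℕ) : Prop :=
  ∃ C : Circuit, out = C.encode ∧ C.WF M ∧ C.Decomposable ∧ C.Smooth M ∧ C.ComputesMarginals M

/-- The output is a most probable explanation, as the list of the values of the variables. -/
def MPESpec (M : Model) (out : List ℕ) : Prop :=
  ∃ x : M.Inst, out = List.ofFn (fun X => (x X : ℕ)) ∧ M.IsMPE x

end ArithCirc

/-! A decomposable and smooth circuit is a compact sum of products in which each product carries one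
indicator for every variable. All numbers are nonnegative, so nothing cancels, and the
instantiations at which the circuit is nonzero are exactly those whose indicators occur together in
a product with nonzero parameters. Now let `+` maximize, let nonzero parameters count as `1`, and
give the indicators arbitrary weights. The root then holds the largest product of weights over the
support of the function (`Circuit.prod_le_root`, `Circuit.exists_root_eq`). Decomposability lets
instantiations of the children of a `*`-node be glued; smoothness makes each child of a `+`-node
speak about all variables of that node. The circuit's own parameters are discarded on purpose: the
circuit need not be deterministic, so the value of one instantiation may be spread over several
products, and maximizing over products would be wrong. Only the support can be trusted.

The values of the factors therefore have to move from the parameters into the weights. In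
`Model.expand` each factor is replaced by an identity matrix linking its scope to a new variable
that names the selected row. The support becomes the graph of the map from instantiations to rows
(`Model.expand_value_ne_zero`), and the value of an instantiation is the product of the weights of
its row indicators, each weight being a table entry.

Weights are handled as powers of two, so that a product costs one addition of exponents. The
exponents are integer approximations of scaled logarithms, computed by repeated squaring with a
truncated mantissa (`ilog_bounds`). The products to be compared are built from numbers of at most
`s` bits in total per instantiation, hence precision linear in `s` orders them without error
(`prod_le_of_sum_ilog_le`). Below the logarithms the exponents have room for the values of the
original variables, as digits in base `2 ^ s`; these break ties only. So the code of the root not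
only identifies the maximum but spells out a maximizer, and no traceback through the circuit is
needed (`Model.exists_isMPE`).

For the running time nothing is known about `t`, neither monotonicity nor growth. One dummy variable
with `s ^ 4` values solves both problems. Every one of its values occurs in the support, so the
circuit contains at least `s ^ 4` indicators, and the compiler must spend as many steps writing them
(`Model.le_length_of_computesMarginals`); this pays for all the additional work. One table entry `2
^ j` of the dummy's factor pads the encoding to exactly `64 * s ^ 4` bits (`Model.target_size`), so
the compiler's bound is used at precisely that argument. The remainder is a verified machine
program: preprocessing (`runs_preProg`), simulation of the compiler (`exec_shift`), evaluation
linear in the length of the circuit (`runs_evalProg`), and reading off digits (`runs_decodeProg`).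
-/

namespace ArithCirc

/-! ## Bottom-up evaluation of circuits -/

section BottomUp

variable {α : Type} (step : List α → Node → α)

theorem bottomUp_append_singleton (C : Circuit) (nd : Node) :
    bottomUp step (C ++ [nd]) = bottomUp step C ++ [step (bottomUp step C) nd] := by
  simp [bottomUp]

theorem length_bottomUp (C : Circuit) : (bottomUp step C).length = C.length := by
  induction C using List.reverseRecOn with
  | nil => simp [bottomUp]
  | append_singleton C nd ih => simp [bottomUp_append_singleton, ih]

/-- The list grows only at its end, so the entry of node `i` is fixed when it is appended, and
`step` has then seen just the prefix of length `i`. -/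
theorem bottomUp_getElem? (C : Circuit) {i : ℕ} {nd : Node} (h : C[i]? = some nd) :
    (bottomUp step C)[i]? = some (step ((bottomUp step C).take i) nd) := by
  induction C using List.reverseRecOn with
  | nil => simp at h
  | append_singleton C nd' ih =>
    have hlen := length_bottomUp step C
    rw [bottomUp_append_singleton]
    rcases lt_trichotomy i C.length with hi | hi | hi
    · rw [List.getElem?_append_left hi] at h
      rw [List.getElem?_append_left (by omega), ih h, List.take_append_of_le_length (by omega)]
    · subst hi
      simp at h
      subst h
      rw [← hlen]
      simp
    · rw [List.getElem?_eq_none (by simp; omega)] at h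
      simp at h

theorem bottomUp_getD (C : Circuit) {i : ℕ} {nd : Node} (h : C[i]? = some nd) (d : α) :
    (bottomUp step C).getD i d = step ((bottomUp step C).take i) nd := by
  rw [List.getD_eq_getElem?_getD, bottomUp_getElem? step C h, Option.getD_some]

theorem getD_take {l : List α} {i c : ℕ} (h : c < i) (d : α) :
    (l.take i).getD c d = l.getD c d := by
  simp [List.getD_eq_getElem?_getD, h]

end BottomUp

/-- The value of a node in the max-product semantics: `+`-nodes maximize, nonzero parameters
count as `1`, and the indicator `λ_x` of the variable `X` has the value `ω X x`. -/
def Node.maxValue (ω : ℕ → ℕ → ℕ) (vs : List ℕ) : Node → ℕ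
  | .ind X x => ω X x
  | .param a _ => if a = 0 then 0 else 1
  | .add cs => (cs.map fun c => vs.getD c 0).foldr max 0
  | .mul cs => (cs.map fun c => vs.getD c 0).prod

namespace Circuit

/-- The value of node `i` under the circuit input `Λ`. -/
def nodeVal (C : Circuit) (Λ : ℕ → ℕ → ℚ≥0) (i : ℕ) : ℚ≥0 :=
  (bottomUp (fun vs nd => nd.value Λ vs) C).getD i 0

/-- The value of node `i` in the max-product semantics. -/
def nodeMax (C : Circuit) (ω : ℕ → ℕ → ℕ) (i : ℕ) : ℕ :=
  (bottomUp (fun vs nd => nd.maxValue ω vs) C).getD i 0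

theorem eval_eq_nodeVal (C : Circuit) (Λ : ℕ → ℕ → ℚ≥0) :
    C.eval Λ = C.nodeVal Λ (C.length - 1) := by
  unfold eval nodeVal
  rw [← length_bottomUp (fun vs nd => nd.value Λ vs) C]
  generalize bottomUp (fun vs nd => nd.value Λ vs) C = l
  rw [List.getLastD_eq_getLast?, List.getLast?_eq_getElem?, List.getD_eq_getElem?_getD]

/-! ### Recursive equations for values, max-product values and variables. -/

section Equations

variable {C : Circuit} {i : ℕ} (Λ : ℕ → ℕ → ℚ≥0) (ω : ℕ → ℕ → ℕ)

theorem nodeVal_ind {X x : ℕ} (h : C[i]? = some (.ind X x)) : C.nodeVal Λ i = Λ X x :=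
  bottomUp_getD _ C h 0

theorem nodeVal_param {a b : ℕ} (h : C[i]? = some (.param a b)) :
    C.nodeVal Λ i = (a : ℚ≥0) / (b : ℚ≥0) :=
  bottomUp_getD _ C h 0

theorem nodeVal_add {cs : List ℕ} (h : C[i]? = some (.add cs)) (hc : ∀ c ∈ cs, c < i) :
    C.nodeVal Λ i = (cs.map (C.nodeVal Λ)).sum := by
  refine (bottomUp_getD _ C h 0).trans ?_
  simp only [Node.value]
  congr 1
  exact List.map_congr_left fun c hcs => getD_take (hc c hcs) 0

theorem nodeVal_mul {cs : List ℕ} (h : C[i]? = some (.mul cs)) (hc : ∀ c ∈ cs, c < i) :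
    C.nodeVal Λ i = (cs.map (C.nodeVal Λ)).prod := by
  refine (bottomUp_getD _ C h 0).trans ?_
  simp only [Node.value]
  congr 1
  exact List.map_congr_left fun c hcs => getD_take (hc c hcs) 0

theorem nodeMax_ind {X x : ℕ} (h : C[i]? = some (.ind X x)) : C.nodeMax ω i = ω X x :=
  bottomUp_getD _ C h 0

theorem nodeMax_param {a b : ℕ} (h : C[i]? = some (.param a b)) :
    C.nodeMax ω i = if a = 0 then 0 else 1 :=
  bottomUp_getD _ C h 0

theorem nodeMax_add {cs : List ℕ} (h : C[i]? = some (.add cs)) (hc : ∀ c ∈ cs, c < i) :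
    C.nodeMax ω i = (cs.map (C.nodeMax ω)).foldr max 0 := by
  refine (bottomUp_getD _ C h 0).trans ?_
  simp only [Node.maxValue]
  congr 1
  exact List.map_congr_left fun c hcs => getD_take (hc c hcs) 0

theorem nodeMax_mul {cs : List ℕ} (h : C[i]? = some (.mul cs)) (hc : ∀ c ∈ cs, c < i) :
    C.nodeMax ω i = (cs.map (C.nodeMax ω)).prod := by
  refine (bottomUp_getD _ C h 0).trans ?_
  simp only [Node.maxValue]
  congr 1
  exact List.map_congr_left fun c hcs => getD_take (hc c hcs) 0

theorem vars_ind {X x : ℕ} (h : C[i]? = some (.ind X x)) : C.vars i = {X} :=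
  bottomUp_getD _ C h ∅

theorem vars_param {a b : ℕ} (h : C[i]? = some (.param a b)) : C.vars i = ∅ :=
  bottomUp_getD _ C h ∅

theorem mem_vars_of_children {nd : Node} (h : C[i]? = some nd) (hc : ∀ c ∈ nd.children, c < i)
    (hne : nd.children ≠ []) (X : ℕ) : X ∈ C.vars i ↔ ∃ c ∈ nd.children, X ∈ C.vars c := by
  have key : C.vars i = nd.children.toFinset.biUnion C.vars := by
    refine (bottomUp_getD _ C h ∅).trans ?_
    cases nd with
    | ind X x => simp [Node.children] at hne
    | param a b => simp [Node.children] at hne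
    | add cs | mul cs =>
      simp only [Node.vars, Node.children]
      exact Finset.biUnion_congr rfl fun c hcs => getD_take (hc c (List.mem_toFinset.1 hcs)) ∅
  simp [key]

end Equations

/-- The circuit input at a total assignment of values. -/
def point (x : ℕ → ℕ) (X v : ℕ) : ℚ≥0 := if x X = v then 1 else 0

/-- Multiplicativity over a disjoint union. A child listed twice is harmless: its variable set is
then disjoint from itself, hence empty. -/
theorem prod_biUnion_of_pairwise {V : ℕ → Finset ℕ} {cs : List ℕ} {U : Finset ℕ}
    (hp : cs.Pairwise fun c c' => Disjoint (V c) (V c'))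
    (hU : ∀ X, X ∈ U ↔ ∃ c ∈ cs, X ∈ V c) (g : ℕ → ℕ) :
    ∏ X ∈ U, g X = (cs.map fun c => ∏ X ∈ V c, g X).prod := by
  induction cs generalizing U with
  | nil =>
    have : U = ∅ := by ext X; simp [hU]
    simp [this]
  | cons c cs ih =>
    rw [List.pairwise_cons] at hp
    have hU' : U = V c ∪ cs.toFinset.biUnion V := by ext X; simp [hU]
    have hd : Disjoint (V c) (cs.toFinset.biUnion V) := by
      rw [Finset.disjoint_biUnion_right]
      intro c' hc'
      exact hp.1 c' (by simpa using hc')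
    rw [hU', Finset.prod_union hd, List.map_cons, List.prod_cons,
      ih hp.2 (U := cs.toFinset.biUnion V) (by simp)]

theorem le_foldr_max {l : List ℕ} {a : ℕ} (h : a ∈ l) : a ≤ l.foldr max 0 := by
  induction l with
  | nil => simp at h
  | cons b l ih =>
    rcases List.mem_cons.1 h with rfl | h
    · simp
    · exact (ih h).trans (le_max_right _ _)

/-- A nonzero maximum cannot come from the starting value `0` of the fold. -/
theorem foldr_max_mem {l : List ℕ} (h : l.foldr max 0 ≠ 0) : l.foldr max 0 ∈ l := by
  induction l with
  | nil => simp at h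
  | cons b l ih =>
    simp only [List.foldr_cons] at h ⊢
    rcases le_total b (l.foldr max 0) with hb | hb
    · rw [max_eq_right hb] at h ⊢
      exact List.mem_cons_of_mem _ (ih h)
    · rw [max_eq_left hb]
      exact List.mem_cons_self

/-! ### Max-product evaluation and the support of the circuit. -/

section Semantics

variable {M : Model} {C : Circuit}

/-- A node sees the input only through the variables under it; an instantiation may be altered
elsewhere, as gluing requires. -/
theorem nodeVal_congr (hC : C.WF M) {Λ Λ' : ℕ → ℕ → ℚ≥0} {i : ℕ} (hi : i < C.length)
    (h : ∀ X ∈ C.vars i, Λ X = Λ' X) : C.nodeVal Λ i = C.nodeVal Λ' i := by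
  induction i using Nat.strong_induction_on with
  | _ i ih =>
    obtain ⟨nd, hnd⟩ : ∃ nd, C[i]? = some nd := ⟨C[i], List.getElem?_eq_getElem hi⟩
    have hmem : nd ∈ C := List.mem_of_getElem? hnd
    have hlt := hC.child_lt i nd hnd
    have hch : nd.children ≠ [] → ∀ c ∈ nd.children, C.nodeVal Λ c = C.nodeVal Λ' c := by
      intro hne c hc
      refine ih c (hlt c hc) ((hlt c hc).trans hi) fun X hX => h X ?_
      exact (mem_vars_of_children hnd hlt hne X).2 ⟨c, hc, hX⟩
    cases nd with
    | ind X x => rw [nodeVal_ind _ hnd, nodeVal_ind _ hnd, h X (by simp [vars_ind hnd])]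
    | param a b => rw [nodeVal_param _ hnd, nodeVal_param _ hnd]
    | add cs =>
      rw [nodeVal_add _ hnd hlt, nodeVal_add _ hnd hlt,
        List.map_congr_left (l := cs) (hch (hC.add_ne cs hmem))]
    | mul cs =>
      rw [nodeVal_mul _ hnd hlt, nodeVal_mul _ hnd hlt,
        List.map_congr_left (l := cs) (hch (hC.mul_ne cs hmem))]

/-- Every instantiation on which a node is nonzero uses indicators of the circuit only, and its
weight is a lower bound for the value of the node in the max-product semantics. -/
theorem prod_le_nodeMax (hC : C.WF M) (hd : C.Decomposable) (hs : C.Smooth M) (ω : ℕ → ℕ → ℕ)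
    (x : ℕ → ℕ)
    {i : ℕ} (hi : i < C.length) (h : C.nodeVal (point x) i ≠ 0) :
    (∀ X ∈ C.vars i, Node.ind X (x X) ∈ C) ∧ ∏ X ∈ C.vars i, ω X (x X) ≤ C.nodeMax ω i := by
  induction i using Nat.strong_induction_on with
  | _ i ih =>
    obtain ⟨nd, hnd⟩ : ∃ nd, C[i]? = some nd := ⟨C[i], List.getElem?_eq_getElem hi⟩
    have hmem : nd ∈ C := List.mem_of_getElem? hnd
    have hlt := hC.child_lt i nd hnd
    cases nd with
    | ind X v =>
      rw [nodeVal_ind _ hnd] at h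
      have hv : x X = v := by
        by_contra hne
        exact h (by simp [point, hne])
      rw [vars_ind hnd, nodeMax_ind _ hnd]
      subst hv
      simpa using hmem
    | param a b =>
      rw [nodeVal_param _ hnd] at h
      have ha : a ≠ 0 := by rintro rfl; simp at h
      simp [vars_param hnd, nodeMax_param _ hnd, ha]
    | add cs =>
      rw [nodeVal_add _ hnd hlt] at h
      obtain ⟨c, hc, hc0⟩ : ∃ c ∈ cs, C.nodeVal (point x) c ≠ 0 := by
        by_contra! hall
        exact h (List.sum_eq_zero (by simpa using hall))
      have hci : c < i := hlt c hc
      -- By smoothness one nonzero child already has all variables of the `+`-node, so its product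
      -- of weights is the one wanted.
      rw [hs.2 i cs hnd c hc, nodeMax_add _ hnd hlt]
      obtain ⟨h1, h2⟩ := ih c hci (hci.trans hi) hc0
      exact ⟨h1, h2.trans (le_foldr_max (List.mem_map_of_mem hc))⟩
    | mul cs =>
      rw [nodeVal_mul _ hnd hlt] at h
      have hc0 : ∀ c ∈ cs, C.nodeVal (point x) c ≠ 0 := by
        intro c hc h0
        exact h (List.prod_eq_zero (h0 ▸ List.mem_map_of_mem hc))
      have hv := mem_vars_of_children hnd hlt (hC.mul_ne cs hmem)
      have hih := fun c hc => ih c (hlt c hc) ((hlt c hc).trans hi) (hc0 c hc)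
      refine ⟨fun X hX => ?_, ?_⟩
      · obtain ⟨c, hc, hX⟩ := (hv X).1 hX
        exact (hih c hc).1 X hX
      · rw [prod_biUnion_of_pairwise (hd i cs hnd) hv, nodeMax_mul _ hnd hlt]
        exact List.prod_le_prod' fun c hc => (hih c hc).2

/-- Decomposability in use: instantiations chosen separately for the children of a `*`-node cannot
conflict, so they merge into one. -/
theorem exists_glue {V : ℕ → Finset ℕ} {cs : List ℕ}
    (hp : cs.Pairwise fun c c' => Disjoint (V c) (V c')) (g : ℕ → ℕ → ℕ) :
    ∃ x : ℕ → ℕ, ∀ c ∈ cs, ∀ X ∈ V c, x X = g c X := by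
  induction cs with
  | nil => exact ⟨fun _ => 0, by simp⟩
  | cons c cs ih =>
    rw [List.pairwise_cons] at hp
    obtain ⟨x, hx⟩ := ih hp.2
    refine ⟨fun X => if X ∈ V c then g c X else x X, fun c' hc' X hX => ?_⟩
    rcases List.mem_cons.1 hc' with rfl | hc'
    · simp [hX]
    · have : X ∉ V c := fun hX' => Finset.disjoint_left.1 (hp.1 c' hc') hX' hX
      simp [this, hx c' hc' X hX]

/-- A nonzero value in the max-product semantics is the weight of an instantiation on which the
node is nonzero. -/
theorem exists_nodeMax_eq (hC : C.WF M) (hd : C.Decomposable) (hs : C.Smooth M) (ω : ℕ → ℕ → ℕ)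
    {i : ℕ} (hi : i < C.length) (h : C.nodeMax ω i ≠ 0) :
    ∃ x : ℕ → ℕ, C.nodeVal (point x) i ≠ 0 ∧ C.nodeMax ω i = ∏ X ∈ C.vars i, ω X (x X) := by
  induction i using Nat.strong_induction_on with
  | _ i ih =>
    obtain ⟨nd, hnd⟩ : ∃ nd, C[i]? = some nd := ⟨C[i], List.getElem?_eq_getElem hi⟩
    have hmem : nd ∈ C := List.mem_of_getElem? hnd
    have hlt := hC.child_lt i nd hnd
    cases nd with
    | ind X v => exact ⟨fun _ => v, by simp [nodeVal_ind _ hnd, point],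
        by simp [vars_ind hnd, nodeMax_ind _ hnd]⟩
    | param a b =>
      rw [nodeMax_param _ hnd] at h
      have ha : a ≠ 0 := by rintro rfl; simp at h
      refine ⟨fun _ => 0, ?_, by simp [vars_param hnd, nodeMax_param _ hnd, ha]⟩
      rw [nodeVal_param _ hnd]
      exact div_ne_zero (by exact_mod_cast ha) (by exact_mod_cast hC.den_ne a b hmem)
    | add cs =>
      rw [nodeMax_add _ hnd hlt] at h ⊢
      obtain ⟨c, hc, hcv⟩ := List.mem_map.1 (foldr_max_mem h)
      rw [← hcv] at h ⊢
      have hci : c < i := hlt c hc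
      obtain ⟨x, hx0, hx⟩ := ih c hci (hci.trans hi) h
      refine ⟨x, ?_, by rw [hx, hs.2 i cs hnd c hc]⟩
      rw [nodeVal_add _ hnd hlt]
      -- No cancellation: values are nonnegative, so one nonzero child makes the sum nonzero.
      have := List.single_le_sum (l := cs.map (C.nodeVal (point x))) (by simp)
        _ (List.mem_map_of_mem hc)
      exact (lt_of_lt_of_le (pos_of_ne_zero hx0) this).ne'
    | mul cs =>
      rw [nodeMax_mul _ hnd hlt] at h ⊢
      have hc0 : ∀ c ∈ cs, C.nodeMax ω c ≠ 0 := by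
        intro c hc h0
        exact h (List.prod_eq_zero (h0 ▸ List.mem_map_of_mem hc))
      have hih : ∀ c, ∃ x : ℕ → ℕ, c ∈ cs → C.nodeVal (point x) c ≠ 0 ∧
          C.nodeMax ω c = ∏ X ∈ C.vars c, ω X (x X) := by
        intro c
        by_cases hc : c ∈ cs
        · obtain ⟨x, hx⟩ := ih c (hlt c hc) ((hlt c hc).trans hi) (hc0 c hc)
          exact ⟨x, fun _ => hx⟩
        · exact ⟨fun _ => 0, fun h => absurd h hc⟩
      choose g hg using hih
      obtain ⟨x, hx⟩ := exists_glue (hd i cs hnd) g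
      refine ⟨x, ?_, ?_⟩
      · rw [nodeVal_mul _ hnd hlt]
        refine List.prod_ne_zero fun h0 => ?_
        obtain ⟨c, hc, hcv⟩ := List.mem_map.1 h0
        refine (hg c hc).1 ?_
        rw [← hcv]
        refine nodeVal_congr hC ((hlt c hc).trans hi) fun X hX => ?_
        funext v
        simp [point, hx c hc X hX]
      · rw [prod_biUnion_of_pairwise (hd i cs hnd)
          (mem_vars_of_children hnd hlt (hC.mul_ne cs hmem))]
        congr 1
        refine List.map_congr_left fun c hc => ?_
        rw [(hg c hc).2]
        exact Finset.prod_congr rfl fun X hX => by rw [hx c hc X hX]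

/-- Every node but the last has a parent, which stands later in the list. Climbing ends at the root,
and variable sets only grow on the way. -/
theorem vars_subset_root (hC : C.WF M) {i : ℕ} (hi : i < C.length) :
    C.vars i ⊆ C.vars (C.length - 1) := by
  induction hk : C.length - i using Nat.strong_induction_on generalizing i with
  | _ k ih =>
    by_cases hr : i + 1 < C.length
    · obtain ⟨nd, hnd, hch⟩ := hC.rooted i hr
      obtain ⟨j, hj⟩ := List.mem_iff_getElem?.1 hnd
      have hjl : j < C.length := (List.getElem?_eq_some_iff.1 hj).1
      have hij := hC.child_lt j nd hj i hch
      refine Finset.Subset.trans (fun X hX => ?_) (ih (C.length - j) (by omega) hjl rfl)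
      exact (mem_vars_of_children hj (hC.child_lt j nd hj) (List.ne_nil_of_mem hch) X).2
        ⟨i, hch, hX⟩
    · rw [show i = C.length - 1 by omega]

theorem vars_subset_range (hC : C.WF M) {i : ℕ} (hi : i < C.length) :
    C.vars i ⊆ Finset.range M.dom.length := by
  induction i using Nat.strong_induction_on with
  | _ i ih =>
    obtain ⟨nd, hnd⟩ : ∃ nd, C[i]? = some nd := ⟨C[i], List.getElem?_eq_getElem hi⟩
    have hmem : nd ∈ C := List.mem_of_getElem? hnd
    have hlt := hC.child_lt i nd hnd
    by_cases hne : nd.children = []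
    · cases nd with
      | ind X x => simpa [vars_ind hnd] using (hC.ind_lt X x hmem).1
      | param a b => simp [vars_param hnd]
      | add cs => exact absurd hne (hC.add_ne cs hmem)
      | mul cs => exact absurd hne (hC.mul_ne cs hmem)
    · intro X hX
      obtain ⟨c, hc, hX⟩ := (mem_vars_of_children hnd hlt hne X).1 hX
      exact ih c (hlt c hc) ((hlt c hc).trans hi) hX

theorem vars_root (hC : C.WF M) (hs : C.Smooth M) :
    C.vars (C.length - 1) = Finset.range M.dom.length := by
  refine Finset.Subset.antisymm (vars_subset_range hC ?_) fun X hX => ?_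
  · exact Nat.sub_lt (List.length_pos_of_ne_nil hC.ne_nil) one_pos
  · obtain ⟨x, hx⟩ := hs.1 X (by simpa using hX)
    obtain ⟨i, hi⟩ := List.mem_iff_getElem?.1 hx
    exact vars_subset_root hC (List.getElem?_eq_some_iff.1 hi).1 (by simp [vars_ind hi])

/-- At a full instantiation, a circuit that computes the marginals has the value of the model. -/
theorem nodeVal_root_eq (hC : C.WF M) (hm : C.ComputesMarginals M) (x : M.Inst) :
    C.nodeVal (point x.get) (C.length - 1) = M.value x := by
  have hl : C.length - 1 < C.length :=
    Nat.sub_lt (List.length_pos_of_ne_nil hC.ne_nil) one_pos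
  have h := hm fun X => some (x X)
  rw [eval_eq_nodeVal] at h
  have h1 : M.marginal (fun X => some (x X)) = M.value x := by
    classical
    unfold Model.marginal
    rw [Finset.sum_eq_single x]
    · intro y hy hyx
      refine absurd (funext fun X => ?_) hyx
      simpa [Model.Compatible, eq_comm] using (Finset.mem_filter.1 hy).2 X
    · intro hx
      simp [Model.Compatible] at hx
  rw [← h1, ← h]
  -- `point` and the circuit input of the marginal agree on the variables of the model only, and
  -- these are all that the root sees.
  refine nodeVal_congr hC hl fun X hX => ?_
  have hX' : X < M.dom.length := by simpa using vars_subset_range hC hl hX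
  funext v
  simp [point, Model.PInst.input, Model.Inst.get, hX']

/-- The max-product value of the root bounds the weights of the instantiations in the support. -/
theorem prod_le_root (hC : C.WF M) (hd : C.Decomposable) (hs : C.Smooth M)
    (hm : C.ComputesMarginals M)
    (ω : ℕ → ℕ → ℕ) (x : M.Inst) (hx : M.value x ≠ 0) :
    (∀ X < M.dom.length, Node.ind X (x.get X) ∈ C) ∧
      ∏ X ∈ Finset.range M.dom.length, ω X (x.get X) ≤ C.nodeMax ω (C.length - 1) := by
  have hl : C.length - 1 < C.length :=
    Nat.sub_lt (List.length_pos_of_ne_nil hC.ne_nil) one_pos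
  have h := prod_le_nodeMax hC hd hs ω x.get hl (by rwa [nodeVal_root_eq hC hm])
  rw [vars_root hC hs] at h
  exact ⟨fun X hX => h.1 X (by simpa using hX), h.2⟩

/-- A nonzero max-product value of the root is attained in the support. -/
theorem exists_root_eq (hC : C.WF M) (hd : C.Decomposable) (hs : C.Smooth M)
    (hm : C.ComputesMarginals M)
    (ω : ℕ → ℕ → ℕ) (h : C.nodeMax ω (C.length - 1) ≠ 0) :
    ∃ x : M.Inst, M.value x ≠ 0 ∧
      C.nodeMax ω (C.length - 1) = ∏ X ∈ Finset.range M.dom.length, ω X (x.get X) := by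
  have hl : C.length - 1 < C.length :=
    Nat.sub_lt (List.length_pos_of_ne_nil hC.ne_nil) one_pos
  obtain ⟨g, hg0, hg⟩ := exists_nodeMax_eq hC hd hs ω hl h
  have hv := vars_root hC hs
  have hind := (prod_le_nodeMax hC hd hs ω g hl hg0).1
  rw [hv] at hind hg
  -- The values of `g` lie in the domains because the corresponding indicators occur in the circuit,
  -- whose labels are proper.
  let x : M.Inst := fun X => ⟨g X, (hC.ind_lt X (g X) (hind X (by simp))).2⟩
  have hxg : ∀ X < M.dom.length, x.get X = g X := fun X hX => by simp [Model.Inst.get, hX, x]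
  refine ⟨x, ?_, ?_⟩
  · rw [← nodeVal_root_eq hC hm]
    rwa [nodeVal_congr hC hl (Λ' := point g)]
    intro X hX
    rw [hv] at hX
    funext v
    simp [point, hxg X (by simpa using hX)]
  · rw [hg]
    exact Finset.prod_congr rfl fun X hX => by rw [hxg X (by simpa using hX)]

end Semantics

end Circuit

end ArithCirc

namespace ArithCirc

/-! ## Max-product values in logarithmic form

The code `0` stands for the value `0`, and the code `w + 1` for the value `2 ^ w`. -/

/-- The number with the given code. -/
def ofCode : ℕ → ℕ
  | 0 => 0
  | w + 1 => 2 ^ w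

/-- The code of a product. -/
def codeMul (a b : ℕ) : ℕ := if a = 0 then 0 else if b = 0 then 0 else a + b - 1

theorem ofCode_strictMono : StrictMono ofCode := by
  refine strictMono_nat_of_lt_succ fun n => ?_
  cases n with
  | zero => simp [ofCode]
  | succ n => exact Nat.pow_lt_pow_right (by norm_num) (Nat.lt_succ_self n)

theorem ofCode_eq_zero {a : ℕ} : ofCode a = 0 ↔ a = 0 := by
  cases a <;> simp [ofCode]

theorem ofCode_max (a b : ℕ) : ofCode (max a b) = max (ofCode a) (ofCode b) :=
  ofCode_strictMono.monotone.map_max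

theorem ofCode_codeMul (a b : ℕ) : ofCode (codeMul a b) = ofCode a * ofCode b := by
  cases a with
  | zero => simp [codeMul, ofCode]
  | succ a =>
    cases b with
    | zero => simp [codeMul, ofCode]
    | succ b =>
      have : codeMul (a + 1) (b + 1) = (a + b) + 1 := by simp [codeMul]; omega
      rw [this]
      simp [ofCode, pow_add]

/-- The value of a node in the max-product semantics, on codes. -/
def Node.codeValue (ω : ℕ → ℕ → ℕ) (vs : List ℕ) : Node → ℕ
  | .ind X x => ω X x
  | .param a _ => if a = 0 then 0 else 1
  | .add cs => (cs.map fun c => vs.getD c 0).foldl max 0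
  | .mul cs => (cs.map fun c => vs.getD c 0).foldl codeMul 1

theorem ofCode_foldl_max (l : List ℕ) (a : ℕ) :
    ofCode (l.foldl max a) = max (ofCode a) ((l.map ofCode).foldr max 0) := by
  induction l generalizing a with
  | nil => simp
  | cons b l ih => simp [ih, ofCode_max, max_assoc]

theorem ofCode_foldl_codeMul (l : List ℕ) (a : ℕ) :
    ofCode (l.foldl codeMul a) = ofCode a * (l.map ofCode).prod := by
  induction l generalizing a with
  | nil => simp
  | cons b l ih => simp [ih, ofCode_codeMul, mul_assoc]

theorem ofCode_getD (vs : List ℕ) (c : ℕ) : ofCode (vs.getD c 0) = (vs.map ofCode).getD c 0 := by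
  simp only [List.getD_eq_getElem?_getD, List.getElem?_map]
  cases vs[c]? <;> simp [ofCode]

theorem ofCode_codeValue (ω : ℕ → ℕ → ℕ) (vs : List ℕ) (nd : Node) :
    ofCode (nd.codeValue ω vs) = nd.maxValue (fun X x => ofCode (ω X x)) (vs.map ofCode) := by
  cases nd with
  | ind X x => rfl
  | param a b => by_cases h : a = 0 <;> simp [Node.codeValue, Node.maxValue, h, ofCode]
  | add cs =>
    simp only [Node.codeValue, Node.maxValue, ofCode_foldl_max, List.map_map, Function.comp_def,
      ofCode_getD]
    simp [ofCode]
  | mul cs =>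
    simp only [Node.codeValue, Node.maxValue, ofCode_foldl_codeMul, List.map_map,
      Function.comp_def, ofCode_getD]
    simp [ofCode]

namespace Circuit

/-- The codes of the max-product values of the nodes. -/
def codes (C : Circuit) (ω : ℕ → ℕ → ℕ) : List ℕ := bottomUp (fun vs nd => nd.codeValue ω vs) C

theorem map_ofCode_codes (C : Circuit) (ω : ℕ → ℕ → ℕ) :
    (C.codes ω).map ofCode =
      bottomUp (fun vs nd => nd.maxValue (fun X x => ofCode (ω X x)) vs) C := by
  unfold codes
  induction C using List.reverseRecOn with
  | nil => simp [bottomUp]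
  | append_singleton C nd ih =>
    rw [bottomUp_append_singleton, bottomUp_append_singleton, ← ih]
    simp [ofCode_codeValue]

/-- The code of the max-product value of the root. -/
def rootCode (C : Circuit) (ω : ℕ → ℕ → ℕ) : ℕ := (C.codes ω).getD (C.length - 1) 0

theorem ofCode_rootCode (C : Circuit) (ω : ℕ → ℕ → ℕ) :
    ofCode (C.rootCode ω) = C.nodeMax (fun X x => ofCode (ω X x)) (C.length - 1) := by
  rw [rootCode, ofCode_getD, map_ofCode_codes, nodeMax]

/-- Multiplying nonzero weights adds the exponents `g X - 1`; the final `+ 1` is the offset that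
reserves the code `0` for the weight `0`. -/
theorem prod_ofCode {s : Finset ℕ} {g : ℕ → ℕ} (h : ∀ X ∈ s, g X ≠ 0) :
    ∏ X ∈ s, ofCode (g X) = ofCode (∑ X ∈ s, (g X - 1) + 1) := by
  rw [ofCode, ← Finset.prod_pow_eq_pow_sum]
  refine Finset.prod_congr rfl fun X hX => ?_
  obtain ⟨w, hw⟩ := Nat.exists_eq_succ_of_ne_zero (h X hX)
  simp [hw, ofCode]

variable {M : Model} {C : Circuit}

/-- Together with `exists_rootCode_eq`: a nonzero root code is one plus the maximum of an additive
objective over the instantiations of the support with nonzero weights. -/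
theorem sum_le_rootCode (hC : C.WF M) (hd : C.Decomposable) (hs : C.Smooth M)
    (hm : C.ComputesMarginals M) (ω : ℕ → ℕ → ℕ) (x : M.Inst) (hx : M.value x ≠ 0)
    (hω : ∀ X < M.dom.length, ω X (x.get X) ≠ 0) :
    ∑ X ∈ Finset.range M.dom.length, (ω X (x.get X) - 1) + 1 ≤ C.rootCode ω := by
  have h := (prod_le_root hC hd hs hm (fun X x => ofCode (ω X x)) x hx).2
  rwa [prod_ofCode (g := fun X => ω X (x.get X)) (by simpa using hω), ← ofCode_rootCode,
    ofCode_strictMono.le_iff_le] at h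

theorem exists_rootCode_eq (hC : C.WF M) (hd : C.Decomposable) (hs : C.Smooth M)
    (hm : C.ComputesMarginals M) (ω : ℕ → ℕ → ℕ) (h : C.rootCode ω ≠ 0) :
    ∃ x : M.Inst, M.value x ≠ 0 ∧ (∀ X < M.dom.length, ω X (x.get X) ≠ 0) ∧
      C.rootCode ω = ∑ X ∈ Finset.range M.dom.length, (ω X (x.get X) - 1) + 1 := by
  obtain ⟨x, hx, hV⟩ := exists_root_eq hC hd hs hm (fun X x => ofCode (ω X x))
    (by rwa [← ofCode_rootCode, Ne, ofCode_eq_zero])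
  rw [← ofCode_rootCode] at hV
  have hω : ∀ X < M.dom.length, ω X (x.get X) ≠ 0 := by
    intro X hX h0
    rw [Finset.prod_eq_zero (i := X) (by simpa using hX) (by simp [h0, ofCode]),
      ofCode_eq_zero] at hV
    exact h hV
  refine ⟨x, hx, hω, ofCode_strictMono.injective ?_⟩
  rw [hV, prod_ofCode (g := fun X => ω X (x.get X)) (by simpa using hω)]

end Circuit

/-! ## The expanded model -/

namespace Model

/-- Horner evaluation in mixed radix. The starting value `r` is arbitrary so that the induction on
`scope` goes through. -/
theorem foldl_row_lt (card g : ℕ → ℕ) (scope : List ℕ) (h : ∀ X ∈ scope, g X < card X) (r : ℕ) :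
    scope.foldl (fun r X => r * card X + g X) r < (r + 1) * (scope.map card).prod := by
  induction scope generalizing r with
  | nil => simp
  | cons X scope ih =>
    simp only [List.foldl_cons, List.map_cons, List.prod_cons]
    refine (ih (fun Y hY => h Y (by simp [hY])) _).trans_le ?_
    rw [← mul_assoc]
    refine Nat.mul_le_mul_right _ ?_
    have := h X (by simp)
    rw [add_mul]
    omega

variable {M : Model}

theorem Inst.get_lt (x : M.Inst) {X : ℕ} (hX : X < M.dom.length) : x.get X < M.card X := by
  simp [Inst.get, hX]

theorem rowIndex_lt (x : M.Inst) {scope : List ℕ} (h : ∀ X ∈ scope, X < M.dom.length) :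
    M.rowIndex x scope < (scope.map M.card).prod := by
  simpa [rowIndex] using foldl_row_lt M.card x.get scope (fun X hX => x.get_lt (h X hX)) 0

theorem rowIndex_congr {N : Model} {x : M.Inst} {y : N.Inst} {scope : List ℕ}
    (hc : ∀ X ∈ scope, M.card X = N.card X) (hg : ∀ X ∈ scope, x.get X = y.get X) :
    M.rowIndex x scope = N.rowIndex y scope := by
  unfold rowIndex
  generalize 0 = r
  induction scope generalizing r with
  | nil => rfl
  | cons X scope ih =>
    simp only [List.foldl_cons]
    rw [hc X (by simp), hg X (by simp)]
    exact ih (fun Y hY => hc Y (by simp [hY])) (fun Y hY => hg Y (by simp [hY])) _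

theorem rowIndex_append_singleton (x : M.Inst) (scope : List ℕ) (X : ℕ) :
    M.rowIndex x (scope ++ [X]) = M.rowIndex x scope * M.card X + x.get X := by
  simp [rowIndex]

theorem card_pos_of_lt (hM : M.WF) {X : ℕ} (hX : X < M.dom.length) : 0 < M.card X := by
  refine hM.card_pos _ ?_
  rw [card, List.getD_eq_getElem _ _ hX]
  exact List.getElem_mem hX

theorem table_length_pos (hM : M.WF) {f : Factor} (hf : f ∈ M.factors) : 0 < f.table.length := by
  rw [hM.table_length f hf]
  refine List.prod_pos ?_
  intro a ha
  obtain ⟨X, hX, rfl⟩ := List.mem_map.1 ha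
  exact card_pos_of_lt hM (hM.scope_lt f hf X hX)

end Model

/-- The identity matrix of order `L`, row after row. -/
def diagTable (L : ℕ) : List ℚ≥0 :=
  (List.range (L * L)).map fun k => if (L + 1) ∣ k then 1 else 0

/-- In row-major order the diagonal entry of row `r` has position `r * (L + 1)`, and no position off
the diagonal is a multiple of `L + 1`. -/
theorem diagTable_getD {L r c : ℕ} (hr : r < L) (hc : c < L) :
    (diagTable L).getD (r * L + c) 0 ≠ 0 ↔ c = r := by
  have hlt : r * L + c < L * L := by nlinarith
  have : (diagTable L).getD (r * L + c) 0 = if (L + 1) ∣ (r * L + c) then 1 else 0 := by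
    rw [List.getD_eq_getElem _ _ (by simpa [diagTable] using hlt)]
    simp [diagTable]
  rw [this]
  have hdvd : (L + 1) ∣ (r * L + c) ↔ c = r := by
    constructor
    · rintro ⟨q, hq⟩
      have hq' : q = r := by
        rcases lt_trichotomy q r with h | h | h
        · nlinarith
        · exact h
        · nlinarith
      subst hq'
      nlinarith
    · rintro rfl
      exact ⟨c, by ring⟩
  simp [hdvd]

/-- The factors of the expanded model: each factor gets an additional variable, named by
consecutive numbers from `b` on, that holds the row of the instantiation. -/
def expandFactors (b : ℕ) : List Factor → List Factor
  | [] => []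
  | f :: fs => ⟨f.scope ++ [b], diagTable f.table.length⟩ :: expandFactors (b + 1) fs

theorem length_expandFactors (b : ℕ) (fs : List Factor) :
    (expandFactors b fs).length = fs.length := by
  induction fs generalizing b with
  | nil => rfl
  | cons f fs ih => simp [expandFactors, ih]

theorem mem_expandFactors {b : ℕ} {fs : List Factor} {g : Factor} :
    g ∈ expandFactors b fs ↔
      ∃ (i : ℕ) (h : i < fs.length),
        g = ⟨fs[i].scope ++ [b + i], diagTable fs[i].table.length⟩ := by
  induction fs generalizing b with
  | nil => simp [expandFactors]
  | cons f fs ih =>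
    simp only [expandFactors, List.mem_cons, ih]
    constructor
    · rintro (rfl | ⟨i, h, rfl⟩)
      · exact ⟨0, by simp, by simp⟩
      · exact ⟨i + 1, by simpa using h, by simp; omega⟩
    · rintro ⟨i, h, rfl⟩
      cases i with
      | zero => left; simp
      | succ i => right; exact ⟨i, by simpa using h, by simp; omega⟩

namespace Model

/-- The model with row variables for the factors of `M`, and with one more variable of `D`
values. The parameter `j` regulates the size of the encoding. -/
def expand (M : Model) (D j : ℕ) : Model where
  dom := M.dom ++ (M.factors.map (fun f => f.table.length) ++ [D])
  factors := expandFactors M.dom.length M.factors ++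
    [⟨[M.dom.length + M.factors.length], List.replicate (D - 1) 1 ++ [((2 ^ j : ℕ) : ℚ≥0)]⟩]

variable {M : Model} {D j : ℕ}

theorem expand_dom_length : (M.expand D j).dom.length = M.dom.length + M.factors.length + 1 := by
  simp [expand]; omega

theorem expand_card_left {X : ℕ} (hX : X < M.dom.length) : (M.expand D j).card X = M.card X := by
  simp only [card, expand]
  rw [List.getD_append _ _ _ _ hX]

theorem expand_card_row {i : ℕ} (hi : i < M.factors.length) :
    (M.expand D j).card (M.dom.length + i) = M.factors[i].table.length := by
  simp [card, expand, List.getD_eq_getElem?_getD, List.getElem?_append, hi]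

theorem expand_card_last : (M.expand D j).card (M.dom.length + M.factors.length) = D := by
  simp [card, expand, List.getD_eq_getElem?_getD]

theorem expand_wf (hM : M.WF) (hD : 0 < D) : (M.expand D j).WF := by
  have hscope : ∀ i (h : i < M.factors.length), ∀ X ∈ M.factors[i].scope, X < M.dom.length :=
    fun i h => hM.scope_lt _ (List.getElem_mem h)
  refine ⟨?_, ?_, ?_, ?_, ?_⟩
  · intro d hd
    simp only [expand, List.mem_append, List.mem_map, List.mem_singleton] at hd
    rcases hd with hd | ⟨f, hf, rfl⟩ | rfl
    · exact hM.card_pos d hd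
    · exact table_length_pos hM hf
    · exact hD
  · intro f hf
    simp only [expand, List.mem_append, mem_expandFactors, List.mem_singleton] at hf
    rcases hf with ⟨i, h, rfl⟩ | rfl
    · refine List.nodup_append.2 ⟨hM.scope_nodup _ (List.getElem_mem h), by simp, ?_⟩
      intro a ha b hb
      have := hscope i h a ha
      simp at hb
      omega
    · simp
  · intro f hf X hX
    rw [expand_dom_length]
    simp only [expand, List.mem_append, mem_expandFactors, List.mem_singleton] at hf
    rcases hf with ⟨i, h, rfl⟩ | rfl
    · rcases List.mem_append.1 hX with hX | hX
      · have := hscope i h X hX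
        omega
      · simp at hX
        omega
    · simp at hX
      omega
  · intro f hf
    simp only [expand, List.mem_append, mem_expandFactors, List.mem_singleton] at hf
    rcases hf with ⟨i, h, rfl⟩ | rfl
    · have h1 : M.factors[i].scope.map (M.expand D j).card = M.factors[i].scope.map M.card :=
        List.map_congr_left fun X hX => expand_card_left (hscope i h X hX)
      have h2 := expand_card_row (D := D) (j := j) h
      have h3 := hM.table_length _ (List.getElem_mem h)
      simp [diagTable, h1, h2, h3]
    · have := expand_card_last (M := M) (D := D) (j := j)
      simp [this]
      omega
  · intro X hX
    rw [expand_dom_length] at hX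
    simp only [expand, List.mem_append, mem_expandFactors, List.mem_singleton]
    rcases lt_or_ge X M.dom.length with h1 | h1
    · obtain ⟨f, hf, hXf⟩ := hM.covered X h1
      obtain ⟨i, hi, rfl⟩ := List.mem_iff_getElem.1 hf
      exact ⟨_, Or.inl ⟨i, hi, rfl⟩, by simp [hXf]⟩
    · rcases lt_or_ge X (M.dom.length + M.factors.length) with h2 | h2
      · exact ⟨_, Or.inl ⟨X - M.dom.length, by omega, rfl⟩, by simp; omega⟩
      · exact ⟨_, Or.inr rfl, by simp; omega⟩

/-- The part of an instantiation of the expanded model on the original variables. -/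
def restrict (y : (M.expand D j).Inst) : M.Inst := fun X =>
  ⟨y.get X, by
    rw [← expand_card_left (D := D) (j := j) X.2]
    exact y.get_lt (by rw [expand_dom_length]; omega)⟩

theorem restrict_get (y : (M.expand D j).Inst) {X : ℕ} (hX : X < M.dom.length) :
    (restrict y).get X = y.get X := by
  simp [Inst.get, hX, restrict]

/-- Each identity matrix forces its row variable, and the table of the last variable has no zero,
which leaves that variable free. The original table entries play no role here; they return as
weights. -/
theorem expand_value_ne_zero (hM : M.WF) (y : (M.expand D j).Inst) :
    (M.expand D j).value y ≠ 0 ↔ ∀ i (h : i < M.factors.length),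
      y.get (M.dom.length + i) = M.rowIndex (restrict y) M.factors[i].scope := by
  have hlast : (M.expand D j).factorValue ⟨[M.dom.length + M.factors.length],
      List.replicate (D - 1) 1 ++ [((2 ^ j : ℕ) : ℚ≥0)]⟩ y ≠ 0 := by
    have h1 := y.get_lt (X := M.dom.length + M.factors.length) (by simp [expand_dom_length])
    rw [expand_card_last] at h1
    simp only [factorValue, rowIndex, List.foldl_cons, List.foldl_nil, zero_mul, zero_add]
    rw [List.getD_eq_getElem _ _ (by simp; omega), List.getElem_append]
    split <;> simp
  have hrow : ∀ i (h : i < M.factors.length), (M.expand D j).factorValue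
      ⟨M.factors[i].scope ++ [M.dom.length + i], diagTable M.factors[i].table.length⟩ y ≠ 0 ↔
        y.get (M.dom.length + i) = M.rowIndex (restrict y) M.factors[i].scope := by
    intro i h
    have hscope := hM.scope_lt _ (List.getElem_mem h)
    have hc := y.get_lt (X := M.dom.length + i) (by rw [expand_dom_length]; omega)
    rw [expand_card_row h] at hc
    have hr := rowIndex_lt (restrict y) hscope
    rw [← hM.table_length _ (List.getElem_mem h)] at hr
    have hcongr : M.rowIndex (restrict y) M.factors[i].scope =
        (M.expand D j).rowIndex y M.factors[i].scope :=
      rowIndex_congr (fun X hX => (expand_card_left (hscope X hX)).symm)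
        (fun X hX => restrict_get y (hscope X hX))
    rw [hcongr] at hr ⊢
    simp only [factorValue, rowIndex_append_singleton, expand_card_row h]
    exact diagTable_getD hr hc
  unfold value
  rw [Ne, List.prod_eq_zero_iff]
  constructor
  · intro h0 i h
    refine (hrow i h).1 fun hz => h0 ?_
    rw [← hz]
    refine List.mem_map_of_mem (f := fun f => (M.expand D j).factorValue f y) ?_
    simp only [expand, List.mem_append, mem_expandFactors]
    exact Or.inl ⟨i, h, rfl⟩
  · intro h h0
    obtain ⟨f, hf, hf0⟩ := List.mem_map.1 h0
    simp only [expand, List.mem_append, mem_expandFactors, List.mem_singleton] at hf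
    rcases hf with ⟨i, hi, rfl⟩ | rfl
    · exact (hrow i hi).2 (h i hi) hf0
    · exact hlast hf0

/-- Every instantiation extends to the support of the expanded model, with an arbitrary value of
the last variable. -/
theorem exists_extension (hM : M.WF) (x : M.Inst) {z : ℕ} (hz : z < D) :
    ∃ y : (M.expand D j).Inst, (M.expand D j).value y ≠ 0 ∧ restrict y = x ∧
      y.get (M.dom.length + M.factors.length) = z := by
  have hlen := expand_dom_length (M := M) (D := D) (j := j)
  let g : ℕ → ℕ := fun X => if X < M.dom.length then x.get X else
    if h : X - M.dom.length < M.factors.length then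
      M.rowIndex x M.factors[X - M.dom.length].scope else z
  have hg : ∀ X < (M.expand D j).dom.length, g X < (M.expand D j).card X := by
    intro X hX
    rw [hlen] at hX
    rcases lt_or_ge X M.dom.length with h1 | h1
    · simpa [g, h1, expand_card_left h1] using x.get_lt h1
    · obtain ⟨i, rfl⟩ := Nat.exists_eq_add_of_le h1
      rcases lt_or_ge i M.factors.length with h2 | h2
      · rw [expand_card_row h2]
        simp only [g, h1.not_gt, add_tsub_cancel_left, h2, if_false, dif_pos]
        rw [hM.table_length _ (List.getElem_mem h2)]
        exact rowIndex_lt x (hM.scope_lt _ (List.getElem_mem h2))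
      · obtain rfl : i = M.factors.length := by omega
        rw [expand_card_last]
        simpa [g] using hz
  let y : (M.expand D j).Inst := fun X => ⟨g X, hg X X.2⟩
  have hy : ∀ X < (M.expand D j).dom.length, y.get X = g X := fun X hX => by
    simp only [Inst.get, hX, y, dif_pos]
  have hr : restrict y = x := by
    funext X
    refine Fin.ext ?_
    change y.get X = x X
    rw [hy X (by rw [hlen]; omega)]
    simp [g, Inst.get]
  refine ⟨y, (expand_value_ne_zero hM y).2 fun i h => ?_, hr, ?_⟩
  · rw [hr, hy _ (by rw [hlen]; omega)]
    simp [g, h]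
  · rw [hy _ (by rw [hlen]; omega)]
    simp [g]

end Model

end ArithCirc

namespace ArithCirc

/-! ## Integer approximations of logarithms -/

/-- The number of halvings that bring `m` below `2 ^ (P + 1)`. -/
def shiftCount (P m : ℕ) : ℕ := m.size - (P + 1)

/-- Squaring of the number `2 ^ e * m`, with a mantissa of `P + 1` bits. -/
def logStep (P : ℕ) (em : ℕ × ℕ) : ℕ × ℕ :=
  (em.1 + em.1 + shiftCount P (em.2 * em.2),
    em.2 * em.2 / 2 ^ shiftCount P (em.2 * em.2))

/-- The number `a * 2 ^ P` with a mantissa of `P + 1` bits. -/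
def logInit (P a : ℕ) : ℕ × ℕ :=
  (shiftCount P (a * 2 ^ P), a * 2 ^ P / 2 ^ shiftCount P (a * 2 ^ P))

/-- An approximation of `2 ^ Q` times the binary logarithm of `a`, up to a constant. -/
def ilog (P Q a : ℕ) : ℕ := ((logStep P)^[Q] (logInit P a)).1

/-- Dropping `c` low bits loses less than `2 ^ c`, while the quotient is at least `2 ^ P`. So a
truncation costs at most the factor `1 + 2 ^ (-P)`, written here without division. -/
theorem shift_bounds {P m : ℕ} (h : 2 ^ P ≤ m) :
    2 ^ P ≤ m / 2 ^ shiftCount P m ∧ m / 2 ^ shiftCount P m < 2 ^ (P + 1) ∧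
      m / 2 ^ shiftCount P m * 2 ^ shiftCount P m ≤ m ∧
      m * 2 ^ P ≤ m / 2 ^ shiftCount P m * 2 ^ shiftCount P m * (2 ^ P + 1) := by
  have hsz : P + 1 ≤ m.size := Nat.lt_size.2 h
  have hc : shiftCount P m + (P + 1) = m.size := by unfold shiftCount; omega
  generalize shiftCount P m = c at hc
  have hlow : 2 ^ (c + P) ≤ m := Nat.lt_size.1 (by omega)
  have hup : m < 2 ^ (c + (P + 1)) := by rw [hc]; exact Nat.lt_size_self m
  have hpos : 0 < 2 ^ c := by positivity
  have h1 : 2 ^ P ≤ m / 2 ^ c := by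
    rw [Nat.le_div_iff_mul_le hpos, ← pow_add, add_comm]
    exact hlow
  have h2 : m / 2 ^ c < 2 ^ (P + 1) := by
    rw [Nat.div_lt_iff_lt_mul hpos, ← pow_add, add_comm]
    exact hup
  have h3 : m < (m / 2 ^ c + 1) * 2 ^ c :=
    (Nat.div_lt_iff_lt_mul hpos).1 (Nat.lt_succ_self _)
  refine ⟨h1, h2, Nat.div_mul_le_self _ _, ?_⟩
  generalize m / 2 ^ c = q at h1 h2 h3
  calc m * 2 ^ P ≤ (q + 1) * 2 ^ c * 2 ^ P := Nat.mul_le_mul_right _ h3.le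
    _ = 2 ^ c * (q * 2 ^ P + 2 ^ P) := by ring
    _ ≤ 2 ^ c * (q * 2 ^ P + q) := by gcongr
    _ = q * 2 ^ c * (2 ^ P + 1) := by ring

/-- Squaring doubles the number of accumulated error factors and the next truncation adds one.
Starting from a single factor, `K ↦ 2 * K + 1` gives `2 ^ (i + 1) - 1`. The error is one-sided
because truncation only decreases. -/
theorem logStep_iterate_bounds (P : ℕ) {a : ℕ} (ha : a ≠ 0) (i : ℕ) :
    let em := (logStep P)^[i] (logInit P a)
    2 ^ P ≤ em.2 ∧ em.2 < 2 ^ (P + 1) ∧ 2 ^ em.1 * em.2 ≤ (a * 2 ^ P) ^ 2 ^ i ∧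
      (a * 2 ^ P) ^ 2 ^ i * (2 ^ P) ^ (2 ^ (i + 1) - 1) ≤
        2 ^ em.1 * em.2 * (2 ^ P + 1) ^ (2 ^ (i + 1) - 1) := by
  induction i with
  | zero =>
    have h : 2 ^ P ≤ a * 2 ^ P := Nat.le_mul_of_pos_left _ (Nat.pos_of_ne_zero ha)
    obtain ⟨h1, h2, h3, h4⟩ := shift_bounds h
    refine ⟨h1, h2, ?_, ?_⟩
    · simpa [logInit, mul_comm] using h3
    · simpa [logInit, mul_comm, mul_assoc, mul_left_comm] using h4
  | succ i ih =>
    rw [Function.iterate_succ_apply']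
    generalize (logStep P)^[i] (logInit P a) = em at ih
    obtain ⟨e, m⟩ := em
    obtain ⟨i1, i2, i3, i4⟩ := ih
    simp only at i1 i2 i3 i4
    have h : 2 ^ P ≤ m * m := i1.trans (Nat.le_mul_of_pos_left _ (by
      exact lt_of_lt_of_le (by positivity) i1))
    obtain ⟨h1, h2, h3, h4⟩ := shift_bounds h
    refine ⟨h1, h2, ?_, ?_⟩
    · simp only [logStep]
      generalize shiftCount P (m * m) = c at *
      calc 2 ^ (e + e + c) * (m * m / 2 ^ c)
          = 2 ^ e * 2 ^ e * (m * m / 2 ^ c * 2 ^ c) := by ring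
        _ ≤ 2 ^ e * 2 ^ e * (m * m) := by gcongr
        _ = (2 ^ e * m) ^ 2 := by ring
        _ ≤ ((a * 2 ^ P) ^ 2 ^ i) ^ 2 := by gcongr
        _ = (a * 2 ^ P) ^ 2 ^ (i + 1) := by rw [← pow_mul, pow_succ 2 i]
    · simp only [logStep]
      have hk : 2 ^ (i + 1 + 1) - 1 = (2 ^ (i + 1) - 1) * 2 + 1 := by
        have : 0 < 2 ^ (i + 1) := by positivity
        rw [pow_succ 2 (i + 1)]
        omega
      rw [hk]
      generalize 2 ^ (i + 1) - 1 = K at *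
      generalize shiftCount P (m * m) = c at *
      calc (a * 2 ^ P) ^ 2 ^ (i + 1) * (2 ^ P) ^ (K * 2 + 1)
          = ((a * 2 ^ P) ^ 2 ^ i * (2 ^ P) ^ K) ^ 2 * 2 ^ P := by
            rw [pow_succ 2 i, pow_mul, pow_succ (2 ^ P), pow_mul (2 ^ P)]; ring
        _ ≤ (2 ^ e * m * (2 ^ P + 1) ^ K) ^ 2 * 2 ^ P := by gcongr
        _ = 2 ^ e * 2 ^ e * ((2 ^ P + 1) ^ K) ^ 2 * (m * m * 2 ^ P) := by ring
        _ ≤ 2 ^ e * 2 ^ e * ((2 ^ P + 1) ^ K) ^ 2 *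
              (m * m / 2 ^ c * 2 ^ c * (2 ^ P + 1)) := by gcongr
        _ = 2 ^ (e + e + c) * (m * m / 2 ^ c) * (2 ^ P + 1) ^ (K * 2 + 1) := by
            rw [pow_succ (2 ^ P + 1), pow_mul (2 ^ P + 1)]; ring

/-- `(1 + 1 / n) ^ K ≤ (1 + 1 / n) ^ n ≤ e ≤ 4`. -/
theorem succ_pow_le {n K : ℕ} (h : K ≤ n) : (n + 1) ^ K ≤ 4 * n ^ K := by
  rcases Nat.eq_zero_or_pos n with rfl | hn
  · obtain rfl : K = 0 := by omega
    simp
  have hn' : (0 : ℝ) < n := by exact_mod_cast hn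
  have h1 : (1 + 1 / (n : ℝ)) ^ K ≤ 4 := by
    calc (1 + 1 / (n : ℝ)) ^ K ≤ (1 + 1 / (n : ℝ)) ^ n :=
          pow_le_pow_right₀ (by simp) h
      _ ≤ (Real.exp (1 / n)) ^ n := by
          gcongr
          rw [add_comm]
          exact Real.add_one_le_exp _
      _ = Real.exp 1 := by rw [← Real.exp_nat_mul]; congr 1; field_simp
      _ ≤ 4 := by linarith [Real.exp_one_lt_d9]
  have h2 : ((n : ℝ) + 1) ^ K ≤ 4 * (n : ℝ) ^ K := by
    have : (n : ℝ) + 1 = n * (1 + 1 / n) := by field_simp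
    rw [this, mul_pow, mul_comm]
    gcongr
  exact_mod_cast h2

/-- The window of three bits consists of one bit for a mantissa between `2 ^ P` and `2 ^ (P + 1)`
and two bits for the truncations, whose number is at most `2 ^ P` by `hPQ`, so that they cost at
most a factor `4`. Hence `ilog P Q a` equals `2 ^ Q * log₂ a + (2 ^ Q - 1) * P` up to an error of at
most `3`. -/
theorem ilog_bounds {P Q a : ℕ} (hPQ : Q + 1 ≤ P) (ha : a ≠ 0) :
    2 ^ (ilog P Q a + P) ≤ (a * 2 ^ P) ^ 2 ^ Q ∧
      (a * 2 ^ P) ^ 2 ^ Q ≤ 2 ^ (ilog P Q a + P + 3) := by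
  have h := logStep_iterate_bounds P ha Q
  unfold ilog
  generalize (logStep P)^[Q] (logInit P a) = em at h
  obtain ⟨e, m⟩ := em
  obtain ⟨h1, h2, h3, h4⟩ := h
  simp only at *
  constructor
  · refine le_trans ?_ h3
    rw [pow_add]
    gcongr
  · have hK : 2 ^ (Q + 1) - 1 ≤ 2 ^ P :=
      (Nat.sub_le _ _).trans (Nat.pow_le_pow_right (by norm_num) hPQ)
    have h5 := succ_pow_le hK
    have hpos : 0 < (2 ^ P) ^ (2 ^ (Q + 1) - 1) := by positivity
    generalize 2 ^ (Q + 1) - 1 = K at *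
    refine Nat.le_of_mul_le_mul_right (h4.trans ?_) hpos
    calc 2 ^ e * m * (2 ^ P + 1) ^ K ≤ 2 ^ e * 2 ^ (P + 1) * (4 * (2 ^ P) ^ K) := by gcongr
      _ = 2 ^ (e + P + 3) * (2 ^ P) ^ K := by ring

theorem ilog_le {P Q s a : ℕ} (hPQ : Q + 1 ≤ P) (ha : a ≠ 0) (has : a.size ≤ s) :
    ilog P Q a ≤ (s + P) * 2 ^ Q := by
  have h := (ilog_bounds hPQ ha).1
  have h1 : a * 2 ^ P ≤ 2 ^ (s + P) := by
    rw [pow_add]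
    gcongr
    exact (Nat.lt_size_self a).le.trans (Nat.pow_le_pow_right (by norm_num) has)
  have h2 : 2 ^ (ilog P Q a + P) ≤ 2 ^ ((s + P) * 2 ^ Q) := by
    rw [pow_mul]
    exact h.trans (Nat.pow_le_pow_left h1 _)
  have := (Nat.pow_le_pow_iff_right (by norm_num)).1 h2
  omega

/-- The errors add up. The offset `P` per number stays explicit because it cancels between lists of
equal length. -/
theorem list_ilog_bounds {P Q : ℕ} (hPQ : Q + 1 ≤ P) (l : List ℕ) (hl : ∀ a ∈ l, a ≠ 0) :
    2 ^ ((l.map (ilog P Q)).sum + P * l.length) ≤ (l.prod * 2 ^ (P * l.length)) ^ 2 ^ Q ∧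
      (l.prod * 2 ^ (P * l.length)) ^ 2 ^ Q ≤
        2 ^ ((l.map (ilog P Q)).sum + P * l.length + 3 * l.length) := by
  induction l with
  | nil => simp
  | cons a l ih =>
    obtain ⟨i1, i2⟩ := ih fun b hb => hl b (by simp [hb])
    obtain ⟨h1, h2⟩ := ilog_bounds hPQ (hl a (by simp))
    simp only [List.map_cons, List.sum_cons, List.prod_cons, List.length_cons]
    have key : (a * l.prod * 2 ^ (P * (l.length + 1))) ^ 2 ^ Q =
        (a * 2 ^ P) ^ 2 ^ Q * (l.prod * 2 ^ (P * l.length)) ^ 2 ^ Q := by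
      rw [← mul_pow]; ring
    rw [key]
    constructor
    · refine le_trans (le_of_eq ?_) (Nat.mul_le_mul h1 i1)
      ring
    · refine (Nat.mul_le_mul h2 i2).trans (le_of_eq ?_)
      ring

/-- Bernoulli's inequality `1 + k / D ≤ (1 + 1 / D) ^ k`, cleared of denominators. -/
theorem pow_mul_add_le (D k : ℕ) : D ^ k * (D + k) ≤ (D + 1) ^ k * D := by
  induction k with
  | zero => simp
  | succ k ih =>
    calc D ^ (k + 1) * (D + (k + 1)) ≤ D ^ k * (D + k) * (D + 1) := by
          rw [pow_succ, mul_assoc, mul_assoc]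
          exact Nat.mul_le_mul_left _ (by nlinarith)
      _ ≤ (D + 1) ^ k * D * (D + 1) := Nat.mul_le_mul_right _ ih
      _ = (D + 1) ^ (k + 1) * D := by ring

/-- The `k`-th power of `2 ≤ (1 + 1 / D) ^ D`: a high power amplifies the gap between the
consecutive integers `D` and `D + 1`. -/
theorem two_pow_mul_le {D : ℕ} (hD : 0 < D) (k : ℕ) :
    2 ^ k * D ^ (D * k) ≤ (D + 1) ^ (D * k) := by
  have h : 2 * D ^ D ≤ (D + 1) ^ D := by
    refine Nat.le_of_mul_le_mul_right ?_ hD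
    refine le_trans (le_of_eq ?_) (pow_mul_add_le D D)
    ring
  rw [pow_mul, pow_mul, ← mul_pow]
  exact Nat.pow_le_pow_left h k

/-- Sums of approximate logarithms determine the order of products. -/
theorem prod_le_of_sum_ilog_le {P Q : ℕ} (hPQ : Q + 1 ≤ P) {l l' : List ℕ}
    (hl : ∀ a ∈ l, a ≠ 0) (hl' : ∀ a ∈ l', a ≠ 0) (hlen : l.length = l'.length)
    (hsum : (l.map (ilog P Q)).sum ≤ (l'.map (ilog P Q)).sum)
    (hQ : l'.prod * (3 * l'.length + 1) ≤ 2 ^ Q) : l.prod ≤ l'.prod := by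
  -- A larger product would be at least `D + 1`, where `D` is the product of `l'`. In the power `2 ^
  -- Q` this gap is worth a factor `2 ^ (3 * n + 1)` (`h4`), but the errors of the logarithms allow
  -- only `2 ^ (3 * n)` (`h3`).
  by_contra! hlt
  have h1 := (list_ilog_bounds hPQ l hl).2
  have h2 := (list_ilog_bounds hPQ l' hl').1
  rw [hlen] at h1
  have hpos : 0 < l'.prod := List.prod_pos fun a ha => Nat.pos_of_ne_zero (hl' a ha)
  generalize l'.length = n at *
  generalize l'.prod = D at *
  have h3 : l.prod ^ 2 ^ Q ≤ 2 ^ (3 * n) * D ^ 2 ^ Q := by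
    have hp : 0 < (2 ^ (P * n)) ^ 2 ^ Q := by positivity
    refine Nat.le_of_mul_le_mul_right ?_ hp
    rw [← mul_pow, mul_assoc, ← mul_pow]
    refine h1.trans (le_trans ?_ (Nat.mul_le_mul_left _ h2))
    rw [← pow_add]
    exact Nat.pow_le_pow_right (by norm_num) (by omega)
  have h4 : 2 ^ (3 * n + 1) * D ^ 2 ^ Q ≤ (D + 1) ^ 2 ^ Q := by
    obtain ⟨r, hr⟩ := Nat.exists_eq_add_of_le hQ
    rw [hr, pow_add D, pow_add (D + 1), ← mul_assoc]
    exact Nat.mul_le_mul (two_pow_mul_le hpos _) (Nat.pow_le_pow_left (by omega) r)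
  have h5 : (D + 1) ^ 2 ^ Q ≤ l.prod ^ 2 ^ Q := Nat.pow_le_pow_left hlt _
  have h6 : 0 < 2 ^ (3 * n) * D ^ 2 ^ Q := by positivity
  rw [pow_succ] at h4
  nlinarith

theorem nnrat_list_prod (l : List ℚ≥0) :
    l.prod * ((l.map NNRat.den).prod : ℕ) = ((l.map NNRat.num).prod : ℕ) := by
  induction l with
  | nil => simp
  | cons q l ih =>
    simp only [List.prod_cons, List.map_cons, Nat.cast_mul]
    rw [← ih]
    have : q * q.den = q.num := NNRat.mul_den_eq_num q
    rw [← this]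
    ring

theorem nnrat_prod_le {l l' : List ℚ≥0}
    (h : (l.map NNRat.num).prod * (l'.map NNRat.den).prod ≤
      (l'.map NNRat.num).prod * (l.map NNRat.den).prod) : l.prod ≤ l'.prod := by
  have hden : ∀ l : List ℚ≥0, (0 : ℚ≥0) < ((l.map NNRat.den).prod : ℕ) := by
    intro l
    have : 0 < (l.map NNRat.den).prod := List.prod_pos (by simp [NNRat.den_pos])
    exact_mod_cast this
  have h' : (((l.map NNRat.num).prod : ℕ) : ℚ≥0) * ((l'.map NNRat.den).prod : ℕ) ≤
      ((l'.map NNRat.num).prod : ℕ) * ((l.map NNRat.den).prod : ℕ) := by exact_mod_cast h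
  rw [← nnrat_list_prod, ← nnrat_list_prod] at h'
  have hp := mul_pos (hden l) (hden l')
  refine le_of_mul_le_mul_right ?_ hp
  calc _ = _ := by ring
    _ ≤ _ := h'
    _ = _ := by ring

end ArithCirc

namespace ArithCirc

/-! ## Sizes of encodings -/

/-- The number of bits of a sequence of numbers, with one extra bit for each number. -/
def bits (l : List ℕ) : ℕ := (l.map fun w => w.size + 1).sum

@[simp] theorem bits_nil : bits [] = 0 := rfl

@[simp] theorem bits_cons (a : ℕ) (l : List ℕ) : bits (a :: l) = a.size + 1 + bits l := by
  simp [bits]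

@[simp] theorem bits_append (l l' : List ℕ) : bits (l ++ l') = bits l + bits l' := by
  simp [bits]

theorem bits_flatMap {α : Type} (l : List α) (g : α → List ℕ) :
    bits (l.flatMap g) = (l.map fun a => bits (g a)).sum := by
  induction l with
  | nil => rfl
  | cons a l ih => simp [ih]

theorem length_le_bits (l : List ℕ) : l.length ≤ bits l := by
  induction l with
  | nil => simp
  | cons a l ih => simp; omega

theorem size_le_bits {l : List ℕ} {a : ℕ} (h : a ∈ l) : a.size < bits l := by
  have := List.single_le_sum (l := l.map fun w => w.size + 1) (by simp) _ (List.mem_map_of_mem h)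
  exact this

theorem Model.size_eq (M : Model) : M.size = bits M.encode := rfl

theorem Factor.row_le_bits (f : Factor) {q : ℚ≥0} (hq : q ∈ f.table) :
    q.num.size + q.den.size ≤ bits f.encode := by
  have h := List.single_le_sum (l := f.table.map fun q => bits [q.num, q.den]) (by simp) _
    (List.mem_map_of_mem hq)
  simp only [encode, List.cons_append, bits_cons, bits_append, bits_flatMap, bits_nil] at h ⊢
  omega

namespace Model

variable {M : Model}

theorem bits_factors_le (M : Model) : bits (M.factors.flatMap Factor.encode) ≤ M.size := by
  simp [size_eq, encode]
  omega

theorem two_le_size (M : Model) : 2 ≤ M.size := by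
  simp [size_eq, encode]
  omega

theorem length_factors_le (M : Model) : M.factors.length ≤ M.size := by
  refine le_trans ?_ M.bits_factors_le
  induction M.factors with
  | nil => simp
  | cons f fs ih => simp [Factor.encode]; omega

theorem card_lt_two_pow (M : Model) {X : ℕ} (hX : X < M.dom.length) :
    M.card X < 2 ^ M.size := by
  have h : M.card X ∈ M.encode := by
    simp only [encode, card, List.getD_eq_getElem _ _ hX]
    simp
  exact (Nat.lt_size_self _).trans_le
    (Nat.pow_le_pow_right (by norm_num) (size_le_bits h).le)

/-- The entries selected from different factors occupy disjoint parts of the encoding, so their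
total length, and not just each one's, is bounded by the size. -/
theorem sum_row_size_le (M : Model) {q : Factor → ℚ≥0} (hq : ∀ f ∈ M.factors, q f ∈ f.table) :
    (M.factors.map fun f => (q f).num.size + (q f).den.size).sum ≤ M.size := by
  refine le_trans ?_ M.bits_factors_le
  rw [bits_flatMap]
  exact List.sum_le_sum fun f hf => f.row_le_bits (hq f hf)

end Model

theorem prod_le_two_pow (l : List ℕ) : l.prod ≤ 2 ^ (l.map Nat.size).sum := by
  induction l with
  | nil => simp
  | cons a l ih =>
    simp only [List.prod_cons, List.map_cons, List.sum_cons, pow_add]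
    exact Nat.mul_le_mul (Nat.lt_size_self a).le ih

theorem nnrat_eq_zero_of_num {q : ℚ≥0} (h : q.num = 0) : q = 0 := by
  rw [← NNRat.num_div_den q, h]
  simp

/-! ## Weights of indicators -/

/-- The code of the weight of a row with the value `q`, for models of size `s` with `m`
variables. -/
def rowCode (s m : ℕ) (q : ℚ≥0) : ℕ :=
  if q.num = 0 then 0 else
    (ilog (8 * s) (4 * s) q.num + (2 ^ (12 * s) - ilog (8 * s) (4 * s) q.den)) * 2 ^ (s * m) + 1

/-- The codes of the weights of the indicators of the expanded model. -/
def Model.weight (M : Model) (X x : ℕ) : ℕ :=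
  if X < M.dom.length then x * 2 ^ (M.size * X) + 1
  else if h : X - M.dom.length < M.factors.length then
    rowCode M.size M.dom.length (M.factors[X - M.dom.length].table.getD x 0)
  else 1

theorem sum_digits_lt {s : ℕ} {g : ℕ → ℕ} {m : ℕ} (hg : ∀ X < m, g X < 2 ^ s) :
    ∑ X ∈ Finset.range m, g X * 2 ^ (s * X) < 2 ^ (s * m) := by
  induction m with
  | zero => simp
  | succ m ih =>
    rw [Finset.sum_range_succ, Nat.mul_succ, pow_add]
    have h1 := ih fun X hX => hg X (by omega)
    have h2 := Nat.mul_le_mul_right (2 ^ (s * m)) (Nat.succ_le_of_lt (hg m (by omega)))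
    rw [Nat.succ_mul, mul_comm (2 ^ s)] at h2
    omega

/-- The high part `G` is arbitrary: it stands for the logarithms in the application and absorbs the
leading digit in the induction. -/
theorem digit_eq {s : ℕ} {g : ℕ → ℕ} {m : ℕ} (hg : ∀ X < m, g X < 2 ^ s) (G : ℕ) {X : ℕ}
    (hX : X < m) :
    (∑ X ∈ Finset.range m, g X * 2 ^ (s * X) + G * 2 ^ (s * m)) / 2 ^ (s * X) % 2 ^ s = g X := by
  induction m generalizing G with
  | zero => simp at hX
  | succ m ih =>
    rw [Finset.sum_range_succ]
    have key : ∑ X ∈ Finset.range m, g X * 2 ^ (s * X) + g m * 2 ^ (s * m) +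
        G * 2 ^ (s * (m + 1)) =
          ∑ X ∈ Finset.range m, g X * 2 ^ (s * X) + (g m + G * 2 ^ s) * 2 ^ (s * m) := by
      rw [Nat.mul_succ, pow_add]; ring
    rw [key]
    rcases Nat.lt_succ_iff_lt_or_eq.1 hX with h | rfl
    · exact ih (fun Y hY => hg Y (by omega)) _ h
    · rw [Nat.add_mul_div_right _ _ (by positivity),
        Nat.div_eq_of_lt (sum_digits_lt fun Y hY => hg Y (by omega)), zero_add,
        Nat.add_mul_mod_self_right, Nat.mod_eq_of_lt (hg X (by omega))]

theorem sum_map_eq_range {α : Type} (l : List α) (h : α → ℕ) :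
    (l.map h).sum = ∑ i ∈ Finset.range l.length, if hi : i < l.length then h l[i] else 0 := by
  induction l with
  | nil => simp
  | cons a l ih =>
    refine Eq.trans ?_ (Finset.sum_range_succ' _ _).symm
    simp [ih, add_comm]

theorem six_mul_add_one_le {s : ℕ} (hs : 2 ≤ s) : 6 * s + 1 ≤ 2 ^ (2 * s) := by
  induction s, hs using Nat.le_induction with
  | base => norm_num
  | succ s hs ih => rw [Nat.mul_succ 2, pow_add]; omega

theorem nine_mul_le (s : ℕ) : 9 * s ≤ 2 ^ (8 * s) := by
  induction s with
  | zero => simp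
  | succ s ih =>
    rw [Nat.mul_succ 8, pow_add]
    have : 0 < 2 ^ (8 * s) := by positivity
    omega

/-! ### Weights order the instantiations and carry their digits. -/

namespace Model

variable {M : Model}

theorem factorValue_mem (hM : M.WF) (x : M.Inst) {f : Factor} (hf : f ∈ M.factors) :
    M.factorValue f x ∈ f.table := by
  have h := rowIndex_lt x (hM.scope_lt f hf)
  rw [← hM.table_length f hf] at h
  rw [factorValue, List.getD_eq_getElem _ _ h]
  exact List.getElem_mem h

/-- The weight of the row of `x` in the factor `f`. -/
def rowLog (M : Model) (x : M.Inst) (f : Factor) : ℕ :=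
  ilog (8 * M.size) (4 * M.size) (M.factorValue f x).num +
    (2 ^ (12 * M.size) - ilog (8 * M.size) (4 * M.size) (M.factorValue f x).den)

/-- This makes the truncated subtraction in `rowCode` and `rowLog` an honest one. The exponent comes
from `ilog_le`: `(s + 8 * s) * 2 ^ (4 * s) ≤ 2 ^ (8 * s) * 2 ^ (4 * s)`. -/
theorem ilog_den_le (hM : M.WF) (x : M.Inst) {f : Factor} (hf : f ∈ M.factors) :
    ilog (8 * M.size) (4 * M.size) (M.factorValue f x).den ≤ 2 ^ (12 * M.size) := by
  have hs := M.two_le_size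
  have hsz : (M.factorValue f x).den.size ≤ M.size := by
    have h1 := f.row_le_bits (factorValue_mem hM x hf)
    have h2 := List.single_le_sum (l := M.factors.map fun f => bits f.encode) (by simp) _
      (List.mem_map_of_mem hf)
    have h3 := M.bits_factors_le
    rw [bits_flatMap] at h3
    omega
  refine (ilog_le (by omega) (NNRat.den_pos _).ne' hsz).trans ?_
  rw [show 12 * M.size = 8 * M.size + 4 * M.size by ring, pow_add]
  refine Nat.mul_le_mul_right _ ?_
  have := nine_mul_le M.size
  omega

/-- Every instantiation selects exactly one row of each factor, so the shifts by `2 ^ (12 * s)` sum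
to the same constant for all of them and drop out of comparisons. -/
theorem sum_rowLog (hM : M.WF) (x : M.Inst) :
    (M.factors.map (M.rowLog x)).sum +
        ((M.factors.map fun f => (M.factorValue f x).den).map
          (ilog (8 * M.size) (4 * M.size))).sum =
      ((M.factors.map fun f => (M.factorValue f x).num).map
          (ilog (8 * M.size) (4 * M.size))).sum + M.factors.length * 2 ^ (12 * M.size) := by
  have h := fun f hf => ilog_den_le hM x (f := f) hf
  generalize M.factors = fs at *
  induction fs with
  | nil => simp
  | cons f fs ih =>
    have h1 := ih fun g hg => h g (by simp [hg])
    have h2 := h f (by simp)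
    simp only [List.map_cons, List.sum_cons, List.length_cons, rowLog, add_mul, one_mul] at h1 ⊢
    omega

theorem value_eq (M : Model) (x : M.Inst) :
    M.value x = (M.factors.map fun f => M.factorValue f x).prod := rfl

theorem value_le_of_sum_rowLog_le (hM : M.WF) {x x' : M.Inst} (hx : M.value x ≠ 0)
    (hx' : M.value x' ≠ 0)
    (h : (M.factors.map (M.rowLog x')).sum ≤ (M.factors.map (M.rowLog x)).sum) :
    M.value x' ≤ M.value x := by
  have hs := M.two_le_size
  have hnum : ∀ y : M.Inst, M.value y ≠ 0 →
      ∀ a ∈ M.factors.map (fun f => (M.factorValue f y).num), a ≠ 0 := by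
    rintro y hy a ha rfl
    obtain ⟨f, hf, hf0⟩ := List.mem_map.1 ha
    refine hy (List.prod_eq_zero ?_)
    rw [← nnrat_eq_zero_of_num hf0]
    exact List.mem_map_of_mem (f := fun f => M.factorValue f y) hf
  have hden : ∀ y : M.Inst, ∀ a ∈ M.factors.map (fun f => (M.factorValue f y).den), a ≠ 0 := by
    intro y a ha
    obtain ⟨f, hf, rfl⟩ := List.mem_map.1 ha
    exact (NNRat.den_pos _).ne'
  have e1 := sum_rowLog hM x
  have e2 := sum_rowLog hM x'
  -- Cross-multiplication: the numerators of one instantiation are paired with the denominators of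
  -- the other. Both lists then consist of nonzero integers and have the same length, so the offsets
  -- of the logarithms cancel.
  have hle := prod_le_of_sum_ilog_le (P := 8 * M.size) (Q := 4 * M.size) (by omega)
    (l := M.factors.map (fun f => (M.factorValue f x').num) ++
      M.factors.map (fun f => (M.factorValue f x).den))
    (l' := M.factors.map (fun f => (M.factorValue f x).num) ++
      M.factors.map (fun f => (M.factorValue f x').den))
    (fun a ha => (List.mem_append.1 ha).elim (hnum x' hx' a) (hden x a))
    (fun a ha => (List.mem_append.1 ha).elim (hnum x hx a) (hden x' a))
    (by simp) (by simp only [List.map_append, List.sum_append]; omega) ?_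
  · rw [List.prod_append, List.prod_append] at hle
    rw [value_eq, value_eq]
    refine nnrat_prod_le ?_
    simpa [Function.comp_def] using hle
  · have hsz : ∀ y : M.Inst,
        ((M.factors.map fun f => (M.factorValue f y).num).map Nat.size).sum +
          ((M.factors.map fun f => (M.factorValue f y).den).map Nat.size).sum ≤ M.size := by
      intro y
      have := M.sum_row_size_le (q := fun f => M.factorValue f y)
        (fun f hf => factorValue_mem hM y hf)
      rw [List.sum_map_add] at this
      simpa [Function.comp_def] using this
    have hn := M.length_factors_le
    have h1 := hsz x
    have h2 := hsz x'
    -- This is why `Q = 4 * s`: the product in question has at most `2 * s` bits, `s` from each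
    -- instantiation, and the lists have at most `2 * s` entries, whence the error term `6 * s + 1 ≤
    -- 2 ^ (2 * s)`.
    calc _ ≤ 2 ^ (2 * M.size) * 2 ^ (2 * M.size) := by
          refine Nat.mul_le_mul ?_ ?_
          · refine (prod_le_two_pow _).trans (Nat.pow_le_pow_right (by norm_num) ?_)
            rw [List.map_append, List.sum_append]
            omega
          · refine le_trans ?_ (six_mul_add_one_le hs)
            simp
            omega
      _ = 2 ^ (4 * M.size) := by rw [← pow_add]; congr 1; omega

/-- The exponents add up to a number of two blocks: the original values as digits in base `2 ^ s`,
and above position `s * m` the total logarithm. A nonzero weight of each row means that no selected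
table entry vanishes. -/
theorem sum_weight {D j : ℕ} (hM : M.WF) {y : (M.expand D j).Inst}
    (hy : (M.expand D j).value y ≠ 0)
    (hω : ∀ X < (M.expand D j).dom.length, M.weight X (y.get X) ≠ 0) :
    M.value (restrict y) ≠ 0 ∧
      ∑ X ∈ Finset.range (M.expand D j).dom.length, (M.weight X (y.get X) - 1) =
        ∑ X ∈ Finset.range M.dom.length, (restrict y).get X * 2 ^ (M.size * X) +
          (M.factors.map (M.rowLog (restrict y))).sum * 2 ^ (M.size * M.dom.length) := by
  have hrow := (expand_value_ne_zero hM y).1 hy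
  have hw : ∀ i (h : i < M.factors.length), M.weight (M.dom.length + i) (y.get (M.dom.length + i)) =
      rowCode M.size M.dom.length (M.factorValue M.factors[i] (restrict y)) := by
    intro i h
    simp [weight, h, hrow i h, factorValue]
  have hnum : ∀ i (h : i < M.factors.length),
      (M.factorValue M.factors[i] (restrict y)).num ≠ 0 := by
    intro i h h0
    refine hω (M.dom.length + i) (by rw [expand_dom_length]; omega) ?_
    rw [hw i h, rowCode, if_pos h0]
  constructor
  · rw [value_eq, Ne, List.prod_eq_zero_iff]
    intro h0
    obtain ⟨f, hf, hf0⟩ := List.mem_map.1 h0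
    obtain ⟨i, hi, rfl⟩ := List.mem_iff_getElem.1 hf
    exact hnum i hi (by rw [hf0]; rfl)
  · rw [expand_dom_length, Finset.sum_range_succ, Finset.sum_range_add]
    have hlast : M.weight (M.dom.length + M.factors.length)
        (y.get (M.dom.length + M.factors.length)) - 1 = 0 := by simp [weight]
    rw [hlast, add_zero]
    congr 1
    · refine Finset.sum_congr rfl fun X hX => ?_
      have hX' : X < M.dom.length := by simpa using hX
      rw [weight, if_pos hX', restrict_get y hX']
      simp
    · rw [sum_map_eq_range, Finset.sum_mul]
      refine Finset.sum_congr rfl fun i hi => ?_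
      have hi' : i < M.factors.length := by simpa using hi
      rw [hw i hi', rowCode, if_neg (hnum i hi'), dif_pos hi', rowLog]
      simp

theorem weight_ne_zero {D j : ℕ} (hM : M.WF) {y : (M.expand D j).Inst}
    (hy : (M.expand D j).value y ≠ 0) (hx : M.value (restrict y) ≠ 0) (X : ℕ) :
    M.weight X (y.get X) ≠ 0 := by
  have hrow := (expand_value_ne_zero hM y).1 hy
  unfold weight
  split_ifs with h1 h2
  · simp
  · have h3 := hrow _ h2
    rw [Nat.add_sub_cancel' (not_lt.1 h1)] at h3
    rw [h3, rowCode, if_neg]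
    · simp
    · intro h0
      refine hx (List.prod_eq_zero (List.mem_map.2 ⟨_, List.getElem_mem h2, ?_⟩))
      exact nnrat_eq_zero_of_num h0
  · simp

/-- The digits of the code of the root are a most probable explanation. -/
theorem exists_isMPE {D j : ℕ} (hM : M.WF) (hD : 0 < D) {C : Circuit}
    (hC : C.WF (M.expand D j)) (hd : C.Decomposable) (hs : C.Smooth (M.expand D j))
    (hm : C.ComputesMarginals (M.expand D j)) :
    ∃ x : M.Inst, M.IsMPE x ∧ ∀ X : Fin M.dom.length,
      (x X : ℕ) = (C.rootCode M.weight - 1) / 2 ^ (M.size * X) % 2 ^ M.size := by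
  have hbound : ∀ x' : M.Inst, M.value x' ≠ 0 → ∃ y' : (M.expand D j).Inst, restrict y' = x' ∧
      (M.expand D j).value y' ≠ 0 ∧
      ∑ X ∈ Finset.range M.dom.length, x'.get X * 2 ^ (M.size * X) +
          (M.factors.map (M.rowLog x')).sum * 2 ^ (M.size * M.dom.length) + 1 ≤
        C.rootCode M.weight := by
    intro x' hx'
    obtain ⟨y', hy', rfl, -⟩ := exists_extension (D := D) (j := j) hM x' hD
    have hω := fun X (_ : X < (M.expand D j).dom.length) => weight_ne_zero hM hy' hx' X
    have hle := Circuit.sum_le_rootCode hC hd hs hm M.weight y' hy' hω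
    rw [(sum_weight hM hy' hω).2] at hle
    exact ⟨y', rfl, hy', hle⟩
  -- Code `0` means that the product of the factors vanishes identically. Any instantiation is then
  -- an MPE, and the all-zero one matches the digits because `0 - 1 = 0`.
  by_cases hV : C.rootCode M.weight = 0
  · refine ⟨fun X => ⟨0, card_pos_of_lt hM X.2⟩, ?_, by simp [hV]⟩
    intro x'
    have : M.value x' = 0 := by
      by_contra hx'
      obtain ⟨y', -, -, h⟩ := hbound x' hx'
      omega
    rw [this]
    exact zero_le
  · obtain ⟨y, hy, hω, hsum⟩ := Circuit.exists_rootCode_eq hC hd hs hm M.weight hV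
    obtain ⟨hx, hsum'⟩ := sum_weight hM hy hω
    rw [hsum'] at hsum
    have hdig : ∀ x : M.Inst, ∀ X < M.dom.length, x.get X < 2 ^ M.size := fun x X hX =>
      (x.get_lt hX).trans (M.card_lt_two_pow hX)
    refine ⟨restrict y, fun x' => ?_, fun X => ?_⟩
    · by_cases hx' : M.value x' = 0
      · rw [hx']
        exact zero_le
      · obtain ⟨y', -, -, h⟩ := hbound x' hx'
        refine value_le_of_sum_rowLog_le hM hx hx' ?_
        -- The digits stay below one unit of the logarithm block, so they cannot compensate for a
        -- smaller total logarithm.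
        have h1 := sum_digits_lt (hdig (restrict y))
        rw [hsum] at h
        by_contra! hlt
        have h2 := Nat.mul_le_mul_right (2 ^ (M.size * M.dom.length)) (Nat.succ_le_of_lt hlt)
        rw [Nat.succ_mul] at h2
        omega
    · rw [hsum, Nat.add_sub_cancel, digit_eq (hdig (restrict y)) _ X.2]
      simp [Inst.get]

end Model

end ArithCirc

namespace ArithCirc

/-! ## A program logic with running times -/

/-- Started in `σ`, the program `P` halts after at most `k` steps in a state with `Q`. -/
def Runs (P : Prog) (σ : State) (k : ℕ) (Q : State → Prop) : Prop :=
  ∃ σ' k', Exec P σ σ' k' ∧ k' ≤ k ∧ Q σ'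

infixr:30 ";;" => Prog.seq

namespace Instr

/-- Whether the register `r` is written. -/
def writes : Instr → ℕ → Bool
  | const d _, r => d == r
  | add d _ _, r => d == r
  | sub d _ _, r => d == r
  | half d _, r => d == r
  | load d _ _, r => d == r
  | store _ _ _, _ => false
  | emit _, _ => false

/-- Whether the array `A` is written. -/
def stores : Instr → ℕ → Bool
  | store B _ _, A => B == A
  | _, _ => false

/-- Whether there is no output. -/
def quiet : Instr → Bool
  | emit _ => false
  | _ => true

end Instr

namespace Prog

/-- Whether the register `r` is written. -/
def writes : Prog → ℕ → Bool
  | basic i, r => i.writes r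
  | seq P Q, r => P.writes r || Q.writes r
  | cond _ P Q, r => P.writes r || Q.writes r
  | loop _ P, r => P.writes r

/-- Whether the array `A` is written. -/
def stores : Prog → ℕ → Bool
  | basic i, A => i.stores A
  | seq P Q, A => P.stores A || Q.stores A
  | cond _ P Q, A => P.stores A || Q.stores A
  | loop _ P, A => P.stores A

/-- Whether there is no output. -/
def quiet : Prog → Bool
  | basic i => i.quiet
  | seq P Q => P.quiet && Q.quiet
  | cond _ P Q => P.quiet && Q.quiet
  | loop _ P => P.quiet

/-- A sequence of basic instructions. -/
def block : List Instr → Prog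
  | [] => basic (.const 49 0)
  | [i] => basic i
  | i :: j :: l => basic i ;; block (j :: l)

/-- No operation; register `49` is never read. -/
def skip : Prog := basic (.const 49 0)

end Prog

/-- `τ` differs from `σ` only in what the program `P` may write. -/
structure Frame (P : Prog) (σ τ : State) : Prop where
  reg : ∀ r, P.writes r = false → τ.reg r = σ.reg r
  mem : ∀ A, P.stores A = false → τ.mem A = σ.mem A
  out : P.quiet = true → τ.out = σ.out

theorem Frame.refl (P : Prog) (σ : State) : Frame P σ σ :=
  ⟨fun _ _ => rfl, fun _ _ => rfl, fun _ => rfl⟩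

theorem Frame.trans {P : Prog} {σ τ υ : State} (h : Frame P σ τ) (h' : Frame P τ υ) :
    Frame P σ υ :=
  ⟨fun r hr => (h'.reg r hr).trans (h.reg r hr), fun A hA => (h'.mem A hA).trans (h.mem A hA),
    fun ho => (h'.out ho).trans (h.out ho)⟩

theorem Frame.mono {P Q : Prog} {σ τ : State} (h : Frame P σ τ)
    (hr : ∀ r, Q.writes r = false → P.writes r = false)
    (hA : ∀ A, Q.stores A = false → P.stores A = false)
    (ho : Q.quiet = true → P.quiet = true) : Frame Q σ τ :=
  ⟨fun r h' => h.reg r (hr r h'), fun A h' => h.mem A (hA A h'), fun h' => h.out (ho h')⟩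

/-- What a program may change is read off its text. The checks are Boolean computations, so for a
concrete program and register "unchanged" is later proved by `rfl`. -/
theorem Exec.frame {P : Prog} {σ τ : State} {k : ℕ} (h : Exec P σ τ k) : Frame P σ τ := by
  induction h with
  | basic i σ =>
    constructor
    · intro r hr
      cases i <;> simp only [Prog.writes, Instr.writes, beq_eq_false_iff_ne] at hr <;>
        simp only [Instr.run] <;> exact Function.update_of_ne (Ne.symm hr) _ _
    · intro A hA
      cases i <;> simp only [Prog.stores, Instr.stores, beq_eq_false_iff_ne] at hA <;>
        simp only [Instr.run]
      exact Function.update_of_ne (Ne.symm hA) _ _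
    · intro ho
      cases i <;> simp [Prog.quiet, Instr.quiet] at ho <;> rfl
  | seq _ _ ih ih' =>
    exact (ih.mono (by simp +contextual [Prog.writes]) (by simp +contextual [Prog.stores])
      (by simp +contextual [Prog.quiet])).trans (ih'.mono (by simp +contextual [Prog.writes])
      (by simp +contextual [Prog.stores]) (by simp +contextual [Prog.quiet]))
  | cond_true _ _ ih =>
    exact ih.mono (by simp +contextual [Prog.writes])
      (by simp +contextual [Prog.stores]) (by simp +contextual [Prog.quiet])
  | cond_false _ _ ih =>
    exact ih.mono (by simp +contextual [Prog.writes])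
      (by simp +contextual [Prog.stores]) (by simp +contextual [Prog.quiet])
  | loop_done _ => exact Frame.refl _ _
  | @loop_step r P _ _ _ _ _ _ _ _ ih ih' =>
    exact (ih.mono (Q := .loop r P) (fun _ h => h) (fun _ h => h) (fun h => h)).trans ih'

namespace Runs

variable {P R : Prog} {σ : State} {k l : ℕ} {Q Q' : State → Prop}

theorem mono (h : Runs P σ k Q) (hk : k ≤ l) (hQ : ∀ τ, Q τ → Q' τ) : Runs P σ l Q' := by
  obtain ⟨τ, k', he, hk', hq⟩ := h
  exact ⟨τ, k', he, hk'.trans hk, hQ τ hq⟩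

theorem le (h : Runs P σ k Q) (hk : k ≤ l) : Runs P σ l Q := h.mono hk fun _ => id

theorem frame (h : Runs P σ k Q) : Runs P σ k fun τ => Q τ ∧ Frame P σ τ := by
  obtain ⟨τ, k', he, hk', hq⟩ := h
  exact ⟨τ, k', he, hk', hq, he.frame⟩

/-- The second premise receives the frame of the first program, so postconditions need to mention
computed values only. -/
theorem seq (h : Runs P σ k Q') (h' : ∀ τ, Q' τ → Frame P σ τ → Runs R τ l Q) :
    Runs (P ;; R) σ (k + l) Q := by
  obtain ⟨τ, k', he, hk', hq⟩ := h
  obtain ⟨υ, l', he', hl', hq'⟩ := h' τ hq he.frame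
  exact ⟨υ, k' + l', .seq he he', add_le_add hk' hl', hq'⟩

theorem basic {i : Instr} (h : Q (i.run σ)) : Runs (.basic i) σ 1 Q :=
  ⟨_, _, .basic i σ, le_rfl, h⟩

theorem block {i : Instr} {is : List Instr} (h : Q ((i :: is).foldl (fun τ i => i.run τ) σ)) :
    Runs (Prog.block (i :: is)) σ (i :: is).length Q := by
  induction is generalizing i σ with
  | nil => exact basic h
  | cons j is ih =>
    have := (basic (i := i) (σ := σ) (Q := fun τ => τ = i.run σ) rfl).seq
      (R := Prog.block (j :: is)) (fun τ hτ _ => ih (i := j) (σ := τ) (by subst hτ; exact h))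
    exact this.le (by simp; omega)

theorem cond {r : ℕ} (h : σ.reg r ≠ 0 → Runs P σ k Q) (h' : σ.reg r = 0 → Runs R σ k Q) :
    Runs (.cond r P R) σ (k + 1) Q := by
  by_cases hr : σ.reg r = 0
  · obtain ⟨τ, k', he, hk', hq⟩ := h' hr
    exact ⟨τ, k' + 1, .cond_false hr he, by omega, hq⟩
  · obtain ⟨τ, k', he, hk', hq⟩ := h hr
    exact ⟨τ, k' + 1, .cond_true hr he, by omega, hq⟩

theorem skip (h : ∀ τ, Frame Prog.skip σ τ → Q τ) : Runs Prog.skip σ 1 Q :=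
  ⟨_, _, .basic _ σ, le_rfl, h _ (Exec.basic _ σ).frame⟩

theorem loop_done {r : ℕ} (hr : σ.reg r = 0) (h : Q σ) : Runs (.loop r P) σ 1 Q :=
  ⟨σ, 1, .loop_done hr, le_rfl, h⟩

theorem loop_step {r : ℕ} (hr : σ.reg r ≠ 0) (h : Runs P σ k Q')
    (h' : ∀ τ, Q' τ → Frame P σ τ → Runs (.loop r P) τ l Q) :
    Runs (.loop r P) σ (k + l + 1) Q := by
  obtain ⟨τ, k', he, hk', hq⟩ := h
  obtain ⟨υ, l', he', hl', hq'⟩ := h' τ hq he.frame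
  exact ⟨υ, k' + l' + 1, .loop_step hr he he', by omega, hq'⟩

/-- A loop that counts down a register, with an invariant. -/
theorem loop_count {r n c : ℕ} (I : ℕ → State → Prop) (hr : σ.reg r = n) (hI : I n σ)
    (step : ∀ j τ, j < n → Frame P σ τ → τ.reg r = j + 1 → I (j + 1) τ →
      Runs P τ c fun τ' => τ'.reg r = j ∧ I j τ') :
    Runs (.loop r P) σ (n * (c + 1) + 1) (I 0) := by
  have key : ∀ j ≤ n, ∀ τ, Frame P σ τ → τ.reg r = j → I j τ →
      Runs (.loop r P) τ (j * (c + 1) + 1) (I 0) := by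
    intro j
    induction j with
    | zero => exact fun _ τ _ h h' => (loop_done h h').le (by simp)
    | succ j ih =>
      intro hj τ hf h h'
      refine (loop_step (by omega) (step j τ (by omega) hf h h')
        fun υ hυ hf' => ih (by omega) υ (hf.trans hf') hυ.1 hυ.2).le ?_
      rw [Nat.succ_mul]
      omega
  exact key n le_rfl σ (Frame.refl _ _) hr hI

/-- A loop that counts down a register, with an invariant indexed by the number of rounds. -/
theorem loop_up {r n c : ℕ} (I : ℕ → State → Prop) (hr : σ.reg r = n) (hI : I 0 σ)
    (step : ∀ i τ, i < n → Frame P σ τ → τ.reg r = n - i → I i τ →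
      Runs P τ c fun τ' => τ'.reg r = n - i - 1 ∧ I (i + 1) τ') :
    Runs (.loop r P) σ (n * (c + 1) + 1) (I n) := by
  refine (loop_count (fun j τ => I (n - j) τ) hr (by simpa using hI) ?_).mono le_rfl
    fun τ h => h
  intro j τ hj hf h hτ
  refine (step (n - (j + 1)) τ (by omega) hf (by omega) hτ).mono le_rfl ?_
  rintro υ ⟨h1, h2⟩
  exact ⟨by omega, by rwa [show n - (j + 1) + 1 = n - j by omega] at h2⟩

end Runs

/-- Register `47` holds `0` and register `48` holds `1`. -/
structure Ready (σ : State) : Prop where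
  zero : σ.reg 47 = 0
  one : σ.reg 48 = 1

theorem Frame.ready {P : Prog} {σ τ : State} (h : Frame P σ τ) (hσ : Ready σ)
    (h0 : P.writes 47 = false) (h1 : P.writes 48 = false) : Ready τ :=
  ⟨(h.reg 47 h0).trans hσ.zero, (h.reg 48 h1).trans hσ.one⟩

/-! ## Arithmetic subroutines -/

open Instr in
/-- Register `12` becomes the product of the registers `10` and `11`. -/
def mulProg : Prog :=
  .block [const 12 0] ;;
  .loop 11 (.block [half 13 11, sub 14 11 13, sub 14 14 13] ;;
    .cond 14 (.block [add 12 12 10]) .skip ;;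
    .block [add 10 10 10, add 11 13 47])

theorem size_div_two {n : ℕ} (h : n ≠ 0) : n.size = (n / 2).size + 1 := by
  conv_lhs => rw [← Nat.bit_bodd_div2 n]
  rw [Nat.size_bit (by rwa [Nat.bit_bodd_div2]), Nat.div2_val]

/-- Binary multiplication: doubling register `10`, halving register `11` and moving an odd remainder
into register `12` preserves `reg 12 + reg 10 * reg 11`. The time depends on the bit length of
register `11` alone. -/
theorem runs_mulProg {σ : State} (hσ : Ready σ) {k : ℕ} (hk : (σ.reg 11).size ≤ k) :
    Runs mulProg σ (8 * k + 2) fun τ => τ.reg 12 = σ.reg 10 * σ.reg 11 := by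
  have key : ∀ (k : ℕ) (τ : State), Ready τ → (τ.reg 11).size ≤ k →
      Runs (.loop 11 (.block [.half 13 11, .sub 14 11 13, .sub 14 14 13] ;;
        .cond 14 (.block [.add 12 12 10]) .skip ;; .block [.add 10 10 10, .add 11 13 47])) τ
        (8 * k + 1) fun υ => υ.reg 12 = τ.reg 12 + τ.reg 10 * τ.reg 11 := by
    intro k
    induction k with
    | zero =>
      intro τ _ h
      have h0 : τ.reg 11 = 0 := Nat.size_eq_zero.1 (by omega)
      exact Runs.loop_done h0 (by simp [h0])
    | succ k ih =>
      intro τ hτ h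
      by_cases h0 : τ.reg 11 = 0
      · exact (Runs.loop_done h0 (by simp [h0])).le (by omega)
      have hbody : Runs (.block [.half 13 11, .sub 14 11 13, .sub 14 14 13] ;;
          .cond 14 (.block [.add 12 12 10]) .skip ;; .block [.add 10 10 10, .add 11 13 47])
          τ 7 fun υ => υ.reg 11 = τ.reg 11 / 2 ∧ υ.reg 10 = τ.reg 10 + τ.reg 10 ∧
            υ.reg 12 = τ.reg 12 + τ.reg 10 * (τ.reg 11 % 2) := by
        -- Parity without a remainder operation: `n - n / 2 - n / 2`.
        refine (Runs.block (Q := fun υ => υ.reg 13 = τ.reg 11 / 2 ∧ υ.reg 14 = τ.reg 11 % 2) ?_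
          ).seq (l := 4) ?_
        · simp [Instr.run]; omega
        rintro υ ⟨h13, h14⟩ hf
        refine (Runs.cond (k := 1)
          (Q := fun υ' => υ'.reg 12 = τ.reg 12 + τ.reg 10 * (τ.reg 11 % 2)) ?_ ?_).seq (l := 2) ?_
        · intro h1
          refine Runs.block ?_
          have : τ.reg 11 % 2 = 1 := by omega
          simp [Instr.run, hf.reg 12 rfl, hf.reg 10 rfl, this]
        · intro h1
          refine Runs.skip fun υ' hf' => ?_
          rw [hf'.reg 12 rfl, hf.reg 12 rfl, ← h14, h1]
          simp
        · intro υ' h12 hf'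
          refine Runs.block ?_
          simp [Instr.run, hf'.reg 13 rfl, h13, hf'.reg 47 rfl, hf.reg 47 rfl,
            hτ.zero, hf'.reg 10 rfl, hf.reg 10 rfl, h12]
      refine (Runs.loop_step h0 hbody (l := 8 * k + 1) ?_).le (by omega)
      rintro υ ⟨h11, h10, h12⟩ hf
      refine (ih υ (hf.ready hτ rfl rfl) ?_).mono le_rfl ?_
      · rw [size_div_two h0] at h
        rw [h11]
        omega
      · intro υ' h
        rw [h, h12, h11, h10]
        have := Nat.div_add_mod (τ.reg 11) 2
        nlinarith
  refine ((Runs.block (Q := fun τ => τ.reg 12 = 0) (by simp [Instr.run])).seq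
    (l := 8 * k + 1) ?_).le (by simp; omega)
  intro τ h12 hf
  refine (key k τ (hf.ready hσ rfl rfl) (by rwa [hf.reg 11 rfl])).mono le_rfl ?_
  intro υ h
  rw [h, h12, hf.reg 10 rfl, hf.reg 11 rfl, zero_add]

end ArithCirc

/-! ### Array segments, bit counts, shifts and logarithms on the machine. -/

namespace ArithCirc

/-- The sequence `l` stands in the array `a` from position `p` on. -/
def Seg (a : ℕ → ℕ) (p : ℕ) (l : List ℕ) : Prop := ∀ i (h : i < l.length), a (p + i) = l[i]

theorem Seg.nil (a : ℕ → ℕ) (p : ℕ) : Seg a p [] := fun i h => by simp at h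

theorem seg_cons {a : ℕ → ℕ} {p x : ℕ} {l : List ℕ} :
    Seg a p (x :: l) ↔ a p = x ∧ Seg a (p + 1) l := by
  constructor
  · intro h
    refine ⟨h 0 (by simp), fun i hi => ?_⟩
    have := h (i + 1) (by simpa using hi)
    rwa [show p + 1 + i = p + (i + 1) by omega]
  · rintro ⟨h0, h⟩ i hi
    cases i with
    | zero => exact h0
    | succ i =>
      have := h i (by simpa using hi)
      rwa [show p + 1 + i = p + (i + 1) by omega] at this

theorem seg_append {a : ℕ → ℕ} {p : ℕ} {l l' : List ℕ} :
    Seg a p (l ++ l') ↔ Seg a p l ∧ Seg a (p + l.length) l' := by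
  induction l generalizing p with
  | nil => simp [Seg.nil]
  | cons x l ih =>
    rw [List.cons_append, seg_cons, seg_cons, ih, and_assoc, List.length_cons,
      show p + 1 + l.length = p + (l.length + 1) by omega]

theorem seg_getD (w : List ℕ) : Seg (fun i => w.getD i 0) 0 w := by
  intro i h
  simp [h]

theorem update_getD (w : List ℕ) (v : ℕ) :
    Function.update (fun i => w.getD i 0) w.length v = fun i => (w ++ [v]).getD i 0 := by
  funext i
  rcases lt_trichotomy i w.length with h | rfl | h
  · rw [Function.update_of_ne h.ne, List.getD_append _ _ _ _ h]
  · simp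
  · rw [Function.update_of_ne h.ne', List.getD_eq_default _ _ h.le,
      List.getD_eq_default _ _ (by simp; omega)]

open Instr in
/-- The halvings of register `18`, counted in register `15`. -/
def sizeLoop : Prog := .loop 18 (.block [add 15 15 48, half 18 18])

theorem runs_sizeLoop {σ : State} (hσ : Ready σ) :
    Runs sizeLoop σ (3 * (σ.reg 18).size + 1) fun τ =>
      τ.reg 15 = σ.reg 15 + (σ.reg 18).size := by
  induction h : (σ.reg 18).size generalizing σ with
  | zero => exact Runs.loop_done (Nat.size_eq_zero.1 h) (by simp)
  | succ k ih =>
    have h0 : σ.reg 18 ≠ 0 := fun h0 => by simp [h0] at h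
    refine (Runs.loop_step h0 (Runs.block (Q := fun τ => τ.reg 18 = σ.reg 18 / 2 ∧
      τ.reg 15 = σ.reg 15 + 1) ?_) (l := 3 * k + 1) ?_).le (by simp; omega)
    · simp [Instr.run, hσ.one]
    · rintro τ ⟨h18, h15⟩ hf
      rw [size_div_two h0] at h
      refine (ih (hf.ready hσ rfl rfl) (by rw [h18]; omega)).mono le_rfl ?_
      intro υ hυ
      rw [hυ, h15]
      omega

open Instr in
/-- The body of the loop of `sizeProg`. -/
def sizeBody (A : ℕ) : Prog :=
  .block [load 18 A 16, add 15 15 48] ;; sizeLoop ;; .block [add 16 16 48, sub 17 17 48]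

open Instr in
/-- Register `15` becomes the number of bits of the sequence in the array `A`, the length of
which is in the register `r`. -/
def sizeProg (A r : ℕ) : Prog :=
  .block [const 15 0, const 16 0, add 17 r 47] ;; .loop 17 (sizeBody A)

theorem runs_size_loop (A : ℕ) (l : List ℕ) {σ : State} (hσ : Ready σ)
    (h17 : σ.reg 17 = l.length) (hl : Seg (σ.mem A) (σ.reg 16) l) :
    Runs (.loop 17 (sizeBody A)) σ (6 * bits l + 1) fun τ => τ.reg 15 = σ.reg 15 + bits l := by
  induction l generalizing σ with
  | nil => exact Runs.loop_done (by simpa using h17) (by simp)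
  | cons v l ih =>
    rw [seg_cons] at hl
    refine (Runs.loop_step (by simp [h17]) (k := 3 * v.size + 5) (Q' := fun τ =>
      τ.reg 15 = σ.reg 15 + (v.size + 1) ∧ τ.reg 16 = σ.reg 16 + 1 ∧ τ.reg 17 = l.length)
      ?_ (l := 6 * bits l + 1) ?_).le (by simp; omega)
    · refine ((Runs.block (Q := fun τ => τ.reg 18 = v ∧ τ.reg 15 = σ.reg 15 + 1) ?_).seq
        (l := 3 * v.size + 3) ?_).le (by simp; omega)
      · simp [Instr.run, hl.1, hσ.one]
      rintro τ ⟨h18, h15⟩ hf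
      have hτ := hf.ready hσ rfl rfl
      refine ((runs_sizeLoop hτ).seq (l := 2) ?_).le (by rw [h18])
      intro υ hυ hf'
      have hυ' := hf'.ready hτ rfl rfl
      refine Runs.block ?_
      simp [Instr.run, hυ'.one, hυ, h15, h18, hf'.reg 16 rfl, hf.reg 16 rfl, hf'.reg 17 rfl,
        hf.reg 17 rfl, h17]
      omega
    · rintro τ ⟨h15, h16, h17'⟩ hf
      refine (ih (hf.ready hσ rfl rfl) h17' ?_).mono le_rfl ?_
      · rw [h16, hf.mem A (by rfl)]
        exact hl.2
      · intro υ hυ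
        rw [hυ, h15]
        simp
        omega

theorem runs_sizeProg {A r : ℕ} {w : List ℕ} {σ : State} (hσ : Ready σ)
    (hr : σ.reg r = w.length) (hr' : 17 < r ∨ r < 15) (hw : σ.mem A = fun i => w.getD i 0) :
    Runs (sizeProg A r) σ (6 * bits w + 4) fun τ => τ.reg 15 = bits w := by
  refine ((Runs.block (Q := fun τ => τ.reg 15 = 0 ∧ τ.reg 16 = 0 ∧ τ.reg 17 = w.length) ?_).seq
    (l := 6 * bits w + 1) ?_).le (by simp; omega)
  · have h15 : r ≠ 15 := by omega
    have h16 : r ≠ 16 := by omega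
    simp [Instr.run, hσ.zero, hr, h15, h16]
  · rintro τ ⟨h15, h16, h17⟩ hf
    refine (runs_size_loop A w (hf.ready hσ rfl rfl) h17 ?_).mono le_rfl ?_
    · rw [h16, hf.mem A rfl, hw]
      exact seg_getD w
    · intro υ hυ
      rw [hυ, h15, zero_add]

open Instr in
/-- Register `d` is multiplied by the power of two with the exponent in register `c`. -/
def shiftProg (d c : ℕ) : Prog := .loop c (.block [add d d d, sub c c 48])

theorem runs_shiftProg {d c : ℕ} (hdc : d ≠ c) (hd : d ≠ 48) {σ : State}
    (h1 : σ.reg 48 = 1) {n : ℕ} (hn : σ.reg c = n) :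
    Runs (shiftProg d c) σ (3 * n + 1) fun τ => τ.reg d = σ.reg d * 2 ^ n := by
  -- The counter could be the register of the constant `1` itself; the loop then runs once and
  -- clears it.
  by_cases hc : c = 48
  · subst hc
    obtain rfl : n = 1 := by omega
    refine (Runs.loop_step (by omega) (Runs.block (Q := fun τ => τ.reg 48 = 0 ∧
      τ.reg d = σ.reg d * 2) ?_) (l := 1) ?_).le (by simp)
    · simp [Instr.run, hdc, h1, hd.symm, mul_two]
    · rintro τ ⟨h, h'⟩ hf
      exact Runs.loop_done h (by simpa using h')
  refine (Runs.loop_count (c := 2) (fun j τ => τ.reg d * 2 ^ j = σ.reg d * 2 ^ n) hn rfl ?_).mono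
    (by omega) fun τ h => by simpa using h
  intro j τ hj hf hr hI
  refine Runs.block ?_
  have h48 : τ.reg 48 = 1 := by
    rw [hf.reg 48 (by simp [Prog.block, Prog.writes, Instr.writes, hd, hc]), h1]
  simp only [List.foldl_cons, List.foldl_nil, Instr.run]
  simp only [Function.update_apply, hdc, hdc.symm, Ne.symm hd, if_true, if_false, h48, hr]
  refine ⟨by simp, ?_⟩
  rw [← hI, pow_succ]
  ring

open Instr in
/-- Normalization of the mantissa in register `20`, with the exponent in register `21`. -/
def normProg : Prog :=
  .block [sub 23 20 22] ;; .loop 23 (.block [half 20 20, add 21 21 48, sub 23 20 22])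

theorem shiftCount_of_lt {P m : ℕ} (h : m ≤ 2 ^ (P + 1) - 1) : shiftCount P m = 0 := by
  have hp : 0 < 2 ^ (P + 1) := by positivity
  have : m.size ≤ P + 1 := Nat.size_le.2 (by omega)
  unfold shiftCount
  omega

theorem shiftCount_of_ge {P m : ℕ} (h : 2 ^ (P + 1) - 1 < m) :
    shiftCount P m = shiftCount P (m / 2) + 1 := by
  have h1 : P + 1 < m.size := Nat.lt_size.2 (by omega)
  have h2 := size_div_two (n := m) (by omega)
  unfold shiftCount
  omega

/-- A positive truncated difference with `2 ^ (P + 1) - 1` says that the number has more than `P +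
1` bits, so the bit length need not be computed. -/
theorem runs_normProg {P : ℕ} {σ : State} (hσ : Ready σ) (h22 : σ.reg 22 = 2 ^ (P + 1) - 1)
    {m : ℕ} (hm : σ.reg 20 = m) {k : ℕ} (hk : shiftCount P m ≤ k) :
    Runs normProg σ (4 * k + 2) fun τ =>
      τ.reg 20 = m / 2 ^ shiftCount P m ∧ τ.reg 21 = σ.reg 21 + shiftCount P m := by
  have key : ∀ (c : ℕ) (τ : State), Ready τ → τ.reg 22 = 2 ^ (P + 1) - 1 →
      τ.reg 23 = τ.reg 20 - τ.reg 22 → shiftCount P (τ.reg 20) = c →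
      Runs (.loop 23 (.block [.half 20 20, .add 21 21 48, .sub 23 20 22])) τ (4 * c + 1)
        fun υ => υ.reg 20 = τ.reg 20 / 2 ^ c ∧ υ.reg 21 = τ.reg 21 + c := by
    intro c
    induction c with
    | zero =>
      intro τ hτ h22 h23 hc
      refine Runs.loop_done ?_ (by simp)
      by_contra h
      rw [shiftCount_of_ge (by omega)] at hc
      omega
    | succ c ih =>
      intro τ hτ h22 h23 hc
      have hlt : 2 ^ (P + 1) - 1 < τ.reg 20 := by
        by_contra h
        rw [shiftCount_of_lt (by omega)] at hc
        omega
      refine (Runs.loop_step (by omega) (Runs.block (Q := fun υ => υ.reg 20 = τ.reg 20 / 2 ∧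
        υ.reg 21 = τ.reg 21 + 1 ∧ υ.reg 23 = τ.reg 20 / 2 - τ.reg 22) ?_)
        (l := 4 * c + 1) ?_).le (by simp; omega)
      · simp [Instr.run, hτ.one]
      · rintro υ ⟨h1, h2, h3⟩ hf
        have h22' : υ.reg 22 = τ.reg 22 := hf.reg 22 rfl
        rw [shiftCount_of_ge hlt] at hc
        refine (ih υ (hf.ready hτ rfl rfl) (h22'.trans h22) (by rw [h3, h1, h22'])
          (by rw [h1]; omega)).mono le_rfl ?_
        rintro υ' ⟨h4, h5⟩
        refine ⟨?_, by omega⟩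
        rw [h4, h1, Nat.div_div_eq_div_mul, pow_succ, mul_comm]
  refine ((Runs.block (Q := fun τ => τ.reg 23 = m - σ.reg 22) ?_).seq
    (l := 4 * shiftCount P m + 1) ?_).le (by simp; omega)
  · simp [Instr.run, hm]
  · intro τ h23 hf
    have h20 : τ.reg 20 = m := (hf.reg 20 rfl).trans hm
    refine (key _ τ (hf.ready hσ rfl rfl) ((hf.reg 22 rfl).trans h22)
      (by rw [h23, h20, hf.reg 22 rfl]) (by rw [h20])).mono le_rfl ?_
    rintro υ ⟨h1, h2⟩
    rw [h1, h2, h20, hf.reg 21 rfl]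
    exact ⟨rfl, rfl⟩

open Instr in
/-- The squaring step of `logProg`. -/
def logBody : Prog :=
  .block [add 10 20 47, add 11 20 47] ;; mulProg ;; .block [add 20 12 47, add 21 21 21] ;;
    normProg ;; .block [sub 26 26 48]

open Instr in
/-- Register `21` becomes the approximate logarithm of register `20`. -/
def logProg : Prog :=
  .block [const 21 0, add 26 24 47] ;; shiftProg 20 26 ;; normProg ;; .block [add 26 25 47] ;;
    .loop 26 logBody

theorem size_mul_self_le {P m : ℕ} (h : m < 2 ^ (P + 1)) : (m * m).size ≤ 2 * P + 2 := by
  refine Nat.size_le.2 ?_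
  calc m * m < 2 ^ (P + 1) * 2 ^ (P + 1) := Nat.mul_self_lt_mul_self h
    _ = 2 ^ (2 * P + 2) := by rw [← pow_add]; congr 1; omega

theorem runs_logBody {P : ℕ} {σ : State} (hσ : Ready σ) (h22 : σ.reg 22 = 2 ^ (P + 1) - 1)
    (hm : σ.reg 20 < 2 ^ (P + 1)) :
    Runs logBody σ (12 * P + 21) fun τ => τ.reg 26 = σ.reg 26 - 1 ∧
      (τ.reg 21, τ.reg 20) = logStep P (σ.reg 21, σ.reg 20) := by
  refine ((Runs.block (Q := fun τ => τ.reg 10 = σ.reg 20 ∧ τ.reg 11 = σ.reg 20) ?_).seq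
    (l := 12 * P + 19) ?_).le (by simp; omega)
  · simp [Instr.run, hσ.zero]
  rintro τ₁ ⟨h10, h11⟩ hf₁
  have hσ₁ := hf₁.ready hσ rfl rfl
  refine ((runs_mulProg hσ₁ (k := P + 1) ?_).seq (l := 4 * P + 9) ?_).le (by omega)
  · rw [h11]
    exact Nat.size_le.2 hm
  intro τ₂ h12 hf₂
  have hσ₂ := hf₂.ready hσ₁ rfl rfl
  refine ((Runs.block (Q := fun τ => τ.reg 20 = σ.reg 20 * σ.reg 20 ∧
    τ.reg 21 = σ.reg 21 + σ.reg 21) ?_).seq (l := 4 * P + 7) ?_).le (by simp; omega)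
  · simp [Instr.run, hσ₂.zero, h12, h10, h11, hf₂.reg 21 rfl, hf₁.reg 21 rfl]
  rintro τ₃ ⟨h20, h21⟩ hf₃
  have hσ₃ := hf₃.ready hσ₂ rfl rfl
  refine ((runs_normProg hσ₃ (P := P) ?_ h20 (k := P + 1) ?_).seq (l := 1) ?_).le (by omega)
  · rw [hf₃.reg 22 rfl, hf₂.reg 22 rfl, hf₁.reg 22 rfl, h22]
  · have := size_mul_self_le hm
    unfold shiftCount
    omega
  rintro τ₄ ⟨h20', h21'⟩ hf₄
  refine Runs.block ?_
  simp [Instr.run, (hf₄.ready hσ₃ rfl rfl).one, hf₄.reg 26 rfl, hf₃.reg 26 rfl, hf₂.reg 26 rfl,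
    hf₁.reg 26 rfl, logStep, h20', h21', h21]

theorem runs_logProg {P Q : ℕ} {σ : State} (hσ : Ready σ) (h22 : σ.reg 22 = 2 ^ (P + 1) - 1)
    (h24 : σ.reg 24 = P) (h25 : σ.reg 25 = Q) {a : ℕ} (h20 : σ.reg 20 = a) (ha : a ≠ 0)
    (has : a.size ≤ P) :
    Runs logProg σ (Q * (12 * P + 22) + 7 * P + 7) fun τ => τ.reg 21 = ilog P Q a := by
  refine ((Runs.block (Q := fun τ => τ.reg 21 = 0 ∧ τ.reg 26 = P) ?_).seq
    (l := Q * (12 * P + 22) + 7 * P + 5) ?_).le (by simp; omega)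
  · simp [Instr.run, hσ.zero, h24]
  rintro τ₁ ⟨h21, h26⟩ hf₁
  have hσ₁ := hf₁.ready hσ rfl rfl
  refine ((runs_shiftProg (d := 20) (c := 26) (by norm_num) (by norm_num) hσ₁.one h26).seq
    (l := Q * (12 * P + 22) + 4 * P + 4) ?_).le (by omega)
  intro τ₂ h20' hf₂
  have hσ₂ := hf₂.ready hσ₁ rfl rfl
  rw [hf₁.reg 20 rfl, h20] at h20'
  refine ((runs_normProg hσ₂ (P := P) ?_ h20' (k := P) ?_).seq
    (l := Q * (12 * P + 22) + 2) ?_).le (by omega)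
  · rw [hf₂.reg 22 rfl, hf₁.reg 22 rfl, h22]
  · have : (a * 2 ^ P).size ≤ P + P := by
      refine Nat.size_le.2 ?_
      rw [pow_add]
      exact Nat.mul_lt_mul_of_pos_right (Nat.size_le.1 has) (by positivity)
    unfold shiftCount
    omega
  rintro τ₃ ⟨h20₃, h21₃⟩ hf₃
  have hσ₃ := hf₃.ready hσ₂ rfl rfl
  refine ((Runs.block (Q := fun τ => τ.reg 26 = Q) ?_).seq
    (l := Q * (12 * P + 22) + 1) ?_).le (by simp; omega)
  · simp [Instr.run, hσ₃.zero, hf₃.reg 25 rfl, hf₂.reg 25 rfl, hf₁.reg 25 rfl, h25]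
  intro τ₄ h26₄ hf₄
  have hσ₄ := hf₄.ready hσ₃ rfl rfl
  have hstart : (τ₄.reg 21, τ₄.reg 20) = logInit P a := by
    rw [hf₄.reg 21 rfl, hf₄.reg 20 rfl, h20₃, h21₃, hf₂.reg 21 rfl, h21, zero_add]
    rfl
  -- The first clause counts the rounds still due. The second keeps the state on the orbit of
  -- `logInit P a`, which supplies the mantissa bound that limits the cost of the next
  -- multiplication.
  refine (Runs.loop_count (c := 12 * P + 21) (fun j τ =>
    (logStep P)^[j] (τ.reg 21, τ.reg 20) = (logStep P)^[Q] (logInit P a) ∧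
      ∃ i, (τ.reg 21, τ.reg 20) = (logStep P)^[i] (logInit P a)) h26₄ ?_ ?_).mono le_rfl ?_
  · rw [hstart]
    exact ⟨rfl, 0, rfl⟩
  · rintro j τ hj hf h26 ⟨hI, i, hi⟩
    have hlt : τ.reg 20 < 2 ^ (P + 1) := by
      have := (logStep_iterate_bounds P ha i).2.1
      rwa [← hi] at this
    refine (runs_logBody (P := P) (hf.ready hσ₄ rfl rfl) ?_ hlt).mono le_rfl ?_
    · rw [hf.reg 22 rfl, hf₄.reg 22 rfl, hf₃.reg 22 rfl, hf₂.reg 22 rfl, hf₁.reg 22 rfl, h22]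
    · rintro υ ⟨hυ, hυ'⟩
      refine ⟨by omega, ?_, i + 1, ?_⟩
      · rw [hυ']
        exact hI
      · rw [hυ', hi, Function.iterate_succ_apply']
  · rintro τ ⟨hI, -⟩
    rw [ilog, ← hI]
    rfl

end ArithCirc

namespace ArithCirc

/-! ## The preprocessing phase -/

/-- The long-lived data of the algorithm on the input `M`. -/
structure Env (M : Model) (σ : State) : Prop where
  ready : Ready σ
  vars : σ.reg 3 = M.dom.length
  facs : σ.reg 4 = M.factors.length
  size : σ.reg 5 = M.size
  dummy : σ.reg 6 = M.size ^ 4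
  thr : σ.reg 22 = 2 ^ (8 * M.size + 1) - 1
  prec : σ.reg 24 = 8 * M.size
  rounds : σ.reg 25 = 4 * M.size
  big : σ.reg 27 = 2 ^ (12 * M.size)
  input : σ.mem 0 = fun i => M.encode.getD i 0

/-- Whether the program leaves the long-lived data alone. -/
def Prog.keeps (P : Prog) : Bool :=
  !(P.writes 3 || P.writes 4 || P.writes 5 || P.writes 6 || P.writes 22 || P.writes 24 ||
    P.writes 25 || P.writes 27 || P.writes 47 || P.writes 48 || P.stores 0)

theorem Frame.env {P : Prog} {σ τ : State} {M : Model} (h : Frame P σ τ) (hσ : Env M σ)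
    (hk : P.keeps = true) : Env M τ := by
  simp only [Prog.keeps, Bool.not_eq_true', Bool.or_eq_false_iff] at hk
  obtain ⟨⟨⟨⟨⟨⟨⟨⟨⟨⟨h3, h4⟩, h5⟩, h6⟩, h22⟩, h24⟩, h25⟩, h27⟩, h47⟩, h48⟩, hm⟩ := hk
  exact ⟨h.ready hσ.ready h47 h48, (h.reg 3 h3).trans hσ.vars, (h.reg 4 h4).trans hσ.facs,
    (h.reg 5 h5).trans hσ.size, (h.reg 6 h6).trans hσ.dummy, (h.reg 22 h22).trans hσ.thr,
    (h.reg 24 h24).trans hσ.prec, (h.reg 25 h25).trans hσ.rounds, (h.reg 27 h27).trans hσ.big,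
    (h.mem 0 hm).trans hσ.input⟩

/-! ### Weights of rows -/

open Instr in
/-- Register `32` becomes the code of the row with numerator in register `30` and denominator in
register `36`. -/
def rowProg : Prog :=
  .cond 30
    (.block [add 20 30 47] ;; logProg ;; .block [add 33 21 47, add 20 36 47] ;; logProg ;;
      .block [sub 34 27 21, add 11 33 34, add 10 28 47] ;; mulProg ;; .block [add 32 12 48])
    (.block [const 32 0])

/-- A bound for the running time of `rowProg` on models of size `s`. -/
def rowCost (s : ℕ) : ℕ := 1200 * (s * s)

theorem runs_rowProg {M : Model} {σ : State} (hσ : Env M σ) {q : ℚ≥0}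
    (h30 : σ.reg 30 = q.num) (h36 : σ.reg 36 = q.den)
    (h28 : σ.reg 28 = 2 ^ (M.size * M.dom.length))
    (hn : q.num.size ≤ M.size) (hd : q.den.size ≤ M.size) :
    Runs rowProg σ (rowCost M.size) fun τ => τ.reg 32 = rowCode M.size M.dom.length q := by
  have hs := M.two_le_size
  generalize hS : M.size = s at *
  -- Two logarithms with `P = 8 * s` and `Q = 4 * s`, one multiplication by a number of at most `12
  -- * s + 1` bits, and the straight-line code.
  have hcost : 2 * (4 * s * (12 * (8 * s) + 22) + 7 * (8 * s) + 7) + (8 * (12 * s + 1) + 2) + 8 ≤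
      1200 * (s * s) := by nlinarith
  refine (Runs.cond (k := 2 * (4 * s * (12 * (8 * s) + 22) + 7 * (8 * s) + 7) +
    (8 * (12 * s + 1) + 2) + 7) ?_ ?_).le (hcost.trans' (by omega))
  swap
  · intro h0
    refine (Runs.block ?_).le (by simp)
    rw [rowCode, if_pos (h30 ▸ h0)]
    simp [Instr.run]
  intro h0
  rw [h30] at h0
  refine ((Runs.block (Q := fun τ => τ.reg 20 = q.num) ?_).seq
    (l := 2 * (4 * s * (12 * (8 * s) + 22) + 7 * (8 * s) + 7) + (8 * (12 * s + 1) + 2) + 6) ?_).le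
    (by simp; omega)
  · simp [Instr.run, h30, hσ.ready.zero]
  intro τ₁ h₁ hf₁
  have e₁ := hf₁.env hσ rfl
  refine ((runs_logProg e₁.ready e₁.thr e₁.prec e₁.rounds h₁ h0 (by omega)).seq
    (l := (4 * s * (12 * (8 * s) + 22) + 7 * (8 * s) + 7) + (8 * (12 * s + 1) + 2) + 6) ?_).le
    (by rw [hS]; omega)
  intro τ₂ h₂ hf₂
  have e₂ := hf₂.env e₁ rfl
  refine ((Runs.block (Q := fun τ => τ.reg 33 = ilog (8 * s) (4 * s) q.num ∧
    τ.reg 20 = q.den) ?_).seq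
    (l := (4 * s * (12 * (8 * s) + 22) + 7 * (8 * s) + 7) + (8 * (12 * s + 1) + 2) + 4) ?_).le
    (by simp; omega)
  · simp [Instr.run, h₂, hf₂.reg 36 rfl, hf₁.reg 36 rfl, h36, e₂.ready.zero, hS]
  rintro τ₃ ⟨h33, h20⟩ hf₃
  have e₃ := hf₃.env e₂ rfl
  refine ((runs_logProg e₃.ready e₃.thr e₃.prec e₃.rounds h20 (NNRat.den_pos q).ne'
    (by omega)).seq (l := (8 * (12 * s + 1) + 2) + 4) ?_).le (by rw [hS]; omega)
  intro τ₄ h₄ hf₄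
  have e₄ := hf₄.env e₃ rfl
  rw [hS] at h₄
  refine ((Runs.block (Q := fun τ => τ.reg 11 = ilog (8 * s) (4 * s) q.num +
    (2 ^ (12 * s) - ilog (8 * s) (4 * s) q.den) ∧ τ.reg 10 = 2 ^ (s * M.dom.length)) ?_).seq
    (l := (8 * (12 * s + 1) + 2) + 1) ?_).le (by simp; omega)
  · simp [Instr.run, h₄, e₄.big, hS, e₄.ready.zero, hf₄.reg 33 rfl, h33, hf₄.reg 28 rfl,
      hf₃.reg 28 rfl, hf₂.reg 28 rfl, hf₁.reg 28 rfl, h28]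
  rintro τ₅ ⟨h11, h10⟩ hf₅
  have e₅ := hf₅.env e₄ rfl
  refine ((runs_mulProg e₅.ready (k := 12 * s + 1) ?_).seq (l := 1) ?_).le (by omega)
  · rw [h11]
    have h1 : ilog (8 * s) (4 * s) q.num < 2 ^ (12 * s) := by
      refine lt_of_le_of_lt (ilog_le (by omega) h0 hn) ?_
      rw [show 12 * s = 8 * s + 4 * s by ring, pow_add]
      refine Nat.mul_lt_mul_of_pos_right ?_ (by positivity)
      have h9 : s + 8 * s < 2 ^ (8 * s) := by
        have := nine_mul_le (s - 1)
        have h2 : 2 ^ (8 * s) = 2 ^ (8 * (s - 1)) * 256 := by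
          rw [show 8 * s = 8 * (s - 1) + 8 by omega, pow_add]; norm_num
        omega
      exact h9
    refine Nat.size_le.2 ?_
    rw [pow_succ]
    omega
  intro τ₆ h12 hf₆
  have e₆ := hf₆.env e₅ rfl
  refine Runs.block ?_
  rw [rowCode, if_neg h0]
  simp [Instr.run, e₆.ready.one, h12, h11, h10, mul_comm]

/-! ### The weight table -/

/-- The array `3` holds the offsets of the variables below `k`, and the array `2` the codes of the
weights of their values. -/
def Tabulated (D : ℕ) (card : ℕ → ℕ) (ω : ℕ → ℕ → ℕ) (k : ℕ) (σ : State) : Prop :=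
  ∀ X < k, σ.mem 3 X = X * D ∧ ∀ x < card X, σ.mem 2 (X * D + x) = ω X x

/-- All variables use the same stride `D`, at least as large as every number of values, so earlier
blocks end before position `k * D`. -/
theorem Tabulated.step {D : ℕ} {card : ℕ → ℕ} {ω : ℕ → ℕ → ℕ} {k : ℕ} {σ τ : State}
    (h : Tabulated D card ω k σ) (hD : ∀ X < k, card X ≤ D)
    (h3 : τ.mem 3 = Function.update (σ.mem 3) k (k * D))
    (hold : ∀ i < k * D, τ.mem 2 i = σ.mem 2 i)
    (hnew : ∀ x < card k, τ.mem 2 (k * D + x) = ω k x) : Tabulated D card ω (k + 1) τ := by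
  intro X hX
  rcases Nat.lt_succ_iff_lt_or_eq.1 hX with hX | rfl
  · refine ⟨by rw [h3, Function.update_of_ne hX.ne, (h X hX).1], fun x hx => ?_⟩
    rw [hold _ ?_, (h X hX).2 x hx]
    have h1 := hD X hX
    have h2 := Nat.mul_le_mul_right D (Nat.succ_le_of_lt hX)
    rw [Nat.succ_mul] at h2
    omega
  · exact ⟨by rw [h3, Function.update_self], hnew⟩

theorem Tabulated.congr {D : ℕ} {card : ℕ → ℕ} {ω : ℕ → ℕ → ℕ} {k : ℕ} {σ τ : State}
    (h : Tabulated D card ω k σ) (h3 : τ.mem 3 = σ.mem 3) (h2 : τ.mem 2 = σ.mem 2) :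
    Tabulated D card ω k τ := by
  unfold Tabulated
  rwa [h3, h2]

/-- The array `50`, with its length in register `50`, holds the sequence `w`. -/
structure Holds (w : List ℕ) (σ : State) : Prop where
  mem : σ.mem 50 = fun i => w.getD i 0
  len : σ.reg 50 = w.length

theorem Holds.congr {w : List ℕ} {σ τ : State} (h : Holds w σ) (hm : τ.mem 50 = σ.mem 50)
    (hr : τ.reg 50 = σ.reg 50) : Holds w τ :=
  ⟨hm.trans h.mem, hr.trans h.len⟩

theorem Holds.push {w : List ℕ} {σ τ : State} (h : Holds w σ) {v : ℕ}
    (hm : τ.mem 50 = Function.update (σ.mem 50) (σ.reg 50) v) (hr : τ.reg 50 = σ.reg 50 + 1) :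
    Holds (w ++ [v]) τ :=
  ⟨by rw [hm, h.mem, h.len, update_getD], by rw [hr, h.len]; simp⟩

open Instr in
/-- Filling in the weights of the values of an original variable. -/
def domFill : Prog := .loop 8 (.block [store 2 35 33, add 35 35 48, add 33 33 28, sub 8 8 48])

theorem runs_domFill {σ : State} (hσ : Ready σ) {b c : ℕ} (h35 : σ.reg 35 = b)
    (h33 : σ.reg 33 = 1) (h8 : σ.reg 8 = c) :
    Runs domFill σ (5 * c + 1) fun τ => (∀ i < b, τ.mem 2 i = σ.mem 2 i) ∧
      ∀ x < c, τ.mem 2 (b + x) = x * σ.reg 28 + 1 := by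
  refine (Runs.loop_up (c := 4) (fun i τ => τ.reg 35 = b + i ∧ τ.reg 33 = i * σ.reg 28 + 1 ∧
    (∀ i < b, τ.mem 2 i = σ.mem 2 i) ∧ ∀ x < i, τ.mem 2 (b + x) = x * σ.reg 28 + 1) h8 ?_ ?_).mono
    (by omega) fun τ h => ⟨h.2.2.1, h.2.2.2⟩
  · simp [h35, h33]
  · rintro i τ hi hf hr ⟨h1, h2, h3, h4⟩
    refine Runs.block ?_
    have h28 : τ.reg 28 = σ.reg 28 := hf.reg 28 rfl
    have hone := (hf.ready hσ rfl rfl).one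
    simp only [List.foldl_cons, List.foldl_nil, Instr.run]
    refine ⟨by simp [hr, hone], by simp [h1, hone]; omega, by simp [h2, h28]; ring, ?_, ?_⟩
    · intro j hj
      simp only [Function.update_self, h1]
      rw [Function.update_of_ne (by omega), h3 j hj]
    · intro x hx
      simp only [Function.update_self, h1, h2]
      rcases Nat.lt_succ_iff_lt_or_eq.1 hx with hx | rfl
      · rw [Function.update_of_ne (by omega), h4 x hx]
      · simp

open Instr in
/-- The treatment of one original variable. -/
def domBody : Prog :=
  .block [load 8 0 2, store 50 50 8, add 50 50 48, store 3 9 29, add 35 29 47, const 33 1] ;;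
    domFill ;; .block [add 30 5 47] ;; shiftProg 28 30 ;;
    .block [add 2 2 48, add 29 29 6, add 9 9 48, sub 7 7 48]

open Instr in
/-- The first part of the encoding of the expanded model: the original variables. -/
def domProg : Prog :=
  .block [add 30 3 4, add 30 30 48, store 50 50 30, add 50 50 48, const 2 1, const 28 1,
    const 29 0, const 9 0, add 7 3 47] ;;
  .loop 7 domBody

/-- Registers `28`, `29` and `9` carry the place value, the table offset and the name of the current
variable, updated from round to round by a shift and additions. -/
theorem runs_domBody {M : Model} {σ : State} (hσ : Env M σ) {w : List ℕ} (hw : Holds w σ)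
    {card : ℕ → ℕ} {ω : ℕ → ℕ → ℕ} {X : ℕ} (hX : X < M.dom.length)
    (hcard : ∀ Y < X, card Y ≤ M.size ^ 4) (hc : card X = M.card X) (hcs : M.card X ≤ M.size)
    (hω : ∀ x < M.card X, ω X x = x * 2 ^ (M.size * X) + 1)
    (hT : Tabulated (M.size ^ 4) card ω X σ) (h2 : σ.reg 2 = 1 + X)
    (h28 : σ.reg 28 = 2 ^ (M.size * X)) (h29 : σ.reg 29 = X * M.size ^ 4) (h9 : σ.reg 9 = X) :
    Runs domBody σ (8 * M.size + 13) fun τ => τ.reg 7 = σ.reg 7 - 1 ∧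
      Holds (w ++ [M.card X]) τ ∧ Tabulated (M.size ^ 4) card ω (X + 1) τ ∧
      τ.reg 2 = 1 + (X + 1) ∧ τ.reg 28 = 2 ^ (M.size * (X + 1)) ∧
      τ.reg 29 = (X + 1) * M.size ^ 4 ∧ τ.reg 9 = X + 1 := by
  have hread : σ.mem 0 (1 + X) = M.card X := by
    rw [hσ.input]
    simp only [Model.encode, Model.card, List.cons_append]
    rw [add_comm 1 X, List.getD_cons_succ, List.getD_append _ _ _ _ hX]
  refine ((Runs.block (Q := fun τ => τ.reg 8 = M.card X ∧ Holds (w ++ [M.card X]) τ ∧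
    τ.mem 3 = Function.update (σ.mem 3) X (X * M.size ^ 4) ∧ τ.reg 35 = X * M.size ^ 4 ∧
    τ.reg 33 = 1) ?_).seq (l := 8 * M.size + 7) ?_).le (by simp; omega)
  · simp only [List.foldl_cons, List.foldl_nil, Instr.run]
    refine ⟨by simp [h2, hread], hw.push ?_ ?_, ?_, ?_, ?_⟩ <;>
      simp [h2, hread, hσ.ready.one, hσ.ready.zero, h9, h29]
  rintro τ₁ ⟨h8, hw₁, h3, h35, h33⟩ hf₁
  have e₁ := hf₁.env hσ rfl
  refine ((runs_domFill e₁.ready h35 h33 h8).seq (l := 3 * M.size + 6) ?_).le (by omega)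
  rintro τ₂ ⟨hold, hnew⟩ hf₂
  have e₂ := hf₂.env e₁ rfl
  refine ((Runs.block (Q := fun τ => τ.reg 30 = M.size) ?_).seq (l := 3 * M.size + 5) ?_).le
    (by simp; omega)
  · simp [Instr.run, e₂.ready.zero, e₂.size]
  intro τ₃ h30 hf₃
  have e₃ := hf₃.env e₂ rfl
  refine ((runs_shiftProg (d := 28) (c := 30) (by norm_num) (by norm_num) e₃.ready.one h30).seq
    (l := 4) ?_).le (by omega)
  intro τ₄ h28' hf₄
  have e₄ := hf₄.env e₃ rfl
  have hmem : ∀ A, τ₄.mem A = τ₂.mem A := fun A => (hf₄.mem A rfl).trans (hf₃.mem A rfl)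
  have hreg : ∀ r, r ≠ 28 → r ≠ 30 → domFill.writes r = false → τ₄.reg r = τ₁.reg r := by
    intro r h1 h2 h3
    rw [hf₄.reg r (by simp [shiftProg, Prog.block, Prog.writes, Instr.writes, h1.symm, h2.symm]),
      hf₃.reg r (by simp [Prog.block, Prog.writes, Instr.writes, h2.symm]), hf₂.reg r h3]
  have hT₄ : Tabulated (M.size ^ 4) card ω (X + 1) τ₄ := by
    refine hT.step hcard ?_ ?_ ?_
    · rw [hmem, hf₂.mem 3 rfl, h3]
    · intro i hi
      rw [hmem, hold i hi, hf₁.mem 2 rfl]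
    · intro x hx
      rw [hc] at hx
      rw [hmem, hnew x hx, hω x hx, hf₁.reg 28 rfl, h28]
  have hw₄ : Holds (w ++ [M.card X]) τ₄ :=
    hw₁.congr (by rw [hmem, hf₂.mem 50 rfl]) (hreg 50 (by norm_num) (by norm_num) rfl)
  refine Runs.block ?_
  have r2 := (hreg 2 (by norm_num) (by norm_num) rfl).trans (hf₁.reg 2 rfl)
  have r29 := (hreg 29 (by norm_num) (by norm_num) rfl).trans (hf₁.reg 29 rfl)
  have r9 := (hreg 9 (by norm_num) (by norm_num) rfl).trans (hf₁.reg 9 rfl)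
  have r7 := (hreg 7 (by norm_num) (by norm_num) rfl).trans (hf₁.reg 7 rfl)
  simp only [List.foldl_cons, List.foldl_nil, Instr.run]
  refine ⟨by simp [r7, e₄.ready.one], hw₄.congr rfl (by simp), hT₄.congr rfl rfl, ?_, ?_, ?_, ?_⟩
  · simp [r2, h2, e₄.ready.one]; ring
  · simp [h28', hf₃.reg 28 rfl, hf₂.reg 28 rfl, hf₁.reg 28 rfl, h28, ← pow_add]; ring
  · simp [r29, h29, e₄.dummy]; ring
  · simp [r9, h9, e₄.ready.one]

theorem runs_domProg {M : Model} {σ : State} (hσ : Env M σ) (hw : Holds [] σ)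
    {card : ℕ → ℕ} {ω : ℕ → ℕ → ℕ} (hcs : ∀ X < M.dom.length, M.card X ≤ M.size)
    (hc : ∀ X < M.dom.length, card X = M.card X)
    (hω : ∀ X < M.dom.length, ∀ x < M.card X, ω X x = x * 2 ^ (M.size * X) + 1) :
    Runs domProg σ (M.dom.length * (8 * M.size + 14) + 10) fun τ =>
      Holds ((M.dom.length + M.factors.length + 1) :: M.dom) τ ∧
      Tabulated (M.size ^ 4) card ω M.dom.length τ ∧
      τ.reg 28 = 2 ^ (M.size * M.dom.length) ∧ τ.reg 29 = M.dom.length * M.size ^ 4 ∧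
      τ.reg 9 = M.dom.length := by
  refine ((Runs.block (Q := fun τ => Holds [M.dom.length + M.factors.length + 1] τ ∧
    τ.reg 2 = 1 ∧ τ.reg 28 = 1 ∧ τ.reg 29 = 0 ∧ τ.reg 9 = 0 ∧ τ.reg 7 = M.dom.length) ?_).seq
    (l := M.dom.length * (8 * M.size + 14) + 1) ?_).le (by simp; omega)
  · simp only [List.foldl_cons, List.foldl_nil, Instr.run]
    refine ⟨hw.push ?_ ?_, ?_⟩ <;>
      simp [hσ.vars, hσ.facs, hσ.ready.one, hσ.ready.zero]
  rintro τ₁ ⟨hw₁, h2, h28, h29, h9, h7⟩ hf₁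
  have e₁ := hf₁.env hσ rfl
  have hs := M.two_le_size
  have hle : ∀ X < M.dom.length, card X ≤ M.size ^ 4 := fun X hX => by
    rw [hc X hX]
    exact (hcs X hX).trans (Nat.le_self_pow (by norm_num) _)
  refine (Runs.loop_up (c := 8 * M.size + 13) (fun X τ =>
    Holds ((M.dom.length + M.factors.length + 1) :: M.dom.take X) τ ∧
      Tabulated (M.size ^ 4) card ω X τ ∧ τ.reg 2 = 1 + X ∧ τ.reg 28 = 2 ^ (M.size * X) ∧
      τ.reg 29 = X * M.size ^ 4 ∧ τ.reg 9 = X) h7 ?_ ?_).mono le_rfl ?_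
  · exact ⟨by simpa using hw₁, fun X hX => by omega, h2, by simpa using h28, by simpa using h29, h9⟩
  · rintro X τ hX hf hr ⟨i1, i2, i3, i4, i5, i6⟩
    refine (runs_domBody (hf.env e₁ rfl) i1 hX (fun Y hY => hle Y (by omega)) (hc X hX)
      (hcs X hX) (hω X hX) i2 i3 i4 i5 i6).mono le_rfl ?_
    rintro υ ⟨j0, j1, j2⟩
    refine ⟨by omega, ?_, j2⟩
    have : M.card X = M.dom[X] := List.getD_eq_getElem _ _ hX
    rw [List.take_succ_eq_append_getElem hX, ← this]
    exact j1
  · rintro τ ⟨i1, i2, -, i4, i5, i6⟩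
    rw [List.take_length] at i1
    exact ⟨i1, i2, i4, i5, i6⟩

end ArithCirc

namespace ArithCirc

/-! ### Weights of the rows of the factors -/

open Instr in
/-- The treatment of one row of a factor. -/
def rowBody : Prog :=
  .block [load 30 0 2, add 2 2 48, load 36 0 2, add 2 2 48] ;; rowProg ;;
    .block [store 2 35 32, add 35 35 48, sub 8 8 48]

theorem runs_rowLoop {M : Model} (table : List ℚ≥0) {σ : State} (hσ : Env M σ)
    (h28 : σ.reg 28 = 2 ^ (M.size * M.dom.length))
    (hsz : ∀ q ∈ table, q.num.size + q.den.size ≤ M.size) (h8 : σ.reg 8 = table.length)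
    (hseg : Seg (σ.mem 0) (σ.reg 2) (table.flatMap fun q => [q.num, q.den])) :
    Runs (.loop 8 rowBody) σ (table.length * (rowCost M.size + 8) + 1) fun τ =>
      τ.reg 2 = σ.reg 2 + 2 * table.length ∧
      (∀ i < σ.reg 35, τ.mem 2 i = σ.mem 2 i) ∧ ∀ x < table.length,
        τ.mem 2 (σ.reg 35 + x) = rowCode M.size M.dom.length (table.getD x 0) := by
  induction table generalizing σ with
  | nil => exact (Runs.loop_done (by simpa using h8) (by simp)).le (by simp)
  | cons q table ih =>
    rw [List.flatMap_cons, List.cons_append, List.cons_append, seg_cons, seg_cons,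
      List.nil_append] at hseg
    obtain ⟨hs1, hs2, hs3⟩ := hseg
    have hq := hsz q (by simp)
    refine (Runs.loop_step (by simp [h8]) (k := rowCost M.size + 7) (Q' := fun τ =>
      τ.reg 2 = σ.reg 2 + 2 ∧ τ.reg 8 = table.length ∧ τ.reg 35 = σ.reg 35 + 1 ∧
      τ.reg 28 = 2 ^ (M.size * M.dom.length) ∧
      τ.mem 2 = Function.update (σ.mem 2) (σ.reg 35) (rowCode M.size M.dom.length q)) ?_
      (l := table.length * (rowCost M.size + 8) + 1) ?_).le ?_
    · refine ((Runs.block (Q := fun τ => τ.reg 30 = q.num ∧ τ.reg 36 = q.den ∧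
        τ.reg 2 = σ.reg 2 + 2) ?_).seq (l := rowCost M.size + 3) ?_).le (by simp; omega)
      · simp [Instr.run, hs1, hs2, hσ.ready.one]
      rintro τ₁ ⟨h30, h36, h2⟩ hf₁
      have e₁ := hf₁.env hσ rfl
      refine (runs_rowProg e₁ h30 h36 ((hf₁.reg 28 rfl).trans h28) (by omega) (by omega)).seq
        (l := 3) ?_
      intro τ₂ h32 hf₂
      have e₂ := hf₂.env e₁ rfl
      refine Runs.block ?_
      simp [Instr.run, e₂.ready.one, hf₂.reg 2 rfl, h2, hf₂.reg 8 rfl, hf₁.reg 8 rfl, h8,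
        hf₂.reg 35 rfl, hf₁.reg 35 rfl, hf₂.reg 28 rfl, hf₁.reg 28 rfl, h28, hf₂.mem 2 rfl,
        hf₁.mem 2 rfl, h32]
    · rintro τ ⟨h2, h8', h35, h28', hm⟩ hf
      refine (ih (hf.env hσ rfl) h28' (fun q hq => hsz q (by simp [hq])) h8' ?_).mono le_rfl ?_
      · rw [hf.mem 0 rfl, h2]
        exact hs3
      · rintro υ ⟨i1, i2, i3⟩
        refine ⟨by rw [i1, h2, List.length_cons]; ring, ?_, ?_⟩
        · intro i hi
          rw [i2 i (by omega), hm, Function.update_of_ne (by omega)]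
        · intro x hx
          cases x with
          | zero =>
            rw [i2 _ (by omega), hm]
            simp
          | succ x =>
            have := i3 x (by simpa using hx)
            rw [h35] at this
            rw [show σ.reg 35 + (x + 1) = σ.reg 35 + 1 + x by omega, this]
            simp
    · rw [List.length_cons, Nat.succ_mul]
      omega

open Instr in
/-- The treatment of one factor. -/
def factorBody : Prog :=
  .block [load 30 0 2, add 2 2 30, add 2 2 48, load 8 0 2, add 2 2 48, store 50 50 8,
    add 50 50 48, store 3 9 29, add 35 29 47] ;;
  .loop 8 rowBody ;; .block [add 29 29 6, add 9 9 48, sub 7 7 48]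

/-- Here `X` names the next row variable. This pass skips the scopes: the number of rows gives the
domain of the row variable, and the table gives its weights. -/
theorem runs_factorLoop {M : Model} (fs : List Factor) {σ : State} (hσ : Env M σ)
    {card : ℕ → ℕ} {ω : ℕ → ℕ → ℕ} {X : ℕ} {w : List ℕ} (hw : Holds w σ)
    (h28 : σ.reg 28 = 2 ^ (M.size * M.dom.length))
    (hsz : ∀ f ∈ fs, ∀ q ∈ f.table, q.num.size + q.den.size ≤ M.size)
    (hcard : ∀ Y < X + fs.length, card Y ≤ M.size ^ 4)
    (hc : ∀ i (h : i < fs.length), card (X + i) = fs[i].table.length)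
    (hω : ∀ i (h : i < fs.length), ∀ x, ω (X + i) x =
      rowCode M.size M.dom.length (fs[i].table.getD x 0))
    (hT : Tabulated (M.size ^ 4) card ω X σ)
    (h7 : σ.reg 7 = fs.length) (h29 : σ.reg 29 = X * M.size ^ 4) (h9 : σ.reg 9 = X)
    (hseg : Seg (σ.mem 0) (σ.reg 2) (fs.flatMap Factor.encode)) :
    Runs (.loop 7 factorBody) σ
      ((fs.map fun f => f.table.length * (rowCost M.size + 8) + 14).sum + 1) fun τ =>
      Holds (w ++ fs.map fun f => f.table.length) τ ∧
      Tabulated (M.size ^ 4) card ω (X + fs.length) τ ∧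
      τ.reg 29 = (X + fs.length) * M.size ^ 4 ∧ τ.reg 9 = X + fs.length := by
  induction fs generalizing σ X w with
  | nil =>
    refine Runs.loop_done (by simpa using h7) ?_
    simpa using ⟨hw, hT, h29, h9⟩
  | cons f fs ih =>
    rw [List.flatMap_cons, seg_append, Factor.encode, List.cons_append, seg_cons, seg_append,
      seg_cons] at hseg
    obtain ⟨⟨g1, -, g2, g3⟩, g4⟩ := hseg
    refine (Runs.loop_step (by simp [h7]) (k := f.table.length * (rowCost M.size + 8) + 13)
      (Q' := fun τ => Holds (w ++ [f.table.length]) τ ∧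
        Tabulated (M.size ^ 4) card ω (X + 1) τ ∧
        τ.reg 28 = 2 ^ (M.size * M.dom.length) ∧ τ.reg 7 = fs.length ∧
        τ.reg 29 = (X + 1) * M.size ^ 4 ∧ τ.reg 9 = X + 1 ∧
        τ.reg 2 = σ.reg 2 + f.scope.length + 2 + 2 * f.table.length) ?_
      (l := (fs.map fun f => f.table.length * (rowCost M.size + 8) + 14).sum + 1) ?_).le ?_
    · refine ((Runs.block (Q := fun τ => τ.reg 8 = f.table.length ∧
        Holds (w ++ [f.table.length]) τ ∧ τ.reg 35 = X * M.size ^ 4 ∧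
        τ.mem 3 = Function.update (σ.mem 3) X (X * M.size ^ 4) ∧
        τ.reg 2 = σ.reg 2 + f.scope.length + 2) ?_).seq
        (l := f.table.length * (rowCost M.size + 8) + 4) ?_).le (by simp; omega)
      · have g2' : σ.mem 0 (σ.reg 2 + f.scope.length + 1) = f.table.length := by
          rw [← g2]; congr 1; omega
        simp only [List.foldl_cons, List.foldl_nil, Instr.run]
        refine ⟨?_, hw.push ?_ ?_, ?_, ?_, ?_⟩ <;>
          simp [g1, g2', hσ.ready.one, hσ.ready.zero, h29, h9]
      rintro τ₁ ⟨h8, hw₁, h35, h3, h2⟩ hf₁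
      have e₁ := hf₁.env hσ rfl
      refine ((runs_rowLoop f.table e₁ ((hf₁.reg 28 rfl).trans h28) (hsz f (by simp)) h8 ?_).seq
        (l := 3) ?_).le (by omega)
      · rw [hf₁.mem 0 rfl, h2]
        rwa [show σ.reg 2 + 1 + f.scope.length + 1 = σ.reg 2 + f.scope.length + 2 by omega] at g3
      rintro τ₂ ⟨i1, i2, i3⟩ hf₂
      have e₂ := hf₂.env e₁ rfl
      rw [h35] at i2 i3
      have hc0 : card X = f.table.length := hc 0 (by simp)
      have hω0 : ∀ x, ω X x = rowCode M.size M.dom.length (f.table.getD x 0) :=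
        hω 0 (by simp)
      have hT₂ : Tabulated (M.size ^ 4) card ω (X + 1) τ₂ := by
        refine hT.step (fun Y hY => hcard Y (by omega)) ?_ ?_ ?_
        · rw [hf₂.mem 3 rfl, h3]
        · intro i hi
          rw [i2 i hi, hf₁.mem 2 rfl]
        · intro x hx
          rw [hω0, i3 x (by omega)]
      have hw₂ : Holds (w ++ [f.table.length]) τ₂ := hw₁.congr (hf₂.mem 50 rfl) (hf₂.reg 50 rfl)
      refine Runs.block ?_
      simp only [List.foldl_cons, List.foldl_nil, Instr.run]
      refine ⟨hw₂.congr rfl (by simp), hT₂.congr rfl rfl, ?_, ?_, ?_, ?_, ?_⟩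
      · simp [hf₂.reg 28 rfl, hf₁.reg 28 rfl, h28]
      · simp [hf₂.reg 7 rfl, hf₁.reg 7 rfl, h7, e₂.ready.one]
      · simp [hf₂.reg 29 rfl, hf₁.reg 29 rfl, h29, e₂.dummy]; ring
      · simp [hf₂.reg 9 rfl, hf₁.reg 9 rfl, h9, e₂.ready.one]
      · simp [i1, h2]
    · rintro τ ⟨j1, j2, j3, j4, j5, j6, j7⟩ hf
      refine (ih (hf.env hσ rfl) j1 j3 (fun f hf => hsz f (by simp [hf])) ?_ ?_ ?_ j2 j4 j5 j6
        ?_).mono le_rfl ?_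
      · intro Y hY
        exact hcard Y (by simp; omega)
      · intro i h
        have := hc (i + 1) (by simpa using h)
        rwa [show X + (i + 1) = X + 1 + i by omega] at this
      · intro i h
        have := hω (i + 1) (by simpa using h)
        rwa [show X + (i + 1) = X + 1 + i by omega] at this
      · rw [hf.mem 0 rfl, j7]
        have hlen : (f.scope.length :: (f.scope ++ f.table.length ::
            f.table.flatMap fun q => [q.num, q.den])).length =
              f.scope.length + 2 + 2 * f.table.length := by
          simp; omega
        rw [hlen] at g4
        rwa [show σ.reg 2 + f.scope.length + 2 + 2 * f.table.length =
          σ.reg 2 + (f.scope.length + 2 + 2 * f.table.length) by omega]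
      · rintro υ ⟨k1, k2, k3, k4⟩
        rw [List.length_cons, show X + (fs.length + 1) = X + 1 + fs.length by omega]
        exact ⟨by simpa using k1, k2, k3, k4⟩
    · simp only [List.map_cons, List.sum_cons]
      omega

open Instr in
/-- The second part of the encoding of the expanded model: the row variables. -/
def rowsProg : Prog := .block [add 2 3 48, add 2 2 48, add 7 4 47] ;; .loop 7 factorBody

/-- The position of the first factor in the encoding of a model. -/
theorem seg_factors (M : Model) :
    Seg (fun i => M.encode.getD i 0) (M.dom.length + 2) (M.factors.flatMap Factor.encode) := by
  have h := seg_getD M.encode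
  conv at h => rw [Model.encode]
  rw [List.cons_append, seg_cons, seg_append, seg_cons] at h
  have := h.2.2.2
  rwa [show 0 + 1 + M.dom.length + 1 = M.dom.length + 2 by omega] at this

theorem runs_rowsProg {M : Model} {σ : State} (hσ : Env M σ)
    {card : ℕ → ℕ} {ω : ℕ → ℕ → ℕ} {w : List ℕ} (hw : Holds w σ)
    (h28 : σ.reg 28 = 2 ^ (M.size * M.dom.length))
    (hsz : ∀ f ∈ M.factors, ∀ q ∈ f.table, q.num.size + q.den.size ≤ M.size)
    (hcard : ∀ Y < M.dom.length + M.factors.length, card Y ≤ M.size ^ 4)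
    (hc : ∀ i (h : i < M.factors.length), card (M.dom.length + i) = M.factors[i].table.length)
    (hω : ∀ i (h : i < M.factors.length), ∀ x, ω (M.dom.length + i) x =
      rowCode M.size M.dom.length (M.factors[i].table.getD x 0))
    (hT : Tabulated (M.size ^ 4) card ω M.dom.length σ)
    (h29 : σ.reg 29 = M.dom.length * M.size ^ 4) (h9 : σ.reg 9 = M.dom.length) :
    Runs rowsProg σ
      ((M.factors.map fun f => f.table.length * (rowCost M.size + 8) + 14).sum + 4) fun τ =>
      Holds (w ++ M.factors.map fun f => f.table.length) τ ∧
      Tabulated (M.size ^ 4) card ω (M.dom.length + M.factors.length) τ ∧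
      τ.reg 29 = (M.dom.length + M.factors.length) * M.size ^ 4 ∧
      τ.reg 9 = M.dom.length + M.factors.length := by
  refine ((Runs.block (Q := fun τ => τ.reg 2 = M.dom.length + 2 ∧ τ.reg 7 = M.factors.length)
    ?_).seq (l := (M.factors.map fun f => f.table.length * (rowCost M.size + 8) + 14).sum + 1)
    ?_).le (by simp; omega)
  · simp [Instr.run, hσ.vars, hσ.facs, hσ.ready.one, hσ.ready.zero]
  · rintro τ ⟨h2, h7⟩ hf
    refine runs_factorLoop M.factors (hf.env hσ rfl) (hw.congr (hf.mem 50 rfl) (hf.reg 50 rfl))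
      ((hf.reg 28 rfl).trans h28) hsz hcard hc hω (hT.congr (hf.mem 3 rfl) (hf.mem 2 rfl)) h7
      ((hf.reg 29 rfl).trans h29) ((hf.reg 9 rfl).trans h9) ?_
    rw [hf.mem 0 rfl, hσ.input, h2]
    exact seg_factors M

/-! ### The dummy variable -/

open Instr in
/-- The third part of the encoding of the expanded model: the dummy variable. -/
def dummyProg : Prog :=
  .block [store 50 50 6, add 50 50 48, store 3 9 29, add 35 29 47, add 8 6 47] ;;
  .loop 8 (.block [store 2 35 48, add 35 35 48, sub 8 8 48]) ;;
  .block [add 30 4 48, store 50 50 30, add 50 50 48]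

theorem runs_dummyProg {M : Model} {σ : State} (hσ : Env M σ)
    {card : ℕ → ℕ} {ω : ℕ → ℕ → ℕ} {w : List ℕ} {X : ℕ} (hw : Holds w σ)
    (hcard : ∀ Y < X, card Y ≤ M.size ^ 4) (hc : card X = M.size ^ 4) (hω : ∀ x, ω X x = 1)
    (hT : Tabulated (M.size ^ 4) card ω X σ) (h29 : σ.reg 29 = X * M.size ^ 4)
    (h9 : σ.reg 9 = X) :
    Runs dummyProg σ (4 * M.size ^ 4 + 9) fun τ =>
      Holds (w ++ [M.size ^ 4] ++ [M.factors.length + 1]) τ ∧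
      Tabulated (M.size ^ 4) card ω (X + 1) τ := by
  refine ((Runs.block (Q := fun τ => Holds (w ++ [M.size ^ 4]) τ ∧ τ.reg 35 = X * M.size ^ 4 ∧
    τ.mem 3 = Function.update (σ.mem 3) X (X * M.size ^ 4) ∧ τ.reg 8 = M.size ^ 4) ?_).seq
    (l := 4 * M.size ^ 4 + 4) ?_).le (by simp; omega)
  · simp only [List.foldl_cons, List.foldl_nil, Instr.run]
    refine ⟨hw.push ?_ ?_, ?_, ?_, ?_⟩ <;>
      simp [hσ.ready.one, hσ.ready.zero, h29, h9, hσ.dummy]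
  rintro τ₁ ⟨hw₁, h35, h3, h8⟩ hf₁
  have e₁ := hf₁.env hσ rfl
  refine ((Runs.loop_up (c := 3) (fun i τ => τ.reg 35 = X * M.size ^ 4 + i ∧
    (∀ i < X * M.size ^ 4, τ.mem 2 i = τ₁.mem 2 i) ∧
      ∀ x < i, τ.mem 2 (X * M.size ^ 4 + x) = 1) h8 ?_ ?_).seq (l := 3) ?_).le (by omega)
  · simp [h35]
  · rintro i τ hi hf hr ⟨i1, i2, i3⟩
    refine Runs.block ?_
    have hone := (hf.ready e₁.ready rfl rfl).one
    simp only [List.foldl_cons, List.foldl_nil, Instr.run]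
    refine ⟨by simp [hr, hone], by simp [i1, hone]; omega, ?_, ?_⟩
    · intro j hj
      simp only [Function.update_self, i1]
      rw [Function.update_of_ne (by omega), i2 j hj]
    · intro x hx
      simp only [Function.update_self, i1, hone]
      rcases Nat.lt_succ_iff_lt_or_eq.1 hx with hx | rfl
      · rw [Function.update_of_ne (by omega), i3 x hx]
      · simp
  rintro τ₂ ⟨-, i2, i3⟩ hf₂
  have e₂ := hf₂.env e₁ rfl
  have hT₂ : Tabulated (M.size ^ 4) card ω (X + 1) τ₂ := by
    refine hT.step hcard ?_ ?_ ?_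
    · rw [hf₂.mem 3 rfl, h3]
    · intro i hi
      rw [i2 i hi, hf₁.mem 2 rfl]
    · intro x hx
      rw [hω, i3 x (by omega)]
  have hw₂ := hw₁.congr (hf₂.mem 50 rfl) (hf₂.reg 50 rfl)
  refine Runs.block ?_
  simp only [List.foldl_cons, List.foldl_nil, Instr.run]
  refine ⟨hw₂.push ?_ ?_, hT₂.congr rfl rfl⟩ <;>
    simp [e₂.ready.one, e₂.facs]

/-! ### The factors of the expanded model -/

open Instr in
/-- Copying a part of the input, the length of which is in register `8`. -/
def copyProg : Prog :=
  .loop 8 (.block [load 30 0 2, store 50 50 30, add 50 50 48, add 2 2 48, sub 8 8 48])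

theorem runs_copyProg {M : Model} (l : List ℕ) {σ : State} (hσ : Env M σ) {w : List ℕ}
    (hw : Holds w σ) (h8 : σ.reg 8 = l.length) (hl : Seg (σ.mem 0) (σ.reg 2) l) :
    Runs copyProg σ (6 * l.length + 1) fun τ => Holds (w ++ l) τ ∧
      τ.reg 2 = σ.reg 2 + l.length := by
  induction l generalizing σ w with
  | nil => exact Runs.loop_done (by simpa using h8) (by simpa using hw)
  | cons v l ih =>
    rw [seg_cons] at hl
    refine (Runs.loop_step (by simp [h8]) (Runs.block (Q := fun τ => Holds (w ++ [v]) τ ∧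
      τ.reg 2 = σ.reg 2 + 1 ∧ τ.reg 8 = l.length) ?_) (l := 6 * l.length + 1) ?_).le
      (by simp; omega)
    · simp only [List.foldl_cons, List.foldl_nil, Instr.run]
      refine ⟨hw.push ?_ ?_, ?_, ?_⟩ <;> simp [hσ.ready.one, hl.1, h8]
    · rintro τ ⟨i1, i2, i3⟩ hf
      refine (ih (hf.env hσ rfl) i1 i3 ?_).mono le_rfl ?_
      · rw [hf.mem 0 rfl, i2]
        exact hl.2
      · rintro υ ⟨j1, j2⟩
        exact ⟨by simpa using j1, by rw [j2, i2, List.length_cons]; omega⟩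

open Instr in
/-- Writing the table of the identity matrix; register `30` holds its order and register `8` its
number of entries. -/
def diagProg : Prog :=
  .loop 8 (.cond 33 (.block [store 50 50 47, add 50 50 48, sub 33 33 48])
      (.block [store 50 50 48, add 50 50 48, add 33 30 47]) ;;
    .block [store 50 50 48, add 50 50 48, sub 8 8 48])

/-- The first `k` entries of the table of the identity matrix of order `L`, encoded. -/
def diagEncode (L k : ℕ) : List ℕ :=
  (List.range k).flatMap fun k => [if (L + 1) ∣ k then 1 else 0, 1]

theorem diagEncode_succ (L k : ℕ) :
    diagEncode L (k + 1) = diagEncode L k ++ [if (L + 1) ∣ k then 1 else 0] ++ [1] := by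
  simp [diagEncode, List.range_succ]

theorem runs_diagProg {M : Model} {σ : State} (hσ : Env M σ) {w : List ℕ} (hw : Holds w σ)
    {L K : ℕ} (h30 : σ.reg 30 = L) (h33 : σ.reg 33 = 0) (h8 : σ.reg 8 = K) :
    Runs diagProg σ (8 * K + 1) fun τ => Holds (w ++ diagEncode L K) τ := by
  -- Register `33` counts down to the next diagonal position: `k + reg 33` is a multiple of `L + 1`
  -- and `reg 33 ≤ L`, so entry `k` is `1` exactly when the register is `0`.
  refine (Runs.loop_up (c := 7) (fun k τ => Holds (w ++ diagEncode L k) τ ∧ τ.reg 33 ≤ L ∧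
    (L + 1) ∣ k + τ.reg 33) h8 ?_ ?_).mono (by omega) fun τ h => h.1
  · exact ⟨by simpa [diagEncode] using hw, by omega, by simp [h33]⟩
  rintro k τ hk hf hr ⟨i1, i2, i3⟩
  have e := hf.env hσ rfl
  have hiff : (L + 1) ∣ k ↔ τ.reg 33 = 0 := by
    constructor
    · intro h
      exact Nat.eq_zero_of_dvd_of_lt ((Nat.dvd_add_right h).1 i3) (by omega)
    · intro h
      rwa [h, add_zero] at i3
  refine ((Runs.cond (k := 3) (Q := fun υ =>
    Holds (w ++ diagEncode L k ++ [if (L + 1) ∣ k then 1 else 0]) υ ∧ υ.reg 33 ≤ L ∧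
      (L + 1) ∣ k + 1 + υ.reg 33 ∧ υ.reg 8 = K - k) ?_ ?_).seq (l := 3) ?_).le (by omega)
  · intro h0
    refine Runs.block ?_
    rw [if_neg (mt hiff.1 h0)]
    simp only [List.foldl_cons, List.foldl_nil, Instr.run]
    refine ⟨i1.push ?_ ?_, ?_, ?_, ?_⟩
    · simp [e.ready.zero]
    · simp [e.ready.one]
    · simp [e.ready.one]; omega
    · simp only [e.ready.one, Function.update_apply]
      norm_num
      rwa [show k + 1 + (τ.reg 33 - 1) = k + τ.reg 33 by omega]
    · simp [hr]
  · intro h0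
    refine Runs.block ?_
    rw [if_pos (hiff.2 h0)]
    have h30' : τ.reg 30 = L := (hf.reg 30 rfl).trans h30
    simp only [List.foldl_cons, List.foldl_nil, Instr.run]
    refine ⟨i1.push ?_ ?_, ?_, ?_, ?_⟩
    · simp [e.ready.one]
    · simp [e.ready.one]
    · simp [e.ready.zero, h30']
    · simp [e.ready.zero, h30', show k + 1 + L = k + (L + 1) by omega, hiff, h0]
    · simp [hr]
  · rintro υ ⟨j1, j2, j3, j4⟩ hf'
    have e' := hf'.ready e.ready rfl rfl
    refine Runs.block ?_
    simp only [List.foldl_cons, List.foldl_nil, Instr.run]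
    refine ⟨by simp [j4, e'.one], ?_, by simpa using j2, by simpa using j3⟩
    rw [diagEncode_succ, ← List.append_assoc, ← List.append_assoc]
    refine j1.push ?_ ?_ <;> simp [e'.one]

open Instr in
/-- Writing one factor of the expanded model. -/
def expandBody : Prog :=
  .block [load 8 0 2, add 2 2 48, add 30 8 48, store 50 50 30, add 50 50 48] ;; copyProg ;;
  .block [store 50 50 9, add 50 50 48, load 30 0 2, add 10 30 47, add 11 30 47, add 2 2 48,
    add 2 2 30, add 2 2 30] ;; mulProg ;;
  .block [store 50 50 12, add 50 50 48, add 8 12 47, const 33 0] ;; diagProg ;;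
  .block [add 9 9 48, sub 7 7 48]

/-- A bound for the running time of `expandBody`. -/
def expandCost (f : Factor) : ℕ :=
  6 * f.scope.length + 8 * f.table.length + 8 * (f.table.length * f.table.length) + 30

theorem encode_expand_factor (f : Factor) (b : ℕ) :
    (⟨f.scope ++ [b], diagTable f.table.length⟩ : Factor).encode =
      [f.scope.length + 1] ++ f.scope ++ [b] ++ [f.table.length * f.table.length] ++
        diagEncode f.table.length (f.table.length * f.table.length) := by
  have : (diagTable f.table.length).flatMap (fun q => [q.num, q.den]) =
      diagEncode f.table.length (f.table.length * f.table.length) := by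
    unfold diagTable diagEncode
    rw [List.flatMap_map]
    congr 1
    funext k
    split_ifs <;> simp
  simp only [Factor.encode, this]
  simp [diagTable]

theorem runs_expandBody {M : Model} {f : Factor} {σ : State} (hσ : Env M σ) {w : List ℕ}
    (hw : Holds w σ) {b : ℕ} (h9 : σ.reg 9 = b) (hseg : Seg (σ.mem 0) (σ.reg 2) f.encode) :
    Runs expandBody σ (expandCost f) fun τ =>
      Holds (w ++ (⟨f.scope ++ [b], diagTable f.table.length⟩ : Factor).encode) τ ∧
      τ.reg 9 = b + 1 ∧ τ.reg 7 = σ.reg 7 - 1 ∧ τ.reg 2 = σ.reg 2 + f.encode.length := by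
  rw [encode_expand_factor]
  have hlen : f.encode.length = f.scope.length + 2 + 2 * f.table.length := by
    simp [Factor.encode]; omega
  rw [Factor.encode, List.cons_append, seg_cons, seg_append, seg_cons] at hseg
  obtain ⟨g1, g2, g3, -⟩ := hseg
  set L := f.table.length with hL
  have hcost : expandCost f = 6 * f.scope.length + 8 * L + 8 * (L * L) + 30 := rfl
  refine ((Runs.block (Q := fun τ => τ.reg 8 = f.scope.length ∧ τ.reg 2 = σ.reg 2 + 1 ∧
    Holds (w ++ [f.scope.length + 1]) τ) ?_).seq
    (l := 6 * f.scope.length + 8 * L + 8 * (L * L) + 18) ?_).le (by simp [hcost]; omega)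
  · simp only [List.foldl_cons, List.foldl_nil, Instr.run]
    refine ⟨?_, ?_, hw.push ?_ ?_⟩ <;> simp [g1, hσ.ready.one]
  rintro τ₁ ⟨h8, h2, hw₁⟩ hf₁
  have e₁ := hf₁.env hσ rfl
  refine ((runs_copyProg f.scope e₁ hw₁ h8 ?_).seq (l := 8 * L + 8 * (L * L) + 17) ?_).le
    (by omega)
  · rw [hf₁.mem 0 rfl, h2]
    exact g2
  rintro τ₂ ⟨hw₂, h2₂⟩ hf₂
  have e₂ := hf₂.env e₁ rfl
  have hread : τ₂.mem 0 (τ₂.reg 2) = L := by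
    rw [hf₂.mem 0 rfl, hf₁.mem 0 rfl, h2₂, h2, g3]
  refine ((Runs.block (Q := fun τ => Holds (w ++ [f.scope.length + 1] ++ f.scope ++ [b]) τ ∧
    τ.reg 30 = L ∧ τ.reg 10 = L ∧ τ.reg 11 = L ∧
    τ.reg 2 = σ.reg 2 + (f.scope.length + 2 + 2 * L)) ?_).seq
    (l := 8 * L + 8 * (L * L) + 9) ?_).le (by simp; omega)
  · simp only [List.foldl_cons, List.foldl_nil, Instr.run]
    refine ⟨hw₂.push ?_ ?_, ?_, ?_, ?_, ?_⟩
    · simp [hf₂.reg 9 rfl, hf₁.reg 9 rfl, h9]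
    · simp [e₂.ready.one]
    · simp [hread]
    · simp [hread, e₂.ready.zero]
    · simp [hread, e₂.ready.zero]
    · simp [hread, e₂.ready.one]; omega
  rintro τ₃ ⟨hw₃, h30, h10, h11, h2₃⟩ hf₃
  have e₃ := hf₃.env e₂ rfl
  refine ((runs_mulProg e₃.ready (k := L) ?_).seq (l := 8 * (L * L) + 7) ?_).le (by omega)
  · rw [h11]
    exact Nat.size_le.2 Nat.lt_two_pow_self
  intro τ₄ h12 hf₄
  have e₄ := hf₄.env e₃ rfl
  rw [h10, h11] at h12
  have hw₄ := hw₃.congr (hf₄.mem 50 rfl) (hf₄.reg 50 rfl)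
  refine ((Runs.block (Q := fun τ =>
    Holds (w ++ [f.scope.length + 1] ++ f.scope ++ [b] ++ [L * L]) τ ∧ τ.reg 8 = L * L ∧
    τ.reg 33 = 0) ?_).seq (l := 8 * (L * L) + 3) ?_).le (by simp; omega)
  · simp only [List.foldl_cons, List.foldl_nil, Instr.run]
    refine ⟨hw₄.push ?_ ?_, ?_, ?_⟩ <;> simp [h12, e₄.ready.one, e₄.ready.zero]
  rintro τ₅ ⟨hw₅, h8₅, h33⟩ hf₅
  have e₅ := hf₅.env e₄ rfl
  refine ((runs_diagProg e₅ hw₅ (L := L) ?_ h33 h8₅).seq (l := 2) ?_).le (by omega)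
  · rw [hf₅.reg 30 rfl, hf₄.reg 30 rfl, h30]
  intro τ₆ hw₆ hf₆
  have e₆ := hf₆.env e₅ rfl
  have r9 : τ₆.reg 9 = b := by
    rw [hf₆.reg 9 rfl, hf₅.reg 9 rfl, hf₄.reg 9 rfl, hf₃.reg 9 rfl, hf₂.reg 9 rfl, hf₁.reg 9 rfl,
      h9]
  have r7 : τ₆.reg 7 = σ.reg 7 := by
    rw [hf₆.reg 7 rfl, hf₅.reg 7 rfl, hf₄.reg 7 rfl, hf₃.reg 7 rfl, hf₂.reg 7 rfl, hf₁.reg 7 rfl]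
  have r2 : τ₆.reg 2 = σ.reg 2 + f.encode.length := by
    rw [hf₆.reg 2 rfl, hf₅.reg 2 rfl, hf₄.reg 2 rfl, h2₃, hlen]
  refine Runs.block ?_
  simp only [List.foldl_cons, List.foldl_nil, Instr.run]
  refine ⟨?_, ?_, ?_, ?_⟩
  · refine Holds.congr (σ := τ₆) (by simpa using hw₆) rfl (by simp)
  · simp [r9, e₆.ready.one]
  · simp [r7, e₆.ready.one]
  · simpa using r2

theorem runs_expandLoop {M : Model} (fs : List Factor) {σ : State} (hσ : Env M σ) {w : List ℕ}
    (hw : Holds w σ) {b : ℕ} (h9 : σ.reg 9 = b) (h7 : σ.reg 7 = fs.length)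
    (hseg : Seg (σ.mem 0) (σ.reg 2) (fs.flatMap Factor.encode)) :
    Runs (.loop 7 expandBody) σ ((fs.map fun f => expandCost f + 1).sum + 1) fun τ =>
      Holds (w ++ (expandFactors b fs).flatMap Factor.encode) τ := by
  induction fs generalizing σ w b with
  | nil => exact Runs.loop_done (by simpa using h7) (by simpa [expandFactors] using hw)
  | cons f fs ih =>
    rw [List.flatMap_cons, seg_append] at hseg
    refine (Runs.loop_step (by simp [h7]) (runs_expandBody hσ hw h9 hseg.1)
      (l := (fs.map fun f => expandCost f + 1).sum + 1) ?_).le (by simp; omega)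
    rintro τ ⟨i1, i2, i3, i4⟩ hf
    refine (ih (hf.env hσ rfl) i1 i2 (by simp [i3, h7]) ?_).mono le_rfl ?_
    · rw [hf.mem 0 rfl, i4]
      exact hseg.2
    · intro υ h
      simpa [expandFactors] using h

open Instr in
/-- The fourth part of the encoding of the expanded model: the factors. -/
def factorsProg : Prog :=
  .block [add 2 3 48, add 2 2 48, add 7 4 47, add 9 3 47] ;; .loop 7 expandBody

theorem runs_factorsProg {M : Model} {σ : State} (hσ : Env M σ) {w : List ℕ} (hw : Holds w σ) :
    Runs factorsProg σ ((M.factors.map fun f => expandCost f + 1).sum + 5) fun τ =>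
      Holds (w ++ (expandFactors M.dom.length M.factors).flatMap Factor.encode) τ := by
  refine ((Runs.block (Q := fun τ => τ.reg 2 = M.dom.length + 2 ∧ τ.reg 7 = M.factors.length ∧
    τ.reg 9 = M.dom.length) ?_).seq (l := (M.factors.map fun f => expandCost f + 1).sum + 1)
    ?_).le (by simp; omega)
  · simp [Instr.run, hσ.vars, hσ.facs, hσ.ready.one, hσ.ready.zero]
  · rintro τ ⟨h2, h7, h9⟩ hf
    refine runs_expandLoop M.factors (hf.env hσ rfl) (hw.congr (hf.mem 50 rfl) (hf.reg 50 rfl))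
      h9 h7 ?_
    rw [hf.mem 0 rfl, hσ.input, h2]
    exact seg_factors M

/-! ### The factor of the dummy variable -/

open Instr in
/-- Appending the content of register `r` to the encoding. -/
def pushProg (r : ℕ) : Prog := .block [store 50 50 r, add 50 50 48]

theorem runs_pushProg {σ : State} (hσ : Ready σ) {w : List ℕ} (hw : Holds w σ) {r v : ℕ}
    (hv : σ.reg r = v) : Runs (pushProg r) σ 2 (Holds (w ++ [v])) := by
  refine Runs.block (hw.push ?_ ?_) <;> simp [Instr.run, hσ.one, hv]

open Instr in
/-- The last part of the encoding of the expanded model: the factor of the dummy variable, which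
brings the encoding to the size `64 * s ^ 4`. -/
def lastProg : Prog :=
  pushProg 48 ;; .block [add 30 3 4] ;; pushProg 30 ;; pushProg 6 ;; .block [sub 8 6 48] ;;
  .loop 8 (pushProg 48 ;; pushProg 48 ;; .block [sub 8 8 48]) ;;
  sizeProg 50 50 ;;
  .block [add 30 6 6, add 30 30 30, add 30 30 30, add 30 30 30, add 30 30 30, add 30 30 30,
    sub 30 30 15, const 31 4, sub 30 30 31, const 33 1] ;;
  shiftProg 33 30 ;; pushProg 33 ;; pushProg 48

/-- The encoding of the factor of the dummy variable without its last entry. -/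
def lastEncode (X D : ℕ) : List ℕ := [1] ++ [X] ++ [D] ++ (List.replicate (D - 1) [1, 1]).flatten

theorem replicate_succ_flatten (k : ℕ) :
    (List.replicate (k + 1) [1, 1]).flatten = (List.replicate k [1, 1]).flatten ++ [1] ++ [1] := by
  rw [List.replicate_succ']
  simp

/-- The program counts the bits `B` written so far and chooses the last entry to fill the rest. Six
doublings give `64 * D`; the `4` pays for the leading and the extra bit of `2 ^ j` and for the
denominator `1`, which takes two bits. -/
theorem runs_lastProg {M : Model} {σ : State} (hσ : Env M σ) {w : List ℕ} (hw : Holds w σ)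
    {B : ℕ}
    (hB : bits (w ++ lastEncode (M.dom.length + M.factors.length) (M.size ^ 4)) = B) :
    Runs lastProg σ (6 * M.size ^ 4 + 6 * B + 3 * (64 * M.size ^ 4 - B - 4) + 28) fun τ =>
      Holds (w ++ lastEncode (M.dom.length + M.factors.length) (M.size ^ 4) ++
        [2 ^ (64 * M.size ^ 4 - B - 4)] ++ [1]) τ := by
  have hdummy := hσ.dummy
  generalize hD : M.size ^ 4 = D at *
  generalize hX : M.dom.length + M.factors.length = X at *
  refine ((runs_pushProg hσ.ready hw hσ.ready.one).seq
    (l := 6 * D + 6 * B + 3 * (64 * D - B - 4) + 26) ?_).le (by omega)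
  intro τ₁ hw₁ hf₁
  have e₁ := hf₁.env hσ rfl
  refine ((Runs.block (Q := fun τ => τ.reg 30 = X) ?_).seq
    (l := 6 * D + 6 * B + 3 * (64 * D - B - 4) + 25) ?_).le (by simp; omega)
  · simp [Instr.run, e₁.vars, e₁.facs, hX]
  intro τ₂ h30 hf₂
  have e₂ := hf₂.env e₁ rfl
  refine ((runs_pushProg e₂.ready (hw₁.congr (hf₂.mem 50 rfl) (hf₂.reg 50 rfl)) h30).seq
    (l := 6 * D + 6 * B + 3 * (64 * D - B - 4) + 23) ?_).le (by omega)
  intro τ₃ hw₃ hf₃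
  have e₃ := hf₃.env e₂ rfl
  refine ((runs_pushProg e₃.ready hw₃ (e₃.dummy.trans hD)).seq
    (l := 6 * D + 6 * B + 3 * (64 * D - B - 4) + 21) ?_).le (by omega)
  intro τ₄ hw₄ hf₄
  have e₄ := hf₄.env e₃ rfl
  refine ((Runs.block (Q := fun τ => τ.reg 8 = D - 1) ?_).seq
    (l := 6 * D + 6 * B + 3 * (64 * D - B - 4) + 20) ?_).le (by simp; omega)
  · simp [Instr.run, e₄.ready.one, e₄.dummy, hD]
  intro τ₅ h8 hf₅
  have e₅ := hf₅.env e₄ rfl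
  have hw₅ := hw₄.congr (hf₅.mem 50 rfl) (hf₅.reg 50 rfl)
  refine ((Runs.loop_up (c := 5) (fun k τ => Holds (w ++ [1] ++ [X] ++ [D] ++
    (List.replicate k [1, 1]).flatten) τ) h8 (by simpa using hw₅) ?_).seq
    (l := 6 * B + 3 * (64 * D - B - 4) + 19) ?_).le (by omega)
  · intro k τ hk hf hr hI
    have e := hf.env e₅ rfl
    refine (runs_pushProg e.ready hI e.ready.one).seq (l := 3) ?_
    intro τ' hI' hf'
    have e' := hf'.env e rfl
    refine (runs_pushProg e'.ready hI' e'.ready.one).seq (l := 1) ?_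
    intro τ'' hI'' hf''
    have e'' := hf''.env e' rfl
    refine Runs.block ⟨?_, ?_⟩
    · simp [Instr.run, e''.ready.one, hf''.reg 8 rfl, hf'.reg 8 rfl, hr]
    · rw [replicate_succ_flatten, ← List.append_assoc, ← List.append_assoc]
      exact hI''.congr rfl (by simp [Instr.run])
  intro τ₆ hw₆ hf₆
  have e₆ := hf₆.env e₅ rfl
  have hw₆' : Holds (w ++ lastEncode X D) τ₆ := by
    rw [lastEncode, ← List.append_assoc, ← List.append_assoc, ← List.append_assoc]
    exact hw₆
  refine ((runs_sizeProg e₆.ready hw₆'.len (by omega) hw₆'.mem).seq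
    (l := 3 * (64 * D - B - 4) + 15) ?_).le (by omega)
  intro τ₇ h15 hf₇
  rw [hB] at h15
  have e₇ := hf₇.env e₆ rfl
  have hw₇ := hw₆'.congr (hf₇.mem 50 rfl) (hf₇.reg 50 rfl)
  refine ((Runs.block (Q := fun τ => τ.reg 30 = 64 * D - B - 4 ∧ τ.reg 33 = 1) ?_).seq
    (l := 3 * (64 * D - B - 4) + 5) ?_).le (by simp; omega)
  · simp [Instr.run, e₇.dummy, hD, h15]
    omega
  rintro τ₈ ⟨h30₈, h33⟩ hf₈
  have e₈ := hf₈.env e₇ rfl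
  refine ((runs_shiftProg (d := 33) (c := 30) (by norm_num) (by norm_num) e₈.ready.one h30₈).seq
    (l := 4) ?_).le (by omega)
  intro τ₉ h33₉ hf₉
  rw [h33, one_mul] at h33₉
  have e₉ := hf₉.env e₈ rfl
  refine (runs_pushProg e₉.ready (hw₇.congr ((hf₉.mem 50 rfl).trans (hf₈.mem 50 rfl))
    ((hf₉.reg 50 rfl).trans (hf₈.reg 50 rfl))) h33₉).seq (l := 2) ?_
  intro τ₁₀ hw₁₀ hf₁₀
  have e₁₀ := hf₁₀.env e₉ rfl
  exact runs_pushProg e₁₀.ready hw₁₀ e₁₀.ready.one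

end ArithCirc

namespace ArithCirc

/-! ### Size and running-time bounds -/

theorem size_le_self (n : ℕ) : n.size ≤ n := Nat.size_le.2 Nat.lt_two_pow_self

namespace Factor

theorem length_le_bits_encode (f : Factor) :
    f.scope.length + 2 * f.table.length + 2 ≤ bits f.encode := by
  refine le_trans (le_of_eq ?_) (length_le_bits f.encode)
  simp [encode]
  omega

theorem bits_scope_le (f : Factor) : bits f.scope ≤ bits f.encode := by
  simp only [encode, List.cons_append, bits_cons, bits_append]
  omega

end Factor

namespace Model

variable {M : Model}

theorem sum_bits_factors_le (M : Model) : (M.factors.map fun f => bits f.encode).sum ≤ M.size := by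
  rw [← bits_flatMap]
  exact M.bits_factors_le

theorem bits_factor_le {f : Factor} (hf : f ∈ M.factors) : bits f.encode ≤ M.size :=
  (List.single_le_sum (l := M.factors.map fun f => bits f.encode) (by simp) _
    (List.mem_map_of_mem hf)).trans M.sum_bits_factors_le

theorem length_dom_le (M : Model) : M.dom.length ≤ M.size := by
  refine le_trans ?_ (length_le_bits M.encode)
  simp [encode]
  omega

theorem bits_dom_le (M : Model) : bits M.dom ≤ M.size := by
  simp only [size_eq, encode, List.cons_append, bits_cons, bits_append]
  omega

/-- Some factor contains `X`, its table has at least one row for each value of `X`, and every row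
takes space. So loops over the values of a variable are affordable although domains are encoded in
binary. -/
theorem card_le_size (hM : M.WF) {X : ℕ} (hX : X < M.dom.length) : M.card X ≤ M.size := by
  obtain ⟨f, hf, hXf⟩ := hM.covered X hX
  have h1 : M.card X ≤ (f.scope.map M.card).prod := by
    refine List.single_le_prod ?_ _ (List.mem_map_of_mem hXf)
    intro a ha
    obtain ⟨Y, hY, rfl⟩ := List.mem_map.1 ha
    exact card_pos_of_lt hM (hM.scope_lt f hf Y hY)
  rw [← hM.table_length f hf] at h1
  have h2 := f.length_le_bits_encode
  have h3 := bits_factor_le hf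
  omega

theorem size_le_dummy (M : Model) : M.size ≤ M.size ^ 4 := Nat.le_self_pow (by norm_num) _

theorem dummy_pos (M : Model) : 0 < M.size ^ 4 :=
  pow_pos (by have := M.two_le_size; omega) 4

theorem sum_factors_le (M : Model) {g : Factor → ℕ} {c d : ℕ}
    (h : ∀ f ∈ M.factors, g f ≤ c * bits f.encode + d) :
    (M.factors.map g).sum ≤ c * M.size + d * M.size := by
  have h1 : (M.factors.map g).sum ≤ (M.factors.map fun f => c * bits f.encode + d).sum :=
    List.sum_le_sum h
  rw [List.sum_map_add, List.sum_map_mul_left] at h1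
  have h2 := Nat.mul_le_mul_left c M.sum_bits_factors_le
  have h3 : (M.factors.map fun _ => d).sum ≤ d * M.size := by
    simp only [List.map_const', List.sum_replicate, smul_eq_mul]
    rw [mul_comm]
    exact Nat.mul_le_mul_left d M.length_factors_le
  omega

theorem expand_card_le (hM : M.WF) {X : ℕ} (hX : X < M.dom.length + M.factors.length) (j : ℕ) :
    (M.expand (M.size ^ 4) j).card X ≤ M.size ^ 4 := by
  refine le_trans ?_ M.size_le_dummy
  rcases lt_or_ge X M.dom.length with h | h
  · rw [expand_card_left h]
    exact card_le_size hM h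
  · obtain ⟨i, rfl⟩ := Nat.exists_eq_add_of_le h
    have hi : i < M.factors.length := by omega
    rw [expand_card_row hi]
    have h1 := M.factors[i].length_le_bits_encode
    have h2 := bits_factor_le (List.getElem_mem hi)
    omega

end Model

theorem bits_diagEncode_le (L K : ℕ) : bits (diagEncode L K) ≤ 4 * K := by
  induction K with
  | zero => simp [diagEncode]
  | succ K ih =>
    rw [diagEncode_succ]
    have h1 : (1 : ℕ).size = 1 := Nat.size_one
    have h2 : (if (L + 1) ∣ K then 1 else 0 : ℕ).size ≤ 1 := by split_ifs <;> simp
    simp only [bits_append, bits_cons, bits_nil, h1]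
    omega

/-- An identity matrix squares the table length; one of the two lengths is bounded by `s`, which
leaves a bound linear in `bits f.encode` that can be summed over the factors. -/
theorem bits_expandFactors_le (fs : List Factor) {b c s : ℕ} (hb : b + fs.length ≤ c)
    (hs : ∀ f ∈ fs, f.table.length ≤ s) :
    bits ((expandFactors b fs).flatMap Factor.encode) ≤
      (fs.map fun f => (2 + 5 * s) * bits f.encode + (c + 4)).sum := by
  induction fs generalizing b with
  | nil => simp [expandFactors]
  | cons f fs ih =>
    simp only [expandFactors, List.flatMap_cons, bits_append, List.map_cons, List.sum_cons]
    refine add_le_add ?_ (ih (by simp at hb; omega) fun f hf => hs f (by simp [hf]))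
    rw [encode_expand_factor]
    simp only [bits_append, bits_cons, bits_nil]
    have h1 := size_le_self (f.scope.length + 1)
    have h2 := size_le_self b
    have h3 := size_le_self (f.table.length * f.table.length)
    have h4 := bits_diagEncode_le f.table.length (f.table.length * f.table.length)
    have h5 := f.length_le_bits_encode
    have h6 := f.bits_scope_le
    have h7 : f.table.length * f.table.length ≤ s * bits f.encode :=
      Nat.mul_le_mul (hs f (by simp)) (by omega)
    have h8 : (2 + 5 * s) * bits f.encode = 2 * bits f.encode + 5 * (s * bits f.encode) := by ring
    simp only [List.length_cons] at hb
    omega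

/-- The encoding of the expanded model up to the factor of the dummy variable. -/
def Model.expandPrefix (M : Model) : List ℕ :=
  ((M.dom.length + M.factors.length + 1) :: M.dom) ++ (M.factors.map fun f => f.table.length) ++
    [M.size ^ 4] ++ [M.factors.length + 1] ++
    (expandFactors M.dom.length M.factors).flatMap Factor.encode

/-- The size of the encoding of the expanded model without the last entry. -/
def Model.expandBits (M : Model) : ℕ :=
  bits (M.expandPrefix ++ lastEncode (M.dom.length + M.factors.length) (M.size ^ 4))

/-- The exponent of the last entry of the expanded model. -/
def Model.padding (M : Model) : ℕ := 64 * M.size ^ 4 - M.expandBits - 4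

/-- The model that is compiled. -/
def Model.target (M : Model) : Model := M.expand (M.size ^ 4) M.padding

theorem flatMap_replicate_one (k : ℕ) :
    (List.replicate k (1 : ℚ≥0)).flatMap (fun q => [q.num, q.den]) =
      (List.replicate k [1, 1]).flatten := by
  induction k with
  | zero => rfl
  | succ k ih => simp [List.replicate_succ, ih]

theorem Model.target_encode (M : Model) : M.target.encode =
    M.expandPrefix ++ lastEncode (M.dom.length + M.factors.length) (M.size ^ 4) ++
      [2 ^ M.padding] ++ [1] := by
  have hpos := M.dummy_pos
  have hlast : (⟨[M.dom.length + M.factors.length],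
      List.replicate (M.size ^ 4 - 1) 1 ++ [((2 ^ M.padding : ℕ) : ℚ≥0)]⟩ : Factor).encode =
        lastEncode (M.dom.length + M.factors.length) (M.size ^ 4) ++ [2 ^ M.padding] ++ [1] := by
    simp only [Factor.encode, List.flatMap_append, flatMap_replicate_one, lastEncode]
    simp only [List.flatMap_singleton, NNRat.num_natCast, NNRat.den_natCast]
    simp
    omega
  simp only [Model.encode, target, expand_dom_length]
  simp only [expand, List.flatMap_append, List.flatMap_singleton, hlast, expandPrefix,
    List.length_append, length_expandFactors, List.length_singleton]
  simp

theorem bits_replicate_flatten (k : ℕ) : bits (List.replicate k [1, 1]).flatten = 4 * k := by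
  induction k with
  | zero => rfl
  | succ k ih => simp [List.replicate_succ, ih, Nat.size_one]; omega

theorem power_bounds {s : ℕ} (hs : 2 ≤ s) :
    2 * s ≤ s * s ∧ 2 * (s * s) ≤ s * s * s ∧ 2 * (s * s * s) ≤ s ^ 4 := by
  refine ⟨Nat.mul_le_mul_right s hs, ?_, ?_⟩
  · rw [mul_comm (s * s) s]
    exact Nat.mul_le_mul_right _ hs
  · rw [show s ^ 4 = s * (s * s * s) by ring]
    exact Nat.mul_le_mul_right _ hs

/-- The table of the dummy variable takes about `4 * s ^ 4` bits, and the expanded factors a number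
quadratic in `s`. The constant `64` is generous. -/
theorem Model.expandBits_le (M : Model) : M.expandBits + 4 ≤ 64 * M.size ^ 4 := by
  have hs := M.two_le_size
  obtain ⟨p1, p2, p3⟩ := power_bounds hs
  have hm := M.length_dom_le
  have hn := M.length_factors_le
  have hdom := M.bits_dom_le
  have hlens : bits (M.factors.map fun f => f.table.length) ≤ 1 * M.size + 0 * M.size := by
    rw [bits, List.map_map]
    refine M.sum_factors_le fun f _ => ?_
    have h1 := size_le_self f.table.length
    have h2 := f.length_le_bits_encode
    simp only [Function.comp_apply]
    omega
  have hfs : bits ((expandFactors M.dom.length M.factors).flatMap Factor.encode) ≤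
      (2 + 5 * M.size) * M.size + (2 * M.size + 4) * M.size := by
    refine (bits_expandFactors_le M.factors (c := 2 * M.size) (s := M.size) (by omega) ?_).trans
      (M.sum_factors_le fun f _ => le_rfl)
    intro f hf
    have h1 := f.length_le_bits_encode
    have h2 := Model.bits_factor_le hf
    omega
  have hfs' : (2 + 5 * M.size) * M.size + (2 * M.size + 4) * M.size =
      7 * (M.size * M.size) + 6 * M.size := by ring
  have a1 := size_le_self (M.dom.length + M.factors.length + 1)
  have a2 := size_le_self (M.size ^ 4)
  have a3 := size_le_self (M.factors.length + 1)
  have a4 := size_le_self (M.dom.length + M.factors.length)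
  simp only [expandBits, expandPrefix, lastEncode, bits_append, bits_cons, bits_nil,
    bits_replicate_flatten, Nat.size_one]
  omega

/-- Equality is the point: with no monotonicity available, a mere upper bound on the size would say
nothing about the compiler's running time. -/
theorem Model.target_size (M : Model) : M.target.size = 64 * M.size ^ 4 := by
  have h := M.expandBits_le
  rw [size_eq, target_encode, bits_append, bits_append]
  change M.expandBits + _ + _ = _
  simp only [bits_cons, bits_nil, Nat.size_pow, Nat.size_one, padding]
  omega

theorem Model.target_wf {M : Model} (hM : M.WF) : M.target.WF := expand_wf hM M.dummy_pos

/-! ### The preprocessing program -/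

open Instr in
/-- Computing the long-lived data. -/
def setupProg : Prog :=
  .block [const 48 1] ;; sizeProg 0 0 ;;
  .block [add 5 15 47, add 25 5 5, add 25 25 25, add 24 25 25, const 22 1, add 30 24 48] ;;
  shiftProg 22 30 ;; .block [sub 22 22 48, const 27 1, add 30 24 25] ;; shiftProg 27 30 ;;
  .block [add 10 5 47, add 11 5 47] ;; mulProg ;; .block [add 10 12 47, add 11 12 47] ;;
  mulProg ;; .block [add 6 12 47, const 30 0, load 3 0 30, add 30 3 48, load 4 0 30]

theorem runs_setupProg (M : Model) :
    Runs setupProg (State.init M.encode) (90 * M.size + 40) fun τ => Env M τ ∧ Holds [] τ := by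
  set σ := State.init M.encode with hσ
  -- The frame is carried along because it shows that array `50` and register `50` are still zero,
  -- that is, hold the empty sequence.
  refine Runs.mono (Q := fun τ => Env M τ ∧ Frame setupProg σ τ) (k := 90 * M.size + 40) ?_ le_rfl
    fun τ h => ⟨h.1, ⟨by rw [h.2.mem 50 rfl]; funext i; simp [hσ, State.init],
      by rw [h.2.reg 50 rfl]; simp [hσ, State.init]⟩⟩
  refine Runs.frame ?_
  generalize hS : M.size = s
  refine ((Runs.block (Q := fun τ => τ.reg 48 = 1) ?_).seq (l := 90 * s + 39) ?_).le
    (by simp; omega)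
  · simp [Instr.run]
  intro τ₁ h48 hf₁
  have r₁ : Ready τ₁ := ⟨by rw [hf₁.reg 47 rfl]; simp [hσ, State.init], h48⟩
  refine ((runs_sizeProg r₁ (w := M.encode) ?_ (by omega) ?_).seq (l := 84 * s + 35) ?_).le
    (by rw [← M.size_eq, hS]; omega)
  · rw [hf₁.reg 0 rfl]
    simp [hσ, State.init]
  · rw [hf₁.mem 0 rfl]
    funext i
    simp [hσ, State.init]
  intro τ₂ h15 hf₂
  rw [← M.size_eq, hS] at h15
  have r₂ := hf₂.ready r₁ rfl rfl
  refine ((Runs.block (Q := fun τ => τ.reg 5 = s ∧ τ.reg 25 = 4 * s ∧ τ.reg 24 = 8 * s ∧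
    τ.reg 22 = 1 ∧ τ.reg 30 = 8 * s + 1) ?_).seq (l := 84 * s + 29) ?_).le (by simp; omega)
  · simp [Instr.run, h15, r₂.zero, r₂.one]
    omega
  rintro τ₃ ⟨h5, h25, h24, h22, h30⟩ hf₃
  have r₃ := hf₃.ready r₂ rfl rfl
  refine ((runs_shiftProg (d := 22) (c := 30) (by norm_num) (by norm_num) r₃.one h30).seq
    (l := 60 * s + 25) ?_).le (by omega)
  intro τ₄ h22₄ hf₄
  rw [h22, one_mul] at h22₄
  have r₄ := hf₄.ready r₃ rfl rfl
  refine ((Runs.block (Q := fun τ => τ.reg 22 = 2 ^ (8 * s + 1) - 1 ∧ τ.reg 27 = 1 ∧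
    τ.reg 30 = 12 * s) ?_).seq (l := 60 * s + 22) ?_).le (by simp; omega)
  · simp [Instr.run, h22₄, r₄.one, hf₄.reg 24 rfl, hf₄.reg 25 rfl, h24, h25]
    omega
  rintro τ₅ ⟨h22₅, h27, h30₅⟩ hf₅
  have r₅ := hf₅.ready r₄ rfl rfl
  refine ((runs_shiftProg (d := 27) (c := 30) (by norm_num) (by norm_num) r₅.one h30₅).seq
    (l := 24 * s + 21) ?_).le (by omega)
  intro τ₆ h27₆ hf₆
  rw [h27, one_mul] at h27₆
  have r₆ := hf₆.ready r₅ rfl rfl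
  have h5₆ : τ₆.reg 5 = s := by rw [hf₆.reg 5 rfl, hf₅.reg 5 rfl, hf₄.reg 5 rfl, h5]
  refine ((Runs.block (Q := fun τ => τ.reg 10 = s ∧ τ.reg 11 = s) ?_).seq
    (l := 24 * s + 19) ?_).le (by simp; omega)
  · simp [Instr.run, h5₆, r₆.zero]
  rintro τ₇ ⟨h10, h11⟩ hf₇
  have r₇ := hf₇.ready r₆ rfl rfl
  refine ((runs_mulProg r₇ (k := s) (by rw [h11]; exact size_le_self s)).seq
    (l := 16 * s + 17) ?_).le (by omega)
  intro τ₈ h12 hf₈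
  rw [h10, h11] at h12
  have r₈ := hf₈.ready r₇ rfl rfl
  refine ((Runs.block (Q := fun τ => τ.reg 10 = s * s ∧ τ.reg 11 = s * s) ?_).seq
    (l := 16 * s + 15) ?_).le (by simp; omega)
  · simp [Instr.run, h12, r₈.zero]
  rintro τ₉ ⟨h10₉, h11₉⟩ hf₉
  have r₉ := hf₉.ready r₈ rfl rfl
  refine ((runs_mulProg r₉ (k := 2 * s) ?_).seq (l := 5) ?_).le (by omega)
  · rw [h11₉]
    refine Nat.size_le.2 ?_
    rw [two_mul, pow_add]
    exact Nat.mul_self_lt_mul_self Nat.lt_two_pow_self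
  intro τ₁₀ h12₁₀ hf₁₀
  rw [h10₉, h11₉] at h12₁₀
  have r₁₀ := hf₁₀.ready r₉ rfl rfl
  have hin : τ₁₀.mem 0 = fun i => M.encode.getD i 0 := by
    rw [hf₁₀.mem 0 rfl, hf₉.mem 0 rfl, hf₈.mem 0 rfl, hf₇.mem 0 rfl, hf₆.mem 0 rfl, hf₅.mem 0 rfl,
      hf₄.mem 0 rfl, hf₃.mem 0 rfl, hf₂.mem 0 rfl, hf₁.mem 0 rfl]
    funext i
    simp [hσ, State.init]
  have hin0 : τ₁₀.mem 0 0 = M.dom.length := by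
    rw [hin]
    simp [Model.encode]
  have hin1 : τ₁₀.mem 0 (M.dom.length + 1) = M.factors.length := by
    rw [hin]
    simp [Model.encode]
  refine (Runs.block (Q := fun τ => τ.reg 6 = s ^ 4 ∧ τ.reg 3 = M.dom.length ∧
    τ.reg 4 = M.factors.length) ?_).frame.mono (by simp) ?_
  · simp [Instr.run, h12₁₀, r₁₀.zero, r₁₀.one, hin0, hin1]
    ring
  rintro τ ⟨⟨h6, h3, h4⟩, hf⟩
  constructor
  · exact hf.ready r₁₀ rfl rfl
  · exact h3
  · exact h4
  · rw [hf.reg 5 rfl, hf₁₀.reg 5 rfl, hf₉.reg 5 rfl, hf₈.reg 5 rfl, hf₇.reg 5 rfl, h5₆, hS]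
  · rw [h6, hS]
  · rw [hf.reg 22 rfl, hf₁₀.reg 22 rfl, hf₉.reg 22 rfl, hf₈.reg 22 rfl, hf₇.reg 22 rfl,
      hf₆.reg 22 rfl, h22₅, hS]
  · rw [hf.reg 24 rfl, hf₁₀.reg 24 rfl, hf₉.reg 24 rfl, hf₈.reg 24 rfl, hf₇.reg 24 rfl,
      hf₆.reg 24 rfl, hf₅.reg 24 rfl, hf₄.reg 24 rfl, h24, hS]
  · rw [hf.reg 25 rfl, hf₁₀.reg 25 rfl, hf₉.reg 25 rfl, hf₈.reg 25 rfl, hf₇.reg 25 rfl,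
      hf₆.reg 25 rfl, hf₅.reg 25 rfl, hf₄.reg 25 rfl, h25, hS]
  · rw [hf.reg 27 rfl, hf₁₀.reg 27 rfl, hf₉.reg 27 rfl, hf₈.reg 27 rfl, hf₇.reg 27 rfl, h27₆, hS]
  · rw [hf.mem 0 rfl, hin]

/-- The preprocessing: writing the encoding of the compiled model and the table of weights. -/
def preProg : Prog :=
  setupProg ;; domProg ;; rowsProg ;; dummyProg ;; factorsProg ;; lastProg

/-- There are at most `s` table rows in all, and each weight costs `O(s ^ 2)`; writing the identity
matrices costs `O(s ^ 2)` altogether; the dummy variable with the padding costs `O(s ^ 4)` and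
dominates. -/
theorem runs_preProg {M : Model} (hM : M.WF) :
    Runs preProg (State.init M.encode) (2000 * M.size ^ 4) fun τ => Env M τ ∧
      Holds M.target.encode τ ∧
      Tabulated (M.size ^ 4) M.target.card M.weight (M.dom.length + M.factors.length + 1) τ := by
  have hs := M.two_le_size
  obtain ⟨p1, p2, p3⟩ := power_bounds hs
  have hm := M.length_dom_le
  set k1 := M.dom.length * (8 * M.size + 14) + 10 with hk1
  set k2 := (M.factors.map fun f => f.table.length * (rowCost M.size + 8) + 14).sum + 4 with hk2
  set k4 := (M.factors.map fun f => expandCost f + 1).sum + 5 with hk4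
  set k5 := 6 * M.size ^ 4 + 6 * M.expandBits + 3 * (64 * M.size ^ 4 - M.expandBits - 4) + 28
    with hk5
  have c1 : k1 ≤ 8 * (M.size * M.size) + 14 * M.size + 10 := by
    have := Nat.mul_le_mul_right (8 * M.size + 14) hm
    have e : M.size * (8 * M.size + 14) = 8 * (M.size * M.size) + 14 * M.size := by ring
    omega
  have c2 : k2 ≤ 1200 * (M.size * M.size * M.size) + 22 * M.size + 4 := by
    have := M.sum_factors_le (g := fun f => f.table.length * (rowCost M.size + 8) + 14)
      (c := rowCost M.size + 8) (d := 14) fun f _ => by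
        have h1 := f.length_le_bits_encode
        have h2 := Nat.mul_le_mul_right (rowCost M.size + 8)
          (show f.table.length ≤ bits f.encode by omega)
        rw [mul_comm (rowCost M.size + 8)]
        omega
    have e : (rowCost M.size + 8) * M.size =
        1200 * (M.size * M.size * M.size) + 8 * M.size := by unfold rowCost; ring
    omega
  have c4 : k4 ≤ 8 * (M.size * M.size) + 45 * M.size + 5 := by
    have := M.sum_factors_le (g := fun f => expandCost f + 1)
      (c := 14 + 8 * M.size) (d := 31) fun f hf => by
        have h1 := f.length_le_bits_encode
        have h2 := Model.bits_factor_le hf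
        have h3 : f.table.length * f.table.length ≤ M.size * bits f.encode :=
          Nat.mul_le_mul (by omega) (by omega)
        have e : (14 + 8 * M.size) * bits f.encode =
          14 * bits f.encode + 8 * (M.size * bits f.encode) := by ring
        unfold expandCost
        omega
    have e : (14 + 8 * M.size) * M.size = 8 * (M.size * M.size) + 14 * M.size := by ring
    omega
  have c5 : k5 ≤ 6 * M.size ^ 4 + 6 * (64 * M.size ^ 4) + 28 := by
    have := M.expandBits_le
    omega
  have hcard := fun {X : ℕ} (hX : X < M.dom.length + M.factors.length) =>
    Model.expand_card_le hM hX M.padding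
  refine ((runs_setupProg M).seq (l := k1 + (k2 + ((4 * M.size ^ 4 + 9) + (k4 + k5)))) ?_).le
    (by omega)
  rintro τ₁ ⟨e₁, hw₁⟩ hf₁
  refine (runs_domProg e₁ hw₁ (card := M.target.card) (ω := M.weight)
    (fun X hX => Model.card_le_size hM hX) (fun X hX => Model.expand_card_left hX)
    (fun X hX x hx => by simp [Model.weight, hX])).seq ?_
  rintro τ₂ ⟨hw₂, hT₂, h28, h29, h9⟩ hf₂
  have e₂ := hf₂.env e₁ rfl
  refine (runs_rowsProg e₂ hw₂ h28 ?_ (fun Y hY => hcard hY)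
    (fun i h => Model.expand_card_row h) ?_ hT₂ h29 h9).seq ?_
  · intro f hf q hq
    exact (f.row_le_bits hq).trans (Model.bits_factor_le hf)
  · intro i h x
    simp [Model.weight, h]
  rintro τ₃ ⟨hw₃, hT₃, h29₃, h9₃⟩ hf₃
  have e₃ := hf₃.env e₂ rfl
  refine (runs_dummyProg e₃ hw₃ (fun Y hY => hcard hY) Model.expand_card_last ?_ hT₃ h29₃
    h9₃).seq ?_
  · intro x
    simp [Model.weight]
  rintro τ₄ ⟨hw₄, hT₄⟩ hf₄
  have e₄ := hf₄.env e₃ rfl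
  refine (runs_factorsProg e₄ hw₄).seq ?_
  intro τ₅ hw₅ hf₅
  have e₅ := hf₅.env e₄ rfl
  refine (runs_lastProg e₅ hw₅ (B := M.expandBits) rfl).frame.mono le_rfl ?_
  rintro τ₆ ⟨hw₆, hf₆⟩
  refine ⟨hf₆.env e₅ rfl, ?_, (hT₄.congr (hf₅.mem 3 rfl) (hf₅.mem 2 rfl)).congr
    (hf₆.mem 3 rfl) (hf₆.mem 2 rfl)⟩
  rw [M.target_encode]
  exact hw₆

end ArithCirc

namespace ArithCirc

/-! ## Running the compiler as a subroutine -/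

/-- The program with its registers and arrays renamed, and with its output collected in the array
`1`, the length of which is in register `40`. -/
def Prog.shift : Prog → Prog
  | basic (.const d n) => basic (.const (d + 50) n)
  | basic (.add d a b) => basic (.add (d + 50) (a + 50) (b + 50))
  | basic (.sub d a b) => basic (.sub (d + 50) (a + 50) (b + 50))
  | basic (.half d a) => basic (.half (d + 50) (a + 50))
  | basic (.load d A a) => basic (.load (d + 50) (A + 50) (a + 50))
  | basic (.store A a b) => basic (.store (A + 50) (a + 50) (b + 50))
  | basic (.emit a) => basic (.store 1 40 (a + 50)) ;; basic (.add 40 40 48)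
  | seq P Q => P.shift ;; Q.shift
  | cond r P Q => cond (r + 50) P.shift Q.shift
  | loop r P => loop (r + 50) P.shift

/-- `τ` represents the state `σ` of the subroutine; outside it agrees with `τ₀`. -/
structure Sim (τ₀ σ τ : State) : Prop where
  reg : ∀ r, τ.reg (r + 50) = σ.reg r
  mem : ∀ A, τ.mem (A + 50) = σ.mem A
  arr : τ.mem 1 = fun i => σ.out.getD i 0
  cnt : τ.reg 40 = σ.out.length
  low : ∀ r < 50, r ≠ 40 → τ.reg r = τ₀.reg r
  lowMem : ∀ A < 50, A ≠ 1 → τ.mem A = τ₀.mem A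
  out : τ.out = τ₀.out

theorem Sim.update_reg {τ₀ σ τ : State} (h : Sim τ₀ σ τ) (d v : ℕ) :
    Sim τ₀ { σ with reg := Function.update σ.reg d v }
      { τ with reg := Function.update τ.reg (d + 50) v } := by
  refine ⟨fun r => ?_, h.mem, h.arr, ?_, fun r hr hr' => ?_, h.lowMem, h.out⟩
  · simp [Function.update_apply, h.reg]
  · simpa [Function.update_apply] using h.cnt
  · rw [← h.low r hr hr']
    exact Function.update_of_ne (by omega) _ _

theorem Sim.update_mem {τ₀ σ τ : State} (h : Sim τ₀ σ τ) (A a v : ℕ) :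
    Sim τ₀ { σ with mem := Function.update σ.mem A (Function.update (σ.mem A) a v) }
      ⟨τ.reg, Function.update τ.mem (A + 50) (Function.update (τ.mem (A + 50)) a v),
        τ.out⟩ := by
  refine ⟨h.reg, fun B => ?_, ?_, h.cnt, h.low, fun B hB hB' => ?_, h.out⟩
  · simp [Function.update_apply, h.mem]
  · rw [← h.arr]
    simp
  · rw [← h.lowMem B hB hB']
    exact Function.update_of_ne (by omega) _ _

/-- Each step is copied by one step, except that an output becomes a store and an increment; hence
the factor `2`. `Sim` also fixes the outer memory, so the weight table survives the call. -/
theorem exec_shift {P : Prog} {σ σ' : State} {k : ℕ} (hP : Exec P σ σ' k) {τ₀ τ : State}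
    (h0 : τ₀.reg 48 = 1) (h : Sim τ₀ σ τ) :
    ∃ τ' k', Exec P.shift τ τ' k' ∧ k' ≤ 2 * k ∧ Sim τ₀ σ' τ' := by
  induction hP generalizing τ with
  | basic i σ =>
    cases i with
    | const d n => exact ⟨_, 1, .basic _ τ, by omega, h.update_reg d n⟩
    | add d a b =>
      refine ⟨_, 1, .basic _ τ, by omega, ?_⟩
      simp only [Instr.run, h.reg]
      exact h.update_reg d _
    | sub d a b =>
      refine ⟨_, 1, .basic _ τ, by omega, ?_⟩
      simp only [Instr.run, h.reg]
      exact h.update_reg d _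
    | half d a =>
      refine ⟨_, 1, .basic _ τ, by omega, ?_⟩
      simp only [Instr.run, h.reg]
      exact h.update_reg d _
    | load d A a =>
      refine ⟨_, 1, .basic _ τ, by omega, ?_⟩
      simp only [Instr.run, h.reg, h.mem]
      exact h.update_reg d _
    | store A a b =>
      refine ⟨_, 1, .basic _ τ, by omega, ?_⟩
      simp only [Instr.run, h.reg]
      exact h.update_mem A _ _
    | emit a =>
      refine ⟨_, 1 + 1, .seq (.basic _ _) (.basic _ _), by omega, ?_⟩
      have h48 : τ.reg 48 = 1 := (h.low 48 (by norm_num) (by norm_num)).trans h0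
      simp only [Instr.run]
      refine ⟨fun r => ?_, fun A => ?_, ?_, ?_, fun r hr hr' => ?_, fun A hA hA' => ?_, h.out⟩
      · rw [← h.reg r]
        simp
      · rw [← h.mem A]
        simp
      · simp only [Function.update_self]
        rw [h.arr, h.cnt, h.reg, update_getD]
      · simp [h.cnt, h48]
      · rw [← h.low r hr hr']
        exact Function.update_of_ne hr' _ _
      · rw [← h.lowMem A hA hA']
        exact Function.update_of_ne hA' _ _
  | seq _ _ ih ih' =>
    obtain ⟨τ₁, k₁, he₁, hk₁, h₁⟩ := ih h
    obtain ⟨τ₂, k₂, he₂, hk₂, h₂⟩ := ih' h₁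
    exact ⟨τ₂, k₁ + k₂, .seq he₁ he₂, by omega, h₂⟩
  | cond_true hr _ ih =>
    obtain ⟨τ₁, k₁, he₁, hk₁, h₁⟩ := ih h
    exact ⟨τ₁, k₁ + 1, .cond_true (by rwa [h.reg]) he₁, by omega, h₁⟩
  | cond_false hr _ ih =>
    obtain ⟨τ₁, k₁, he₁, hk₁, h₁⟩ := ih h
    exact ⟨τ₁, k₁ + 1, .cond_false (by rwa [h.reg]) he₁, by omega, h₁⟩
  | loop_done hr => exact ⟨τ, 1, .loop_done (by rwa [h.reg]), by omega, h⟩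
  | loop_step hr _ _ ih ih' =>
    obtain ⟨τ₁, k₁, he₁, hk₁, h₁⟩ := ih h
    obtain ⟨τ₂, k₂, he₂, hk₂, h₂⟩ := ih' h₁
    exact ⟨τ₂, k₁ + k₂ + 1, .loop_step (by rwa [h.reg]) he₁ he₂, by omega, h₂⟩

/-- A step writes at most one number, so the length of the output is a lower bound for the
compiler's time. -/
theorem Exec.out_length_le {P : Prog} {σ σ' : State} {k : ℕ} (h : Exec P σ σ' k) :
    σ'.out.length ≤ σ.out.length + k := by
  induction h with
  | basic i σ => cases i <;> simp [Instr.run]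
  | seq _ _ ih ih' => omega
  | cond_true _ _ ih => omega
  | cond_false _ _ ih => omega
  | loop_done _ => omega
  | loop_step _ _ _ ih ih' => omega

/-- Whether all registers and arrays that are written are named by numbers up to `50`. -/
def Instr.bounded : Instr → Bool
  | const d _ => d ≤ 50
  | add d _ _ => d ≤ 50
  | sub d _ _ => d ≤ 50
  | half d _ => d ≤ 50
  | load d _ _ => d ≤ 50
  | store A _ _ => A ≤ 50
  | emit _ => true

/-- Whether all registers and arrays that are written are named by numbers up to `50`. -/
def Prog.bounded : Prog → Bool
  | basic i => i.bounded
  | seq P Q => P.bounded && Q.bounded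
  | cond _ P Q => P.bounded && Q.bounded
  | loop _ P => P.bounded

/-- One finite check covers the infinitely many registers and arrays above `50`. -/
theorem Prog.bounded_spec {P : Prog} (h : P.bounded = true) {r : ℕ} (hr : 50 < r) :
    P.writes r = false ∧ P.stores r = false := by
  induction P with
  | basic i =>
    cases i <;> simp [Prog.bounded, Instr.bounded] at h <;>
      simp [Prog.writes, Instr.writes, Prog.stores, Instr.stores] <;> omega
  | seq P Q ihP ihQ | cond _ P Q ihP ihQ =>
    simp only [Prog.bounded, Bool.and_eq_true] at h
    simp [Prog.writes, Prog.stores, ihP h.1, ihQ h.2]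
  | loop _ P ih => exact ih h

/-- Array `50` and register `50` are the images of array `0` and register `0` under `Prog.shift`,
and everything above is untouched, hence `0`. The preprocessing thus leaves a correct initial state
for the compiler. -/
theorem sim_init {M : Model} {τ : State} (hf : Frame preProg (State.init M.encode) τ)
    {w : List ℕ} (hw : Holds w τ) : Sim τ (State.init w) τ := by
  refine ⟨fun r => ?_, fun A => ?_, ?_, ?_, fun _ _ _ => rfl, fun _ _ _ => rfl, rfl⟩
  · rcases Nat.eq_zero_or_pos r with rfl | hr
    · exact hw.len
    · rw [hf.reg _ (Prog.bounded_spec (P := preProg) rfl (by omega)).1]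
      simp [State.init, hr.ne']
  · rcases Nat.eq_zero_or_pos A with rfl | hA
    · exact hw.mem
    · rw [hf.mem _ (Prog.bounded_spec (P := preProg) rfl (by omega)).2]
      simp [State.init, hA.ne']
  · rw [hf.mem 1 rfl]
    simp [State.init]
  · rw [hf.reg 40 rfl]
    simp [State.init]

/-! ## Evaluation of the circuit -/

open Instr in
/-- The maximum of the codes of the children of a node. -/
def maxLoop : Prog :=
  .loop 33 (.block [load 34 1 2, add 2 2 48, load 35 4 34, sub 36 35 32, add 32 32 36,
    sub 33 33 48])

/-- With truncated subtraction `max a b = a + (b - a)`, so no test is needed. -/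
theorem runs_maxLoop (cs : List ℕ) {σ : State} (hσ : Ready σ) {vs : List ℕ}
    (hv : σ.mem 4 = fun i => vs.getD i 0) (h33 : σ.reg 33 = cs.length)
    (hseg : Seg (σ.mem 1) (σ.reg 2) cs) :
    Runs maxLoop σ (7 * cs.length + 1) fun τ =>
      τ.reg 32 = (cs.map fun c => vs.getD c 0).foldl max (σ.reg 32) ∧
      τ.reg 2 = σ.reg 2 + cs.length := by
  induction cs generalizing σ with
  | nil => exact Runs.loop_done (by simpa using h33) (by simp)
  | cons c cs ih =>
    rw [seg_cons] at hseg
    refine (Runs.loop_step (by simp [h33]) (Runs.block (Q := fun τ =>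
      τ.reg 32 = max (σ.reg 32) (vs.getD c 0) ∧ τ.reg 2 = σ.reg 2 + 1 ∧
      τ.reg 33 = cs.length) ?_) (l := 7 * cs.length + 1) ?_).le (by simp; omega)
    · simp only [List.foldl_cons, List.foldl_nil, Instr.run]
      refine ⟨?_, ?_, ?_⟩
      · simp only [Function.update_apply, hseg.1, hv]
        norm_num
        omega
      · simp [hσ.one]
      · simp [hσ.one, h33]
    · rintro τ ⟨i1, i2, i3⟩ hf
      refine (ih (hf.ready hσ rfl rfl) ((hf.mem 4 rfl).trans hv) i3 ?_).mono le_rfl ?_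
      · rw [hf.mem 1 rfl, i2]
        exact hseg.2
      · rintro υ ⟨j1, j2⟩
        rw [j1, j2, i1, i2]
        exact ⟨by simp, by simp; omega⟩

open Instr in
/-- The product of the codes of the children of a node. -/
def mulLoop : Prog :=
  .loop 33 (.block [load 34 1 2, add 2 2 48, load 35 4 34] ;;
    .cond 32 (.cond 35 (.block [add 32 32 35, sub 32 32 48]) (.block [const 32 0, const 36 0]))
      (.block [const 32 0]) ;;
    .block [sub 33 33 48])

theorem runs_mulLoop (cs : List ℕ) {σ : State} (hσ : Ready σ) {vs : List ℕ}
    (hv : σ.mem 4 = fun i => vs.getD i 0) (h33 : σ.reg 33 = cs.length)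
    (hseg : Seg (σ.mem 1) (σ.reg 2) cs) :
    Runs mulLoop σ (9 * cs.length + 1) fun τ =>
      τ.reg 32 = (cs.map fun c => vs.getD c 0).foldl codeMul (σ.reg 32) ∧
      τ.reg 2 = σ.reg 2 + cs.length := by
  induction cs generalizing σ with
  | nil => exact Runs.loop_done (by simpa using h33) (by simp)
  | cons c cs ih =>
    rw [seg_cons] at hseg
    refine (Runs.loop_step (by simp [h33]) (k := 8) (Q' := fun τ =>
      τ.reg 32 = codeMul (σ.reg 32) (vs.getD c 0) ∧ τ.reg 2 = σ.reg 2 + 1 ∧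
      τ.reg 33 = cs.length) ?_ (l := 9 * cs.length + 1) ?_).le (by simp; omega)
    · refine (Runs.block (Q := fun τ => τ.reg 35 = vs.getD c 0 ∧ τ.reg 2 = σ.reg 2 + 1) ?_).seq
        (l := 5) ?_
      · simp [Instr.run, hseg.1, hv, hσ.one]
      rintro τ₁ ⟨h35, h2⟩ hf₁
      have r₁ := hf₁.ready hσ rfl rfl
      have h32 : τ₁.reg 32 = σ.reg 32 := hf₁.reg 32 rfl
      refine (Runs.cond (k := 3) (Q := fun τ => τ.reg 32 = codeMul (σ.reg 32) (vs.getD c 0))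
        ?_ ?_).seq (l := 1) ?_
      · intro h0
        refine Runs.cond (k := 2) ?_ ?_
        · intro h1
          refine Runs.block ?_
          rw [h32] at h0
          rw [h35] at h1
          rw [codeMul, if_neg h0, if_neg h1]
          simp [Instr.run, h32, h35, r₁.one]
        · intro h1
          refine Runs.block ?_
          rw [h35] at h1
          rw [codeMul, h1]
          simp [Instr.run]
      · intro h0
        refine (Runs.block ?_).le (by simp)
        rw [h32] at h0
        rw [codeMul, if_pos h0]
        simp [Instr.run]
      · intro τ₂ h32₂ hf₂
        have r₂ := hf₂.ready r₁ rfl rfl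
        refine Runs.block ?_
        simp [Instr.run, h32₂, hf₂.reg 2 rfl, h2, hf₂.reg 33 rfl, hf₁.reg 33 rfl, h33, r₂.one]
    · rintro τ ⟨i1, i2, i3⟩ hf
      refine (ih (hf.ready hσ rfl rfl) ((hf.mem 4 rfl).trans hv) i3 ?_).mono le_rfl ?_
      · rw [hf.mem 1 rfl, i2]
        exact hseg.2
      · rintro υ ⟨j1, j2⟩
        rw [j1, j2, i1, i2]
        exact ⟨by simp, by simp; omega⟩

open Instr in
/-- Register `32` becomes the code of the value of the node at the position in register `2`. -/
def nodeProg : Prog :=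
  .block [load 30 1 2, add 2 2 48, load 33 1 2, add 2 2 48] ;;
  .cond 30
    (.block [sub 30 30 48] ;;
      .cond 30
        (.block [sub 30 30 48] ;;
          .cond 30 (.block [const 32 1] ;; mulLoop) (.block [const 32 0] ;; maxLoop))
        (.block [add 2 2 48] ;; .cond 33 (.block [const 32 1]) (.block [const 32 0])))
    (.block [load 34 1 2, add 2 2 48, load 35 3 33, add 35 35 34, load 32 2 35])

/-- The tag of a node is recognized by successive decrements. Reading an indicator is a table
lookup; a parameter matters only through its numerator being zero or not. -/
theorem runs_nodeProg {nd : Node} {σ : State} (hσ : Ready σ) {vs : List ℕ}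
    (hv : σ.mem 4 = fun i => vs.getD i 0) {D K : ℕ} {card : ℕ → ℕ} {ω : ℕ → ℕ → ℕ}
    (hT : Tabulated D card ω K σ) (hind : ∀ X x, nd = .ind X x → X < K ∧ x < card X)
    (hseg : Seg (σ.mem 1) (σ.reg 2) nd.encode) :
    Runs nodeProg σ (9 * nd.encode.length) fun τ => τ.reg 32 = nd.codeValue ω vs ∧
      τ.reg 2 = σ.reg 2 + nd.encode.length := by
  have hstart : ∀ t a l, nd.encode = t :: a :: l → Runs (.block [.load 30 1 2, .add 2 2 48,
      .load 33 1 2, .add 2 2 48]) σ 4 fun τ => τ.reg 30 = t ∧ τ.reg 33 = a ∧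
        τ.reg 2 = σ.reg 2 + 2 ∧ Seg (τ.mem 1) (τ.reg 2) l := by
    intro t a l he
    rw [he, seg_cons, seg_cons] at hseg
    refine Runs.block ?_
    simp only [List.foldl_cons, List.foldl_nil, Instr.run]
    refine ⟨?_, ?_, ?_, ?_⟩
    · simp [hseg.1]
    · simp [hσ.one, hseg.2.1]
    · simp [hσ.one]
    · simpa [hσ.one] using hseg.2.2
  cases nd with
  | ind X x =>
    obtain ⟨hX, hx⟩ := hind X x rfl
    refine ((hstart 0 X [x] rfl).seq (l := 6) ?_).le (by simp [Node.encode])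
    rintro τ₁ ⟨h30, h33, h2, hs⟩ hf₁
    have r₁ := hf₁.ready hσ rfl rfl
    refine Runs.cond (fun h => absurd h30 h) fun _ => Runs.block ?_
    rw [seg_cons, h2] at hs
    have hb := (hT X hX).1
    have hw := (hT X hX).2 x hx
    simp [Instr.run, hs.1, h33, hf₁.mem 3 rfl, hb, hf₁.mem 2 rfl, hw, r₁.one, h2, Node.codeValue,
      Node.encode]
  | param a b =>
    refine ((hstart 1 a [b] rfl).seq (l := 6) ?_).le (by simp [Node.encode])
    rintro τ₁ ⟨h30, h33, h2, hs⟩ hf₁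
    have r₁ := hf₁.ready hσ rfl rfl
    refine Runs.cond (fun _ => ?_) fun h => by omega
    refine (Runs.block (Q := fun τ => τ.reg 30 = 0) (by simp [Instr.run, h30, r₁.one])).seq
      (l := 4) ?_
    intro τ₂ h30₂ hf₂
    have r₂ := hf₂.ready r₁ rfl rfl
    refine Runs.cond (fun h => absurd h30₂ h) fun _ => ?_
    refine (Runs.block (Q := fun τ => τ.reg 2 = σ.reg 2 + 3) ?_).seq (l := 2) ?_
    · simp [Instr.run, r₂.one, hf₂.reg 2 rfl, h2]
    intro τ₃ h2₃ hf₃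
    have h33₃ : τ₃.reg 33 = a := by rw [hf₃.reg 33 rfl, hf₂.reg 33 rfl, h33]
    refine Runs.cond (fun h => ?_) fun h => ?_
    · refine Runs.block ?_
      rw [h33₃] at h
      simp [Instr.run, Node.codeValue, h, h2₃, Node.encode]
    · refine Runs.block ?_
      rw [h33₃] at h
      simp [Instr.run, Node.codeValue, h, h2₃, Node.encode]
  | add cs =>
    refine ((hstart 2 cs.length cs rfl).seq (l := 7 * cs.length + 7) ?_).le
      (by simp [Node.encode]; omega)
    rintro τ₁ ⟨h30, h33, h2, hs⟩ hf₁
    have r₁ := hf₁.ready hσ rfl rfl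
    refine Runs.cond (fun _ => ?_) fun h => by omega
    refine ((Runs.block (Q := fun τ => τ.reg 30 = 1) (by simp [Instr.run, h30, r₁.one])).seq
      (l := 7 * cs.length + 5) ?_).le (by simp; omega)
    intro τ₂ h30₂ hf₂
    have r₂ := hf₂.ready r₁ rfl rfl
    refine Runs.cond (fun _ => ?_) fun h => by omega
    refine ((Runs.block (Q := fun τ => τ.reg 30 = 0) (by simp [Instr.run, h30₂, r₂.one])).seq
      (l := 7 * cs.length + 3) ?_).le (by simp; omega)
    intro τ₃ h30₃ hf₃
    have r₃ := hf₃.ready r₂ rfl rfl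
    refine Runs.cond (fun h => absurd h30₃ h) fun _ => ?_
    refine ((Runs.block (Q := fun τ => τ.reg 32 = 0) (by simp [Instr.run])).seq
      (l := 7 * cs.length + 1) ?_).le (by simp; omega)
    intro τ₄ h32 hf₄
    have h2₄ : τ₄.reg 2 = τ₁.reg 2 := by rw [hf₄.reg 2 rfl, hf₃.reg 2 rfl, hf₂.reg 2 rfl]
    refine (runs_maxLoop cs (hf₄.ready r₃ rfl rfl) (vs := vs) ?_ ?_ ?_).mono le_rfl ?_
    · rw [hf₄.mem 4 rfl, hf₃.mem 4 rfl, hf₂.mem 4 rfl, hf₁.mem 4 rfl, hv]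
    · rw [hf₄.reg 33 rfl, hf₃.reg 33 rfl, hf₂.reg 33 rfl, h33]
    · rw [hf₄.mem 1 rfl, hf₃.mem 1 rfl, hf₂.mem 1 rfl, h2₄]
      exact hs
    · rintro υ ⟨j1, j2⟩
      rw [j1, j2, h32, h2₄, h2]
      exact ⟨rfl, by simp [Node.encode]; omega⟩
  | mul cs =>
    refine ((hstart 3 cs.length cs rfl).seq (l := 9 * cs.length + 7) ?_).le
      (by simp [Node.encode]; omega)
    rintro τ₁ ⟨h30, h33, h2, hs⟩ hf₁
    have r₁ := hf₁.ready hσ rfl rfl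
    refine Runs.cond (fun _ => ?_) fun h => by omega
    refine ((Runs.block (Q := fun τ => τ.reg 30 = 2) (by simp [Instr.run, h30, r₁.one])).seq
      (l := 9 * cs.length + 5) ?_).le (by simp; omega)
    intro τ₂ h30₂ hf₂
    have r₂ := hf₂.ready r₁ rfl rfl
    refine Runs.cond (fun _ => ?_) fun h => by omega
    refine ((Runs.block (Q := fun τ => τ.reg 30 = 1) (by simp [Instr.run, h30₂, r₂.one])).seq
      (l := 9 * cs.length + 3) ?_).le (by simp; omega)
    intro τ₃ h30₃ hf₃
    have r₃ := hf₃.ready r₂ rfl rfl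
    refine Runs.cond (fun _ => ?_) fun h => by omega
    refine ((Runs.block (Q := fun τ => τ.reg 32 = 1) (by simp [Instr.run])).seq
      (l := 9 * cs.length + 1) ?_).le (by simp; omega)
    intro τ₄ h32 hf₄
    have h2₄ : τ₄.reg 2 = τ₁.reg 2 := by rw [hf₄.reg 2 rfl, hf₃.reg 2 rfl, hf₂.reg 2 rfl]
    refine (runs_mulLoop cs (hf₄.ready r₃ rfl rfl) (vs := vs) ?_ ?_ ?_).mono le_rfl ?_
    · rw [hf₄.mem 4 rfl, hf₃.mem 4 rfl, hf₂.mem 4 rfl, hf₁.mem 4 rfl, hv]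
    · rw [hf₄.reg 33 rfl, hf₃.reg 33 rfl, hf₂.reg 33 rfl, h33]
    · rw [hf₄.mem 1 rfl, hf₃.mem 1 rfl, hf₂.mem 1 rfl, h2₄]
      exact hs
    · rintro υ ⟨j1, j2⟩
      rw [j1, j2, h32, h2₄, h2]
      exact ⟨rfl, by simp [Node.encode]; omega⟩

theorem Node.two_le_length_encode (nd : Node) : 2 ≤ nd.encode.length := by
  cases nd <;> simp [Node.encode]

open Instr in
/-- The evaluation of one node. -/
def evalBody : Prog := nodeProg ;; .block [store 4 31 32, add 31 31 48, sub 7 40 2]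

open Instr in
/-- The evaluation of the circuit in the array `1`. -/
def evalProg : Prog := .block [const 2 0, const 31 0, sub 7 40 2] ;; .loop 7 evalBody

/-- Register `7` holds the unread length, since the number of nodes is not known beforehand. A node
costs `9` steps per number plus at most `4`; every node is encoded by at least two numbers, which
gives `11` per number. -/
theorem runs_evalLoop (rest : Circuit) {done : Circuit} {σ : State} (hσ : Ready σ)
    {D K : ℕ} {card : ℕ → ℕ} {ω : ℕ → ℕ → ℕ} (hT : Tabulated D card ω K σ)
    (hv : σ.mem 4 = fun i => (Circuit.codes done ω).getD i 0) (h31 : σ.reg 31 = done.length)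
    (hind : ∀ X x, Node.ind X x ∈ rest → X < K ∧ x < card X)
    (hseg : Seg (σ.mem 1) (σ.reg 2) rest.encode)
    (h40 : σ.reg 40 = σ.reg 2 + rest.encode.length) (h7 : σ.reg 7 = rest.encode.length) :
    Runs (.loop 7 evalBody) σ (11 * rest.encode.length + 1) fun τ =>
      τ.mem 4 = (fun i => (Circuit.codes (done ++ rest) ω).getD i 0) ∧
      τ.reg 31 = (done ++ rest).length := by
  induction rest generalizing σ done with
  | nil => exact Runs.loop_done (by simpa [Circuit.encode] using h7) (by simpa using ⟨hv, h31⟩)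
  | cons nd rest ih =>
    have henc : Circuit.encode (nd :: rest) = nd.encode ++ Circuit.encode rest := rfl
    rw [henc, seg_append] at hseg
    rw [henc, List.length_append] at h40 h7
    have h2le := nd.two_le_length_encode
    have hcode : Circuit.codes (done ++ [nd]) ω = Circuit.codes done ω ++
        [nd.codeValue ω (Circuit.codes done ω)] := bottomUp_append_singleton _ _ _
    have hlen : (Circuit.codes done ω).length = done.length := length_bottomUp _ _
    refine (Runs.loop_step (by omega) (k := 9 * nd.encode.length + 3) (Q' := fun τ =>
      τ.mem 4 = (fun i => (Circuit.codes (done ++ [nd]) ω).getD i 0) ∧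
      τ.reg 31 = (done ++ [nd]).length ∧ τ.reg 2 = σ.reg 2 + nd.encode.length ∧
      τ.reg 7 = σ.reg 40 - (σ.reg 2 + nd.encode.length)) ?_
      (l := 11 * (Circuit.encode rest).length + 1) ?_).le
      (by rw [henc, List.length_append]; omega)
    · refine (runs_nodeProg hσ hv hT (fun X x h => hind X x (by simp [h])) hseg.1).seq (l := 3) ?_
      rintro τ₁ ⟨h32, h2⟩ hf₁
      have r₁ := hf₁.ready hσ rfl rfl
      refine Runs.block ?_
      simp only [List.foldl_cons, List.foldl_nil, Instr.run]
      refine ⟨?_, ?_, ?_, ?_⟩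
      · simp only [Function.update_self]
        rw [hf₁.mem 4 rfl, hv, hf₁.reg 31 rfl, h31, h32, hcode, ← hlen, update_getD]
      · simp [hf₁.reg 31 rfl, h31, r₁.one]
      · simpa using h2
      · simp [hf₁.reg 40 rfl, h2]
    · rintro τ ⟨i1, i2, i3, i4⟩ hf
      have h := ih (done := done ++ [nd]) (hf.ready hσ rfl rfl)
        (hT.congr (hf.mem 3 rfl) (hf.mem 2 rfl)) i1 i2 (fun X x h => hind X x (by simp [h]))
        (by rw [hf.mem 1 rfl, i3]; exact hseg.2) (by rw [hf.reg 40 rfl, i3]; omega)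
        (by rw [i4]; omega)
      simpa using h

theorem runs_evalProg (C : Circuit) {σ : State} (hσ : Ready σ) {D K : ℕ} {card : ℕ → ℕ}
    {ω : ℕ → ℕ → ℕ} (hT : Tabulated D card ω K σ) (h4 : σ.mem 4 = fun _ => 0)
    (hind : ∀ X x, Node.ind X x ∈ C → X < K ∧ x < card X)
    (h1 : σ.mem 1 = fun i => C.encode.getD i 0) (h40 : σ.reg 40 = C.encode.length) :
    Runs evalProg σ (11 * C.encode.length + 4) fun τ =>
      τ.mem 4 (C.length - 1) = C.rootCode ω ∧ τ.reg 31 = C.length := by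
  refine ((Runs.block (Q := fun τ => τ.reg 2 = 0 ∧ τ.reg 31 = 0 ∧ τ.reg 7 = C.encode.length)
    ?_).seq (l := 11 * C.encode.length + 1) ?_).le (by simp; omega)
  · simp [Instr.run, h40]
  rintro τ ⟨h2, h31, h7⟩ hf
  refine (runs_evalLoop C (done := []) (hf.ready hσ rfl rfl)
    (hT.congr (hf.mem 3 rfl) (hf.mem 2 rfl)) ?_ h31 hind ?_ ?_ h7).mono le_rfl ?_
  · rw [hf.mem 4 rfl, h4]
    funext i
    simp [Circuit.codes, bottomUp]
  · rw [hf.mem 1 rfl, h1, h2]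
    exact seg_getD _
  · rw [hf.reg 40 rfl, h40, h2, zero_add]
  · rintro υ ⟨i1, i2⟩
    rw [i1]
    exact ⟨rfl, by simpa using i2⟩

/-! ## Reading off the explanation -/

open Instr in
/-- Writing the digits of the code of the root. -/
def decodeBody : Prog :=
  .block [add 33 32 47, add 8 5 47] ;; .loop 8 (.block [half 33 33, sub 8 8 48]) ;;
  .block [add 34 33 47, add 8 5 47] ;; shiftProg 34 8 ;;
  .block [sub 34 32 34, emit 34, add 32 33 47, sub 7 7 48]

open Instr in
/-- Writing the explanation. -/
def decodeProg : Prog :=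
  .block [sub 31 31 48, load 32 4 31, sub 32 32 48, add 7 3 47] ;; .loop 7 decodeBody

/-- The remainder modulo `2 ^ s` is found by `s` halvings, `s` doublings of the quotient and a
subtraction. -/
theorem runs_decodeBody {M : Model} {σ : State} (hσ : Env M σ) :
    Runs decodeBody σ (6 * M.size + 10) fun τ => τ.reg 7 = σ.reg 7 - 1 ∧
      τ.reg 32 = σ.reg 32 / 2 ^ M.size ∧ τ.out = σ.out ++ [σ.reg 32 % 2 ^ M.size] := by
  refine ((Runs.block (Q := fun τ => τ.reg 33 = σ.reg 32 ∧ τ.reg 8 = M.size) ?_).seq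
    (l := 6 * M.size + 8) ?_).le (by simp; omega)
  · simp [Instr.run, hσ.ready.zero, hσ.size]
  rintro τ₁ ⟨h33, h8⟩ hf₁
  have e₁ := hf₁.env hσ rfl
  refine ((Runs.loop_up (c := 2) (fun i τ => τ.reg 33 = σ.reg 32 / 2 ^ i) h8 (by simpa using h33)
    ?_).seq (l := 3 * M.size + 7) ?_).le (by omega)
  · intro i τ hi hf hr hI
    refine Runs.block ?_
    have r := hf.ready e₁.ready rfl rfl
    simp [Instr.run, r.one, hr, hI, Nat.div_div_eq_div_mul, pow_succ]
  intro τ₂ h33₂ hf₂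
  have e₂ := hf₂.env e₁ rfl
  refine ((Runs.block (Q := fun τ => τ.reg 34 = σ.reg 32 / 2 ^ M.size ∧ τ.reg 8 = M.size)
    ?_).seq (l := 3 * M.size + 5) ?_).le (by simp; omega)
  · simp [Instr.run, e₂.ready.zero, e₂.size, h33₂]
  rintro τ₃ ⟨h34, h8₃⟩ hf₃
  have e₃ := hf₃.env e₂ rfl
  refine ((runs_shiftProg (d := 34) (c := 8) (by norm_num) (by norm_num) e₃.ready.one h8₃).seq
    (l := 4) ?_).le (by omega)
  intro τ₄ h34₄ hf₄
  rw [h34] at h34₄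
  have e₄ := hf₄.env e₃ rfl
  have h32 : τ₄.reg 32 = σ.reg 32 := by
    rw [hf₄.reg 32 rfl, hf₃.reg 32 rfl, hf₂.reg 32 rfl, hf₁.reg 32 rfl]
  have h33₄ : τ₄.reg 33 = σ.reg 32 / 2 ^ M.size := by
    rw [hf₄.reg 33 rfl, hf₃.reg 33 rfl, h33₂]
  have h7 : τ₄.reg 7 = σ.reg 7 := by
    rw [hf₄.reg 7 rfl, hf₃.reg 7 rfl, hf₂.reg 7 rfl, hf₁.reg 7 rfl]
  have hout : τ₄.out = σ.out := by
    rw [hf₄.out rfl, hf₃.out rfl, hf₂.out rfl, hf₁.out rfl]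
  refine Runs.block ?_
  have hmod := Nat.mod_eq_sub_div_mul (x := σ.reg 32) (k := 2 ^ M.size)
  simp [Instr.run, h32, h33₄, h34₄, h7, hout, e₄.ready.one, e₄.ready.zero, hmod]

theorem runs_decodeProg {M : Model} {σ : State} (hσ : Env M σ) {V k : ℕ}
    (h31 : σ.reg 31 = k) (h4 : σ.mem 4 (k - 1) = V) (hout : σ.out = []) :
    Runs decodeProg σ (M.dom.length * (6 * M.size + 11) + 5) fun τ =>
      τ.out = (List.range M.dom.length).map fun X => (V - 1) / 2 ^ (M.size * X) % 2 ^ M.size := by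
  refine ((Runs.block (Q := fun τ => τ.reg 32 = V - 1 ∧ τ.reg 7 = M.dom.length) ?_).seq
    (l := M.dom.length * (6 * M.size + 11) + 1) ?_).le (by simp; omega)
  · simp [Instr.run, h31, hσ.ready.one, hσ.ready.zero, h4, hσ.vars]
  rintro τ₁ ⟨h32, h7⟩ hf₁
  have e₁ := hf₁.env hσ rfl
  refine (Runs.loop_up (c := 6 * M.size + 10) (fun X τ =>
    τ.reg 32 = (V - 1) / 2 ^ (M.size * X) ∧ τ.out = (List.range X).map fun X =>
      (V - 1) / 2 ^ (M.size * X) % 2 ^ M.size) h7 ?_ ?_).mono le_rfl fun τ h => h.2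
  · simp [h32, hf₁.out rfl, hout]
  · rintro X τ hX hf hr ⟨i1, i2⟩
    refine (runs_decodeBody (hf.env e₁ rfl)).mono le_rfl ?_
    rintro υ ⟨j1, j2, j3⟩
    refine ⟨by omega, ?_, ?_⟩
    · rw [j2, i1, Nat.div_div_eq_div_mul, ← pow_add, Nat.mul_succ]
    · rw [j3, i1, i2, List.range_succ]
      simp

end ArithCirc

namespace ArithCirc

/-! ## The algorithm -/

/-- A circuit for the marginals of an expanded model has an indicator for every value of the dummy
variable. -/
theorem Model.le_length_of_computesMarginals {M : Model} {D j : ℕ} (hM : M.WF) {C : Circuit}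
    (hC : C.WF (M.expand D j)) (hd : C.Decomposable) (hs : C.Smooth (M.expand D j))
    (hm : C.ComputesMarginals (M.expand D j)) : D ≤ C.length := by
  have hsub : (List.range D).map (Node.ind (M.dom.length + M.factors.length)) ⊆ C := by
    intro nd hnd
    obtain ⟨z, hz, rfl⟩ := List.mem_map.1 hnd
    -- Any instantiation of `M`, here the all-zero one, extends to the support with the dummy equal
    -- to `z`, whatever the factors of `M` are; so the indicator of `z` must occur.
    obtain ⟨y, hy, -, hyz⟩ := Model.exists_extension (j := j) hM
      (fun X => ⟨0, Model.card_pos_of_lt hM X.2⟩) (List.mem_range.1 hz)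
    have h := (Circuit.prod_le_root hC hd hs hm (fun _ _ => 0) y hy).1
      (M.dom.length + M.factors.length) (by simp [Model.expand_dom_length])
    rwa [hyz] at h
  have hnd : ((List.range D).map (Node.ind (M.dom.length + M.factors.length))).Nodup :=
    List.nodup_range.map fun a b h => (Node.ind.inj h).2
  simpa using (hnd.subperm hsub).length_le

theorem Circuit.length_le_length_encode (C : Circuit) : C.length ≤ C.encode.length := by
  induction C with
  | nil => simp
  | cons nd C ih =>
    have := nd.two_le_length_encode
    simp only [Circuit.encode, List.flatMap_cons, List.length_append, List.length_cons] at ih ⊢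
    omega

theorem Sim.env {M : Model} {τ₀ σ τ : State} (h : Sim τ₀ σ τ) (e : Env M τ₀) : Env M τ := by
  have hr : ∀ r < 40, τ.reg r = τ₀.reg r := fun r hr => h.low r (by omega) (by omega)
  refine ⟨⟨?_, ?_⟩, ?_, ?_, ?_, ?_, ?_, ?_, ?_, ?_, ?_⟩
  · rw [h.low 47 (by norm_num) (by norm_num), e.ready.zero]
  · rw [h.low 48 (by norm_num) (by norm_num), e.ready.one]
  · rw [hr 3 (by norm_num), e.vars]
  · rw [hr 4 (by norm_num), e.facs]
  · rw [hr 5 (by norm_num), e.size]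
  · rw [hr 6 (by norm_num), e.dummy]
  · rw [hr 22 (by norm_num), e.thr]
  · rw [hr 24 (by norm_num), e.prec]
  · rw [hr 25 (by norm_num), e.rounds]
  · rw [hr 27 (by norm_num), e.big]
  · rw [h.lowMem 0 (by norm_num) (by norm_num), e.input]

/-- From a compiler to an algorithm for most probable explanations. -/
def mpeProg (Ξ : Prog) : Prog := preProg ;; Ξ.shift ;; evalProg ;; decodeProg

theorem exec_mpeProg {Ξ : Prog} {M : Model} (hM : M.WF) {σ : State} {k : ℕ}
    (hΞ : Exec Ξ (State.init M.target.encode) σ k) (hspec : CompilationSpec M.target σ.out) :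
    ∃ τ l, Exec (mpeProg Ξ) (State.init M.encode) τ l ∧ MPESpec M τ.out ∧ l ≤ 2100 * k := by
  obtain ⟨C, hout, hC, hd, hs, hm⟩ := hspec
  -- The chain `s ^ 4 ≤` number of nodes `≤` output length `≤ k` turns every cost polynomial in `s`
  -- into a multiple of the compiler's own time.
  have hDk : M.size ^ 4 ≤ C.length := Model.le_length_of_computesMarginals hM hC hd hs hm
  have hCe := C.length_le_length_encode
  have hek : C.encode.length ≤ k := by
    have := hΞ.out_length_le
    rw [hout] at this
    simpa [State.init] using this
  obtain ⟨τ₀, k₀, he₀, hk₀, ⟨e₀, hw, hT⟩, hf₀⟩ := (runs_preProg hM).frame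
  obtain ⟨τ₁, k₁, he₁, hk₁, h₁⟩ := exec_shift hΞ e₀.ready.one (sim_init hf₀ hw)
  have e₁ := h₁.env e₀
  have hT₁ := hT.congr (h₁.lowMem 3 (by norm_num) (by norm_num))
    (h₁.lowMem 2 (by norm_num) (by norm_num))
  have h4 : τ₁.mem 4 = fun _ => 0 := by
    rw [h₁.lowMem 4 (by norm_num) (by norm_num), hf₀.mem 4 rfl]
    simp [State.init]
  have hind : ∀ X x, Node.ind X x ∈ C →
      X < M.dom.length + M.factors.length + 1 ∧ x < M.target.card X := fun X x hX => by
    have h := hC.ind_lt X x hX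
    rwa [Model.target, Model.expand_dom_length] at h
  obtain ⟨τ₂, k₂, he₂, hk₂, ⟨hV, h31⟩, hf₂⟩ := (runs_evalProg C e₁.ready hT₁ h4 hind
    (by rw [h₁.arr, hout]) (by rw [h₁.cnt, hout])).frame
  have hout₂ : τ₂.out = [] := by
    rw [hf₂.out rfl, h₁.out, hf₀.out rfl]
    rfl
  obtain ⟨τ₃, k₃, he₃, hk₃, hτ⟩ := runs_decodeProg (hf₂.env e₁ rfl) h31 hV hout₂
  refine ⟨τ₃, _, .seq he₀ (.seq he₁ (.seq he₂ he₃)), ?_, ?_⟩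
  · obtain ⟨x, hx, hdig⟩ := Model.exists_isMPE hM M.dummy_pos hC hd hs hm
    refine ⟨x, ?_, hx⟩
    rw [hτ]
    exact List.ext_getElem (by simp) fun i _ _ => by simp [hdig]
  -- The total is at most `2000 * s ^ 4` for preprocessing, `2 * k` for the simulation, `11 * k + 4`
  -- for the evaluation and a quadratic term for the digits.
  · have hsize := M.two_le_size
    obtain ⟨p1, p2, p3⟩ := power_bounds hsize
    have hm' : M.dom.length * (6 * M.size + 11) ≤ 6 * (M.size * M.size) + 11 * M.size :=
      (Nat.mul_le_mul_right _ M.length_dom_le).trans_eq (by ring)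
    omega

end ArithCirc

theorem mainTheorem7 :
    ∃ p : Polynomial ℕ, ∀ (Ξ : ArithCirc.Prog) (t : ℕ → ℝ),
      ArithCirc.SolvesInTime ArithCirc.CompilationSpec Ξ t →
        ∃ A : ArithCirc.Prog,
          ArithCirc.SolvesInTime ArithCirc.MPESpec A (fun s => t (p.eval s)) := by
  -- The polynomial is the exact size of the compiled model, independent of `Ξ` and `t`.
  refine ⟨Polynomial.C 64 * Polynomial.X ^ 4, fun Ξ t ⟨T, hT, ht⟩ =>
    ⟨ArithCirc.mpeProg Ξ, fun s => 2100 * T (64 * s ^ 4), fun M hM => ?_, ?_⟩⟩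
  · obtain ⟨σ, k, he, hspec, hk⟩ := hT M.target (ArithCirc.Model.target_wf hM)
    obtain ⟨τ, l, he', hspec', hl⟩ := ArithCirc.exec_mpeProg hM he hspec
    rw [M.target_size] at hk
    exact ⟨τ, l, he', hspec', hl.trans (Nat.mul_le_mul_left _ hk)⟩
  -- The asymptotic bound for `T` transfers to the arguments `64 * s ^ 4` because these tend to
  -- infinity.
  · have hp : Filter.Tendsto (fun s : ℕ => 64 * s ^ 4) Filter.atTop Filter.atTop :=
      Filter.tendsto_atTop_mono (fun s => (Nat.le_self_pow (by norm_num) s).trans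
        (Nat.le_mul_of_pos_left _ (by norm_num))) Filter.tendsto_id
    simpa [Function.comp_def] using (ht.comp_tendsto hp).const_mul_left (2100 : ℝ)
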